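/- Let $(M,g)$ be a smooth Riemannian manifold of dimension $n\ge 2$, let $\mathbb D\subset\mathbb C$ be the open unit disc and $\mathbb B^n\subset\mathbb R^n$ the open unit ball. A smooth map $u:\mathbb D\to M$ is a *conformal harmonic disc* if it is harmonic (in local coordinates $\Delta u^i+\Gamma^i_{jk}(u)(u^j_xu^k_x+u^j_yu^k_y)=0$) and conformal, that is $|u_x|_g=|u_y|_g$ and $\langle u_x,u_y\rangle_g=0$ (zeros of $du$ are allowed). An upper semicontinuous function $\rho:V\to[-\infty,\infty)$ on an open set $V\subset M$ is *MPSH* if $\rho\circ u$ is subharmonic on $\mathbb D$ (the function $-\infty$ being allowed) for every immersed conformal harmonic disc $u:\mathbb D\to V$. A $C^2$ function $\varphi:V\to\mathbb R$ is *strictly MPSH* if for every $q\in V$ there are normal coordinates $y$ centred at $q$ and $c>0$ such that $\varphi-c|y|^2$ is MPSH in a neighbourhood of $q$. For a domain (connected open set) $D\subset M$, $w\in D$ and $\xi\in T_wM$, the Kobayashi–Royden pseudometric is $$F_D(w,\xi)=\inf\{\alpha>0:\ \text{there is a conformal harmonic disc } u:\mathbb D\to D \text{ with } u(0)=w,\ du(0)e_1=\alpha^{-1}\xi\},\qquad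 e_1=(1,0).$$ **Theorem.** Let $p\in M$ and let $x:U\to 3\mathbb B^n$ be a normal coordinate chart of $M$ centred at $p$ (a diffeomorphism of the open set $U$ onto $3\mathbb B^n$ with $x(p)=0$), with $U$ small enough that $|x|^2$ is strictly MPSH on $U$. For all $\varepsilon,B>0$ there is a constant $C>0$, depending only on $\varepsilon$, $B$ and on $(M,g)$ and the chart $x$, with the following property. Let $D\subset M$ be a domain with $p\in D$ and let $\rho$ be a negative MPSH function on $D$ such that $\rho-\varepsilon|x|^2$ is MPSH on $D\cap U$ and $|\rho|\le B$ on $D\cap x^{-1}(2\mathbb B^n)$. Then for every $w\in D\cap x^{-1}(\mathbb B^n)$ and every $\xi\in T_wM$ $$F_D(w,\xi)\ \ge\ C\,|\xi|\,|\rho(w)|^{-1/2},$$ both for $|\xi|$ the Riemannian norm of $\xi$ and for $|\xi|$ the Euclidean norm of $dx_w(\xi)$. No boundedness or hyperbolicity of $D$ is assumed, and $U$ need not be contained in $D$. -/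

import Mathlib

open scoped Manifold ContDiff

noncomputable section

namespace ConformalDiscs

section Metric

variable {n : ℕ} {M : Type*} [TopologicalSpace M] [ChartedSpace (EuclideanSpace ℝ (Fin n)) M]
  [IsManifold (𝓡 n) ∞ M]

/-- A smooth Riemannian metric on the `n`-dimensional smooth manifold `M`. -/
abbrev Metric (n : ℕ) (M : Type*) [TopologicalSpace M]
    [ChartedSpace (EuclideanSpace ℝ (Fin n)) M] [IsManifold (𝓡 n) ∞ M] :=
  Bundle.ContMDiffRiemannianMetric (𝓡 n) ∞ (EuclideanSpace ℝ (Fin n))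
    (fun p : M => TangentSpace (𝓡 n) p)

/-- The coordinate vector field `∂/∂y_j` of the chart `e`, at the point with coordinates `y`. -/
def coordVec (e : OpenPartialHomeomorph M (EuclideanSpace ℝ (Fin n)))
    (y : EuclideanSpace ℝ (Fin n)) (j : Fin n) : TangentSpace (𝓡 n) (e.symm y) :=
  mfderiv (𝓡 n) (𝓡 n) e.symm y (EuclideanSpace.single j (1 : ℝ))

/-- The matrix `(g_jk)` of the metric in the chart `e`, as a function of the coordinates. -/
def metricMatrix (g : Metric n M) (e : OpenPartialHomeomorph M (EuclideanSpace ℝ (Fin n)))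
    (y : EuclideanSpace ℝ (Fin n)) : Matrix (Fin n) (Fin n) ℝ :=
  Matrix.of fun j k => g.inner (e.symm y) (coordVec e y j) (coordVec e y k)

/-- The partial derivative `∂ g_jk / ∂ y_l` in the chart `e`. -/
def metricDeriv (g : Metric n M) (e : OpenPartialHomeomorph M (EuclideanSpace ℝ (Fin n)))
    (y : EuclideanSpace ℝ (Fin n)) (l j k : Fin n) : ℝ :=
  fderiv ℝ (fun y' => metricMatrix g e y' j k) y (EuclideanSpace.single l (1 : ℝ))

/-- The Christoffel symbol `Γ^i_jk` of the Levi-Civita connection in the chart `e`, at the point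
with coordinates `y`. -/
def christoffel (g : Metric n M) (e : OpenPartialHomeomorph M (EuclideanSpace ℝ (Fin n)))
    (y : EuclideanSpace ℝ (Fin n)) (i j k : Fin n) : ℝ :=
  (1 / 2 : ℝ) * ∑ l, (metricMatrix g e y)⁻¹ i l *
    (metricDeriv g e y j k l + metricDeriv g e y k j l - metricDeriv g e y l j k)

/-- `e` is a normal coordinate chart centred at `p` onto the open ball of radius `R` in `ℝⁿ`:
it is a smooth chart sending `p` to `0`, the coordinate frame is orthonormal at `p`, and every
radial curve `t ↦ e⁻¹(t v)` is a geodesic (its coordinates have vanishing second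
derivative, so this is the vanishing of `Γ^i_jk(t v) v_j v_k`). In other words, `e` is the inverse
of the exponential map at `p` composed with a linear isometry `T_p M ≅ ℝⁿ`. -/
structure IsNormalChart (g : Metric n M) (p : M)
    (e : OpenPartialHomeomorph M (EuclideanSpace ℝ (Fin n))) (R : ℝ) : Prop where
  mem_atlas : e ∈ IsManifold.maximalAtlas (𝓡 n) ∞ M
  target_eq : e.target = Metric.ball 0 R
  mem_source : p ∈ e.source
  map_center : e p = 0
  orthonormal : metricMatrix g e 0 = 1
  radial_geodesic : ∀ (v : EuclideanSpace ℝ (Fin n)) (t : ℝ), t • v ∈ e.target →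
    ∀ i, ∑ j, ∑ k, christoffel g e (t • v) i j k * v j * v k = 0

/-- The components `dx_w(ξ) ∈ ℝⁿ` of the tangent vector `ξ` at `w` in the chart `e`. -/
def coordComponents (e : OpenPartialHomeomorph M (EuclideanSpace ℝ (Fin n))) (w : M)
    (ξ : TangentSpace (𝓡 n) w) : EuclideanSpace ℝ (Fin n) :=
  mfderiv (𝓡 n) (𝓡 n) e w ξ

/-- The derivative of the disc `u` at `z` in the direction `a` of `ℂ = ℝ²`. -/
def discDeriv (u : ℂ → M) (z a : ℂ) : TangentSpace (𝓡 n) (u z) :=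
  mfderiv 𝓘(ℝ, ℂ) (𝓡 n) u z a

/-- The Euler-Lagrange equation of the energy at the point `z`, in all local coordinates:
`Δ u^i + Γ^i_jk(u) (∂_x u^j ∂_x u^k + ∂_y u^j ∂_y u^k) = 0`. -/
def HarmonicMapAt (g : Metric n M) (u : ℂ → M) (z : ℂ) : Prop :=
  ∀ e ∈ IsManifold.maximalAtlas (𝓡 n) ∞ M, u z ∈ e.source → ∀ i : Fin n,
    Laplacian.laplacian (fun ζ => e (u ζ) i) z +
      ∑ j, ∑ k, christoffel g e (e (u z)) i j k *
        (fderiv ℝ (fun ζ => e (u ζ) j) z 1 * fderiv ℝ (fun ζ => e (u ζ) k) z 1 +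
          fderiv ℝ (fun ζ => e (u ζ) j) z Complex.I *
            fderiv ℝ (fun ζ => e (u ζ) k) z Complex.I) = 0

/-- `u` restricts to a conformal harmonic disc `𝔻 → V`. Only the values of `u` on the open unit
disc matter. Conformality means `|u_x| = |u_y|` and `⟨u_x, u_y⟩ = 0`; as for holomorphic discs,
zeros of the differential are allowed. -/
structure IsConformalHarmonicDisc (g : Metric n M) (V : Set M) (u : ℂ → M) : Prop where
  mapsTo : Set.MapsTo u (Metric.ball 0 1) V
  smooth : ContMDiffOn 𝓘(ℝ, ℂ) (𝓡 n) ∞ u (Metric.ball 0 1)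
  conformal_norm : ∀ z ∈ Metric.ball (0 : ℂ) 1,
    g.inner (u z) (discDeriv u z 1) (discDeriv u z 1) =
      g.inner (u z) (discDeriv u z Complex.I) (discDeriv u z Complex.I)
  conformal_orthogonal : ∀ z ∈ Metric.ball (0 : ℂ) 1,
    g.inner (u z) (discDeriv u z 1) (discDeriv u z Complex.I) = 0
  harmonic : ∀ z ∈ Metric.ball (0 : ℂ) 1, HarmonicMapAt g u z

/-- A conformal harmonic disc in `V` that is an immersion. -/
structure IsImmersedConformalHarmonicDisc (g : Metric n M) (V : Set M) (u : ℂ → M) : Prop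
    extends IsConformalHarmonicDisc g V u where
  immersion : ∀ z ∈ Metric.ball (0 : ℂ) 1, Function.Injective (mfderiv 𝓘(ℝ, ℂ) (𝓡 n) u z)

end Metric

/-- `f` is subharmonic on the open set `Ω` of the plane: upper semicontinuous with values in
`[-∞, ∞)`, and satisfying the sub-mean value inequality on each circle bounding a closed disc in
`Ω`. The mean of `f` over the circle, which may be `-∞`, is the infimum of the means of the
continuous functions `φ ≥ f` on the circle, by upper semicontinuity. The function `-∞` is
allowed. -/
structure IsSubharmonicOn (f : ℂ → EReal) (Ω : Set ℂ) : Prop where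
  usc : UpperSemicontinuousOn f Ω
  lt_top : ∀ z ∈ Ω, f z < ⊤
  le_mean : ∀ (c : ℂ) (r : ℝ), 0 < r → Metric.closedBall c r ⊆ Ω →
    ∀ φ : ℂ → ℝ, ContinuousOn φ (Metric.sphere c r) →
      (∀ z ∈ Metric.sphere c r, f z ≤ (φ z : EReal)) → f c ≤ ((Real.circleAverage φ c r : ℝ) : EReal)

section MPSH

variable {n : ℕ} {M : Type*} [TopologicalSpace M] [ChartedSpace (EuclideanSpace ℝ (Fin n)) M]
  [IsManifold (𝓡 n) ∞ M]

/-- `ρ` is minimal plurisubharmonic (MPSH) on the open set `V`. -/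
structure IsMPSHOn (g : Metric n M) (ρ : M → EReal) (V : Set M) : Prop where
  usc : UpperSemicontinuousOn ρ V
  lt_top : ∀ q ∈ V, ρ q < ⊤
  subharmonic : ∀ u : ℂ → M, IsImmersedConformalHarmonicDisc g V u →
    IsSubharmonicOn (fun z => ρ (u z)) (Metric.ball 0 1)

/-- The `C²` function `φ` is strictly MPSH on the open set `V`: for each `q ∈ V` there are normal
coordinates `y` centred at `q` and `c > 0` such that `φ - c |y|²` is MPSH near `q`. -/
structure IsStrictlyMPSHOn (g : Metric n M) (φ : M → ℝ) (V : Set M) : Prop where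
  contMDiffOn : ContMDiffOn (𝓡 n) 𝓘(ℝ, ℝ) 2 φ V
  strict : ∀ q ∈ V, ∃ (y : OpenPartialHomeomorph M (EuclideanSpace ℝ (Fin n))) (R : ℝ),
    IsNormalChart g q y R ∧ ∃ c : ℝ, 0 < c ∧ ∃ W : Set M, IsOpen W ∧ q ∈ W ∧
      W ⊆ V ∩ y.source ∧ IsMPSHOn g (fun w => ((φ w - c * ‖y w‖ ^ 2 : ℝ) : EReal)) W

/-- The Kobayashi-Royden pseudometric `F_D(w, ξ)`: the infimum of the `α > 0` for which there is a
conformal harmonic disc `u : 𝔻 → D` with `u(0) = w` and `du(0) e₁ = α⁻¹ ξ` (an equality of tangent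
vectors, that is, of points of the tangent bundle). -/
def kobayashiRoyden (g : Metric n M) (D : Set M) (w : M) (ξ : TangentSpace (𝓡 n) w) : ENNReal :=
  ⨅ (α : ℝ) (_ : 0 < α) (_ : ∃ u : ℂ → M, IsConformalHarmonicDisc g D u ∧
      (⟨u 0, discDeriv u 0 1⟩ : TangentBundle (𝓡 n) M) = ⟨w, α⁻¹ • ξ⟩),
    ENNReal.ofReal α

end MPSH

end ConformalDiscs

end

/-! A competitor α in the definition of F_D(w, ξ) comes from a disc u with u(0) = w whose conformal
factor e = |u_x|² satisfies e(0) = |ξ|²/α². So it suffices to prove e(0) ≤ C |ρ(w)| for every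
conformal harmonic disc u in D centred at w; this is `exists_conformalFactor_le`.

The bound is obtained by Sibony's method. Let s be the squared distance to w in the chart x,
measured in the metric frozen at w, and let θ = `poleProfile κ`. The function θ(s/δ²) has a
logarithmic pole at w, vanishes where s ≥ δ², and along u its Laplacian is at least -104 e/δ². Since
|x|² is strictly MPSH, the Laplacian of |x|² along u dominates e. As ρ - ε|x|² is MPSH, adding lam·ρ
with lam of order 1/δ² therefore compensates the negative Laplacian. The sum is nonpositive along u
and grows at most like log|z|² at 0, so a maximum principle gives θ(s/δ²) + lam·ρ ≤ log|z|². As z →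
0, s(u(z)) ~ e(0)|z|², whence log e(0) ≤ log δ² + const + lam·|ρ(w)|. Taking δ² proportional to
|ρ(w)| keeps the last term constant, and δ² supplies the factor |ρ(w)|.

Three points need care. Freezing the metric makes a relative error of order √s, so the Laplacian of
log s along u is only bounded below by a negative multiple of e/√s; the √t term of θ cancels this
(`exists_frozen_distance_bounds`, `poleProfile_laplacian_lower`).

MPSH functions are tested on immersed discs only, whereas e may have zeros. A small multiple of log
e is added: it is -∞ at these zeros, and Bochner's formula bounds its Laplacian below on compact
sets (`laplacian_log_conformalFactor_bound`). The multiple tends to 0 at the end of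
`schwarz_maximum_principle`.

Finally, ρ is only upper semicontinuous and may be -∞ away from the chart. It is truncated at -B and
never smoothed: only its sub-mean value property on small circles is used, in sums with C²
functions. -/

noncomputable section

namespace ConformalDiscs

open Filter Topology Metric Laplacian InnerProductSpace

/-! ### Laplacians, circle averages and the sub-mean value property in the plane. -/

section Planar

variable {E F : Type*} [NormedAddCommGroup E] [NormedSpace ℝ E] [NormedAddCommGroup F]
  [NormedSpace ℝ F]

theorem laplacian_eq_fderiv_fderiv (f : ℂ → F) (z : ℂ) :
    Δ f z = fderiv ℝ (fderiv ℝ f) z 1 1 + fderiv ℝ (fderiv ℝ f) z Complex.I Complex.I := by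
  rw [laplacian_eq_iteratedFDeriv_complexPlane]
  simp [iteratedFDeriv_two_apply]

theorem fderiv_fderiv_comp {φ : E → F} {X : ℂ → E} {z : ℂ} (hφ : ContDiffAt ℝ 2 φ (X z))
    (hX : ContDiffAt ℝ 2 X z) (a b : ℂ) :
    fderiv ℝ (fderiv ℝ fun ζ => φ (X ζ)) z a b =
      fderiv ℝ (fderiv ℝ φ) (X z) (fderiv ℝ X z a) (fderiv ℝ X z b) +
        fderiv ℝ φ (X z) (fderiv ℝ (fderiv ℝ X) z a b) := by
  have hφ1 : ContDiffAt ℝ 1 (fderiv ℝ φ) (X z) := hφ.fderiv_right (by norm_num)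
  have hX1 : ContDiffAt ℝ 1 (fderiv ℝ X) z := hX.fderiv_right (by norm_num)
  have hXd : DifferentiableAt ℝ X z := hX.differentiableAt (by norm_num)
  have hev : (fderiv ℝ fun ζ => φ (X ζ)) =ᶠ[𝓝 z]
      fun ζ => (fderiv ℝ φ (X ζ)).comp (fderiv ℝ X ζ) := by
    have h1 : ∀ᶠ ζ in 𝓝 z, DifferentiableAt ℝ X ζ := by
      filter_upwards [hX.eventually (by norm_num)] with ζ h using h.differentiableAt (by norm_num)
    have h2 : ∀ᶠ ζ in 𝓝 z, DifferentiableAt ℝ φ (X ζ) := by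
      filter_upwards [hX.continuousAt.eventually (hφ.eventually (by norm_num))] with ζ h
        using h.differentiableAt (by norm_num)
    filter_upwards [h1, h2] with ζ h1 h2 using fderiv_fun_comp ζ h2 h1
  have hc : HasFDerivAt (fun ζ => fderiv ℝ φ (X ζ))
      ((fderiv ℝ (fderiv ℝ φ) (X z)).comp (fderiv ℝ X z)) z :=
    (hφ1.differentiableAt (by norm_num)).hasFDerivAt.comp z hXd.hasFDerivAt
  have hd := hc.clm_comp (hX1.differentiableAt (by norm_num)).hasFDerivAt
  rw [hev.fderiv_eq, hd.fderiv]
  simp [add_comm]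

theorem laplacian_comp {φ : E → F} {X : ℂ → E} {z : ℂ} (hφ : ContDiffAt ℝ 2 φ (X z))
    (hX : ContDiffAt ℝ 2 X z) :
    Δ (fun ζ => φ (X ζ)) z =
      fderiv ℝ (fderiv ℝ φ) (X z) (fderiv ℝ X z 1) (fderiv ℝ X z 1) +
        fderiv ℝ (fderiv ℝ φ) (X z) (fderiv ℝ X z Complex.I) (fderiv ℝ X z Complex.I) +
        fderiv ℝ φ (X z) (Δ X z) := by
  simp only [laplacian_eq_fderiv_fderiv, fderiv_fderiv_comp hφ hX, map_add]
  abel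

theorem laplacian_real_comp {θ : ℝ → ℝ} {s : ℂ → ℝ} {z : ℂ} (hθ : ContDiffAt ℝ 2 θ (s z))
    (hs : ContDiffAt ℝ 2 s z) :
    Δ (fun ζ => θ (s ζ)) z =
      deriv (deriv θ) (s z) * (fderiv ℝ s z 1 ^ 2 + fderiv ℝ s z Complex.I ^ 2) +
        deriv θ (s z) * Δ s z := by
  have h2 : ∀ a b : ℝ, fderiv ℝ (fderiv ℝ θ) (s z) a b = deriv (deriv θ) (s z) * (a * b) := by
    intro a b
    have hd : DifferentiableAt ℝ (fderiv ℝ θ) (s z) :=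
      (hθ.fderiv_right (m := 1) (by norm_num)).differentiableAt (by norm_num)
    have h3 : deriv (deriv θ) (s z) = fderiv ℝ (fderiv ℝ θ) (s z) 1 1 := by
      have : deriv θ = fun t => fderiv ℝ θ t 1 := by ext t; simp
      rw [this, ← fderiv_apply_one_eq_deriv, fderiv_clm_apply hd (by fun_prop)]
      simp
    rw [h3]
    have ha : a = a • (1 : ℝ) := by simp
    have hb : b = b • (1 : ℝ) := by simp
    calc fderiv ℝ (fderiv ℝ θ) (s z) a b
        = fderiv ℝ (fderiv ℝ θ) (s z) (a • (1 : ℝ)) (b • (1 : ℝ)) := by rw [← ha, ← hb]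
      _ = _ := by
        rw [map_smul, map_smul]
        simp only [_root_.smul_apply, smul_eq_mul]
        ring
  rw [laplacian_comp hθ hs, h2, h2]
  have h1 : fderiv ℝ θ (s z) (Δ s z) = deriv θ (s z) * Δ s z := by
    have : Δ s z = (Δ s z) • (1 : ℝ) := by simp
    rw [this, map_smul, fderiv_apply_one_eq_deriv]; simp [mul_comm]
  rw [h1]; ring

/-- Second order Taylor expansion with little-o remainder. -/
theorem taylor_two {f : ℂ → ℝ} {z : ℂ} (hf : ContDiffAt ℝ 2 f z) {η : ℝ} (hη : 0 < η) :
    ∀ᶠ h in 𝓝 (0 : ℂ), |f (z + h) - f z - fderiv ℝ f z h -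
      (1 / 2) * fderiv ℝ (fderiv ℝ f) z h h| ≤ η * ‖h‖ ^ 2 := by
  set B := fderiv ℝ (fderiv ℝ f) z with hB
  have hf1 : ContDiffAt ℝ 1 (fderiv ℝ f) z := hf.fderiv_right (by norm_num)
  have hsym : ∀ v w, B v w = B w v := fun v w => (hf.isSymmSndFDerivAt (by simp)).eq v w
  have hlo := (hf1.differentiableAt (by norm_num)).hasFDerivAt.isLittleO
  have h1 : ∀ᶠ ζ in 𝓝 z, ‖fderiv ℝ f ζ - fderiv ℝ f z - B (ζ - z)‖ ≤ η * ‖ζ - z‖ :=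
    hlo.def hη
  have h2 : ∀ᶠ ζ in 𝓝 z, DifferentiableAt ℝ f ζ := by
    filter_upwards [hf.eventually (by norm_num)] with ζ h using h.differentiableAt (by norm_num)
  obtain ⟨R, hR, hball⟩ := Metric.eventually_nhds_iff_ball.1 (h1.and h2)
  filter_upwards [Metric.ball_mem_nhds (0 : ℂ) hR] with h hh
  have hh' : ‖h‖ < R := by simpa using hh
  -- The second order remainder vanishes at 0, and its derivative is the first order remainder of
  -- `fderiv ℝ f`, of norm at most η‖h‖ on the ball of radius ‖h‖. The mean value inequality
  -- concludes.
  let g : ℂ → ℝ := fun k => f (z + k) - f z - fderiv ℝ f z k - (1 / 2) * B k k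
  have hg : ∀ k ∈ closedBall (0 : ℂ) ‖h‖, HasFDerivWithinAt g
      (fderiv ℝ f (z + k) - fderiv ℝ f z - B k) (closedBall 0 ‖h‖) k := by
    intro k hk
    have hk' : ‖k‖ ≤ ‖h‖ := by simpa using hk
    have hkR : z + k ∈ ball z R := by simpa using hk'.trans_lt hh'
    have e1 : HasFDerivAt (fun k => f (z + k)) (fderiv ℝ f (z + k)) k := by
      exact ((hball _ hkR).2.hasFDerivAt.comp k ((hasFDerivAt_id k).const_add z)).congr_fderiv
        (by ext; simp)
    have e2 : HasFDerivAt (fun k => B k k) (B k + B.flip k) k := by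
      exact ((B.hasFDerivAt (x := k)).clm_apply (hasFDerivAt_id k)).congr_fderiv
        (by ext; simp)
    have e3 := ((e1.sub_const (f z)).sub (fderiv ℝ f z).hasFDerivAt).sub (e2.const_mul (1 / 2))
    refine (e3.congr_fderiv ?_).hasFDerivWithinAt
    refine ContinuousLinearMap.ext fun v => ?_
    simp [hsym v k]
    ring
  have hbd : ∀ k ∈ closedBall (0 : ℂ) ‖h‖,
      ‖fderiv ℝ f (z + k) - fderiv ℝ f z - B k‖ ≤ η * ‖h‖ := by
    intro k hk
    have hk' : ‖k‖ ≤ ‖h‖ := by simpa using hk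
    have hkR : z + k ∈ ball z R := by simpa using hk'.trans_lt hh'
    have := (hball _ hkR).1
    simp only [add_sub_cancel_left] at this
    exact this.trans (by gcongr)
  have := (convex_closedBall (0 : ℂ) ‖h‖).norm_image_sub_le_of_norm_hasFDerivWithin_le hg hbd
    (x := 0) (y := h) (by simp) (by simp)
  have g0 : g 0 = 0 := by simp [g]
  rw [g0, sub_zero, sub_zero, Real.norm_eq_abs] at this
  calc _ = |g h| := rfl
    _ ≤ _ := by rw [pow_two, ← mul_assoc]; exact this

theorem circleAverage_rotate (f : ℂ → ℝ) (z : ℂ) (r : ℝ) :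
    Real.circleAverage (fun ζ => f (z + Complex.I * (ζ - z))) z r = Real.circleAverage f z r := by
  rw [Real.circleAverage_eq_integral_add (Real.pi / 2) (f := f), Real.circleAverage_def]
  congr 1
  refine intervalIntegral.integral_congr fun θ _ => ?_
  simp only [circleMap]
  congr 1
  push_cast
  rw [add_mul, Complex.exp_add, Complex.exp_pi_div_two_mul_I]
  ring

/-- Quarter turns about z preserve the circle average, so f may be replaced by the sum of its four
rotates. In f(z+k) + f(z+ik) + f(z-k) + f(z-ik) the linear Taylor terms cancel and the quadratic
ones add up to |k|² Δf(z). The contradiction is thus pointwise on the circle and needs no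
trigonometric integral. -/
theorem laplacian_nonpos_of_circleAverage_le {f : ℂ → ℝ} {z : ℂ} (hf : ContDiffAt ℝ 2 f z)
    (h : ∀ᶠ r in 𝓝[>] (0 : ℝ), Real.circleAverage f z r ≤ f z) : Δ f z ≤ 0 := by
  by_contra! hpos
  set B := fderiv ℝ (fderiv ℝ f) z with hB
  have hΔ : Δ f z = B 1 1 + B Complex.I Complex.I := laplacian_eq_fderiv_fderiv f z
  set d := Δ f z
  have hcont : ∀ᶠ ζ in 𝓝 z, ContinuousAt f ζ := by
    filter_upwards [hf.eventually (by norm_num)] with ζ h using h.continuousAt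
  -- Four Taylor errors of size d/8 · r² use up half of the gain r² d.
  obtain ⟨R, hR, hball⟩ := Metric.eventually_nhds_iff_ball.1
    (taylor_two hf (η := d / 8) (by positivity))
  obtain ⟨R', hR', hball'⟩ := Metric.eventually_nhds_iff_ball.1 hcont
  have hsmall : ∀ᶠ r in 𝓝[>] (0 : ℝ), 0 < r ∧ r < R ∧ r < R' := by
    filter_upwards [Ioo_mem_nhdsGT (lt_min hR hR')] with r hr
    exact ⟨hr.1, hr.2.trans_le (min_le_left _ _), hr.2.trans_le (min_le_right _ _)⟩
  obtain ⟨r, hr, hr0, hrR, hrR'⟩ := (h.and hsmall).exists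
  let ρ : (ℂ → ℝ) → (ℂ → ℝ) := fun f ζ => f (z + Complex.I * (ζ - z))
  have hmem : ∀ ζ ∈ sphere z r, z + Complex.I * (ζ - z) ∈ sphere z r := by
    intro ζ hζ
    rw [mem_sphere, dist_eq_norm] at hζ ⊢
    simpa using hζ
  have hint : ∀ f : ℂ → ℝ, ContinuousOn f (sphere z r) → ContinuousOn (ρ f) (sphere z r) :=
    fun f hf => hf.comp (by fun_prop) hmem
  have hf0 : ContinuousOn f (sphere z r) := fun ζ hζ =>
    (hball' ζ (sphere_subset_ball hrR' hζ)).continuousWithinAt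
  have c1 := hint _ hf0
  have c2 := hint _ c1
  have c3 := hint _ c2
  have ci : ∀ f : ℂ → ℝ, ContinuousOn f (sphere z r) → CircleIntegrable f z r :=
    fun f hf => hf.circleIntegrable hr0.le
  have a1 : Real.circleAverage (ρ f) z r = Real.circleAverage f z r := circleAverage_rotate _ _ _
  have a2 : Real.circleAverage (ρ (ρ f)) z r = Real.circleAverage f z r :=
    (circleAverage_rotate _ _ _).trans a1
  have a3 : Real.circleAverage (ρ (ρ (ρ f))) z r = Real.circleAverage f z r :=
    (circleAverage_rotate _ _ _).trans a2
  have hsum : Real.circleAverage (f + ρ f + ρ (ρ f) + ρ (ρ (ρ f))) z r =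
      4 * Real.circleAverage f z r := by
    rw [Real.circleAverage_add (((ci _ hf0).add (ci _ c1)).add (ci _ c2)) (ci _ c3),
      Real.circleAverage_add ((ci _ hf0).add (ci _ c1)) (ci _ c2),
      Real.circleAverage_add (ci _ hf0) (ci _ c1), a1, a2, a3]
    ring
  have hlow : ∀ ζ ∈ sphere z |r|,
      4 * f z + r ^ 2 * d / 2 ≤ (f + ρ f + ρ (ρ f) + ρ (ρ (ρ f))) ζ := by
    intro ζ hζ
    rw [abs_of_pos hr0, mem_sphere, dist_eq_norm] at hζ
    obtain ⟨k, rfl⟩ : ∃ k, ζ = z + k := ⟨ζ - z, by ring⟩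
    simp only [add_sub_cancel_left] at hζ
    have hI : ∀ k : ℂ, ‖Complex.I * k‖ = ‖k‖ := fun k => by simp
    have t : ∀ k : ℂ, ‖k‖ = r → |f (z + k) - f z - fderiv ℝ f z k - (1 / 2) * B k k| ≤
        d / 8 * r ^ 2 := by
      intro k hk
      have := hball k (by simpa [hk] using hrR)
      rwa [hk] at this
    have t0 := abs_le.1 (t k hζ)
    have t1 := abs_le.1 (t (Complex.I * k) (by rw [hI, hζ]))
    have t2 := abs_le.1 (t (-k) (by rw [norm_neg, hζ]))
    have t3 := abs_le.1 (t (-(Complex.I * k)) (by rw [norm_neg, hI, hζ]))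
    have e2 : Complex.I * (Complex.I * k) = -k := by
      rw [← mul_assoc, Complex.I_mul_I]; ring
    have hBk : B k k + B (Complex.I * k) (Complex.I * k) = r ^ 2 * d := by
      have hk1 : k = k.re • (1 : ℂ) + k.im • Complex.I := by
        simp [Complex.re_add_im]
      have hk2 : Complex.I * k = (-k.im) • (1 : ℂ) + k.re • Complex.I := by
        apply Complex.ext <;> simp
      have hn : r ^ 2 = k.re ^ 2 + k.im ^ 2 := by
        rw [← hζ, Complex.sq_norm, Complex.normSq_apply]; ring
      have hsym : B 1 Complex.I = B Complex.I 1 := (hf.isSymmSndFDerivAt (by simp)).eq _ _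
      rw [hk2]
      conv_lhs => rw [hk1]
      simp only [map_add, map_smul, _root_.add_apply, _root_.smul_apply,
        smul_eq_mul]
      simp
      rw [hn, hΔ, hsym]
      ring
    simp only [Pi.add_apply, ρ, add_sub_cancel_left, e2, mul_neg]
    simp only [map_neg, _root_.neg_apply, neg_neg] at t2 t3
    linarith [t0.1, t1.1, t2.1, t3.1]
  have hge : 4 * f z + r ^ 2 * d / 2 ≤ 4 * Real.circleAverage f z r := by
    rw [← hsum]
    have hc := (((ci _ hf0).add (ci _ c1)).add (ci _ c2)).add (ci _ c3)
    have hm := Real.circleAverage_mono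
      (circleIntegrable_const (4 * f z + r ^ 2 * d / 2) z r) hc hlow
    rwa [Real.circleAverage_const] at hm
  have : 0 < r ^ 2 * d := by positivity
  linarith

/-- The local sub-mean value inequality at `z`, tested on continuous majorants. -/
def SubMeanAt (f : ℂ → ℝ) (z : ℂ) : Prop :=
  ∀ᶠ r in 𝓝[>] (0 : ℝ), ∀ φ : ℂ → ℝ, ContinuousOn φ (sphere z r) →
    (∀ ζ ∈ sphere z r, f ζ ≤ φ ζ) → f z ≤ Real.circleAverage φ z r

theorem eventually_sphere_of_eventually {P : ℂ → Prop} {z : ℂ} (h : ∀ᶠ ζ in 𝓝 z, P ζ) :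
    ∀ᶠ r in 𝓝[>] (0 : ℝ), 0 < r ∧ ∀ ζ ∈ sphere z r, P ζ := by
  obtain ⟨R, hR, hball⟩ := Metric.eventually_nhds_iff_ball.1 h
  filter_upwards [Ioo_mem_nhdsGT hR] with r hr
  exact ⟨hr.1, fun ζ hζ => hball ζ (sphere_subset_ball hr.2 hζ)⟩

/-- A C² function is continuous near z, hence an admissible majorant of itself. -/
theorem SubMeanAt.laplacian_nonneg {f : ℂ → ℝ} {z : ℂ} (hf : ContDiffAt ℝ 2 f z)
    (h : SubMeanAt f z) : 0 ≤ Δ f z := by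
  have hcont : ∀ᶠ ζ in 𝓝 z, ContinuousAt f ζ := by
    filter_upwards [hf.eventually (by norm_num)] with ζ h using h.continuousAt
  have : Δ (-f) z ≤ 0 := by
    refine laplacian_nonpos_of_circleAverage_le hf.neg ?_
    filter_upwards [h, eventually_sphere_of_eventually hcont] with r hr hc
    have h1 := hr f (fun ζ hζ => (hc.2 ζ hζ).continuousWithinAt) fun ζ _ => le_rfl
    have h2 : Real.circleAverage (-f) z r = -Real.circleAverage f z r := by
      simp [Real.circleAverage_def, intervalIntegral.integral_neg]
    rw [h2]; simpa using h1
  rw [laplacian_neg] at this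
  simpa using this

/-- At a local maximum of the sum of a smooth function and a function with the sub-mean value
property, the Laplacian of the smooth function is not positive. -/
theorem SubMeanAt.laplacian_nonpos_of_isLocalMax {f ψ : ℂ → ℝ} {z : ℂ} (hf : SubMeanAt f z)
    (hψ : ContDiffAt ℝ 2 ψ z) (hmax : ∀ᶠ ζ in 𝓝 z, ψ ζ + f ζ ≤ ψ z + f z) : Δ ψ z ≤ 0 := by
  have hcont : ∀ᶠ ζ in 𝓝 z, ContinuousAt ψ ζ := by
    filter_upwards [hψ.eventually (by norm_num)] with ζ h using h.continuousAt
  refine laplacian_nonpos_of_circleAverage_le hψ ?_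
  filter_upwards [hf, eventually_sphere_of_eventually (hcont.and hmax)] with r hr ⟨hr0, hc⟩
  have hψc : ContinuousOn ψ (sphere z r) := fun ζ hζ => (hc ζ hζ).1.continuousWithinAt
  -- The maximum makes this continuous function a majorant of f on small circles, with value f(z) at
  -- the centre.
  have h1 := hr (fun ζ => (ψ z + f z) - ψ ζ) (continuousOn_const.sub hψc)
    fun ζ hζ => by linarith [(hc ζ hζ).2]
  rw [Real.circleAverage_fun_sub (circleIntegrable_const _ z r) (hψc.circleIntegrable hr0.le),
    Real.circleAverage_const] at h1
  linarith

/-- Otherwise the constant f(z) - η would majorize f on small circles. Upper semicontinuity controls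
values near z from above only; this supplies the lower bound needed to pass to the limit at the
centre of the disc. -/
theorem SubMeanAt.frequently_ge {f : ℂ → ℝ} {z : ℂ} (hf : SubMeanAt f z) {η : ℝ} (hη : 0 < η) :
    ∃ᶠ ζ in 𝓝[≠] z, f z - η ≤ f ζ := by
  intro hcon
  have h' : ∀ᶠ ζ in 𝓝 z, ζ ≠ z → f ζ < f z - η := by
    rw [eventually_nhdsWithin_iff] at hcon
    filter_upwards [hcon] with ζ h1 h2 using not_le.1 (h1 h2)
  obtain ⟨r, hr, hr0, hs⟩ := (hf.and (eventually_sphere_of_eventually h')).exists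
  have := hr (fun _ => f z - η) continuousOn_const fun ζ hζ => (hs ζ hζ (by
    rintro rfl; simp at hζ; linarith)).le
  rw [Real.circleAverage_const] at this
  linarith

end Planar

/-! ### Quadratic functions along maps, and the maximum principle with a logarithmic pole. -/

section Schwarz

variable {E : Type*} [NormedAddCommGroup E] [NormedSpace ℝ E]

theorem hasFDerivAt_quadratic (B : E →L[ℝ] E →L[ℝ] ℝ) (w y : E) :
    HasFDerivAt (fun y => B (y - w) (y - w)) (B (y - w) + B.flip (y - w)) y := by
  have h := (hasFDerivAt_id (𝕜 := ℝ) y).sub_const w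
  exact ((B.hasFDerivAt.comp y h).clm_apply h).congr_fderiv (by ext; simp)

theorem contDiff_quadratic (B : E →L[ℝ] E →L[ℝ] ℝ) (w : E) {k : WithTop ℕ∞} :
    ContDiff ℝ k fun y => B (y - w) (y - w) := by
  fun_prop

theorem fderiv_quadratic (B : E →L[ℝ] E →L[ℝ] ℝ) (w : E) :
    (fderiv ℝ fun y => B (y - w) (y - w)) = fun y => B (y - w) + B.flip (y - w) := by
  ext1 y
  exact (hasFDerivAt_quadratic B w y).fderiv

theorem fderiv_fderiv_quadratic (B : E →L[ℝ] E →L[ℝ] ℝ) (w y a b : E) :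
    fderiv ℝ (fderiv ℝ fun y => B (y - w) (y - w)) y a b = B a b + B b a := by
  rw [fderiv_quadratic]
  have h := (hasFDerivAt_id (𝕜 := ℝ) y).sub_const w
  have h1 := (B.hasFDerivAt.comp y h).add (B.flip.hasFDerivAt.comp y h)
  have h2 : fderiv ℝ (fun y => B (y - w) + B.flip (y - w)) y = _ := h1.fderiv
  rw [h2]
  simp

theorem laplacian_quadratic_comp (B : E →L[ℝ] E →L[ℝ] ℝ) (hB : ∀ a b, B a b = B b a) (w : E)
    {X : ℂ → E} {z : ℂ} (hX : ContDiffAt ℝ 2 X z) :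
    Δ (fun ζ => B (X ζ - w) (X ζ - w)) z =
      2 * (B (fderiv ℝ X z 1) (fderiv ℝ X z 1) +
        B (fderiv ℝ X z Complex.I) (fderiv ℝ X z Complex.I)) + 2 * B (X z - w) (Δ X z) := by
  have := laplacian_comp (φ := fun y => B (y - w) (y - w)) (contDiff_quadratic B w).contDiffAt hX
  rw [this, fderiv_fderiv_quadratic, fderiv_fderiv_quadratic, fderiv_quadratic]
  simp only [_root_.add_apply, ContinuousLinearMap.flip_apply, hB (Δ X z)]
  ring

theorem fderiv_quadratic_comp (B : E →L[ℝ] E →L[ℝ] ℝ) (hB : ∀ a b, B a b = B b a) (w : E)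
    {X : ℂ → E} {z : ℂ} (hX : DifferentiableAt ℝ X z) (v : ℂ) :
    fderiv ℝ (fun ζ => B (X ζ - w) (X ζ - w)) z v = 2 * B (X z - w) (fderiv ℝ X z v) := by
  have := (hasFDerivAt_quadratic B w (X z)).comp z hX.hasFDerivAt
  have h2 : fderiv ℝ (fun ζ => B (X ζ - w) (X ζ - w)) z = _ := this.fderiv
  rw [h2]
  simp [hB (fderiv ℝ X z v)]
  ring

theorem laplacian_norm_sq_comp {F : Type*} [NormedAddCommGroup F] [InnerProductSpace ℝ F]
    {X : ℂ → F} {z : ℂ} (hX : ContDiffAt ℝ 2 X z) :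
    Δ (fun ζ => ‖X ζ‖ ^ 2) z = 2 * (‖fderiv ℝ X z 1‖ ^ 2 + ‖fderiv ℝ X z Complex.I‖ ^ 2) +
      2 * inner ℝ (X z) (Δ X z) := by
  obtain ⟨B, hB⟩ : ∃ B : F →L[ℝ] F →L[ℝ] ℝ, ∀ a b, B a b = inner ℝ a b :=
    ⟨innerSL ℝ, fun _ _ => rfl⟩
  have := laplacian_quadratic_comp B (fun a b => by rw [hB, hB, real_inner_comm]) 0 hX
  simpa only [hB, sub_zero, real_inner_self_eq_norm_sq] using this

theorem laplacian_complex_norm_sq (z : ℂ) : Δ (fun ζ : ℂ => ‖ζ‖ ^ 2) z = 4 := by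
  have h0 : Δ (fun ζ : ℂ => ζ) z = 0 := by
    have h1 : (fderiv ℝ fun ζ : ℂ => ζ) = fun _ => ContinuousLinearMap.id ℝ ℂ := by
      ext1 ζ; exact fderiv_id
    rw [laplacian_eq_fderiv_fderiv, h1]
    simp
  have := laplacian_norm_sq_comp (X := fun ζ : ℂ => ζ) (z := z) contDiffAt_id
  rw [this, h0]
  simp
  norm_num

theorem upperSemicontinuousOn_const_mul {V : ℂ → ℝ} {s : Set ℂ} (hV : UpperSemicontinuousOn V s)
    {c : ℝ} (hc : 0 ≤ c) : UpperSemicontinuousOn (fun z => c * V z) s :=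
  (continuous_const.mul continuous_id).comp_upperSemicontinuousOn hV
    (monotone_mul_left_of_nonneg hc)

/-- A Schwarz lemma for `W + lam * V`, where `W` is `-∞` on the zero set of `t` and has a
logarithmic pole at the origin. -/
theorem schwarz_maximum_principle {W V e t : ℂ → ℝ} {lam : ℝ} (hlam : 0 < lam)
    (hV : UpperSemicontinuousOn V (ball 0 1)) (hV0 : ∀ z ∈ ball (0 : ℂ) 1, V z ≤ 0)
    (ht : ContinuousOn t (ball 0 1)) (ht0 : ∀ z ∈ ball (0 : ℂ) 1, 0 ≤ t z)
    (hW : ∀ z ∈ ball (0 : ℂ) 1, z ≠ 0 → t z ≠ 0 → ContinuousAt W z)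
    (hW0 : ∀ z ∈ ball (0 : ℂ) 1, t z ≠ 0 → W z ≤ 0)
    (hWt : ∃ c, ∀ z ∈ ball (0 : ℂ) 1, t z ≠ 0 → W z ≤ Real.log (t z) + c)
    (hWlog : ∃ c, ∀ᶠ z in 𝓝[≠] (0 : ℂ), W z ≤ 2 * Real.log ‖z‖ + c)
    (he : ContinuousOn e (ball 0 1)) (he0 : ∀ z ∈ ball (0 : ℂ) 1, 0 ≤ e z)
    (helog : ∀ r < 1, ∃ C, ∀ z ∈ closedBall (0 : ℂ) r, e z ≠ 0 →
      ContDiffAt ℝ 2 e z ∧ -C ≤ Δ (fun ζ => Real.log (e ζ)) z)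
    (hsub : ∀ z ∈ ball (0 : ℂ) 1, z ≠ 0 → t z ≠ 0 → e z ≠ 0 → ∃ ψ V₁ : ℂ → ℝ, ContDiffAt ℝ 2 ψ z ∧
      0 ≤ Δ ψ z ∧ SubMeanAt V₁ z ∧ ∀ᶠ ζ in 𝓝 z, W ζ + lam * V ζ = ψ ζ + V₁ ζ) :
    ∀ z ∈ ball (0 : ℂ) 1, z ≠ 0 → t z ≠ 0 → e z ≠ 0 → W z + lam * V z ≤ 2 * Real.log ‖z‖ := by
  intro z₁ hz₁ hz₁0 htz₁ hez₁
  have hn1 : 0 < ‖z₁‖ := norm_pos_iff.2 hz₁0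
  have hn1' : ‖z₁‖ < 1 := by simpa using hz₁
  -- Working on a closed disc of radius r < 1 makes the bounds on e and on the Laplacian of log e
  -- uniform; the loss 2 log r vanishes as r → 1.
  suffices H : ∀ r, ‖z₁‖ < r → r < 1 →
      W z₁ + lam * V z₁ ≤ 2 * Real.log ‖z₁‖ - 2 * Real.log r by
    have hlim : Tendsto (fun r => 2 * Real.log ‖z₁‖ - 2 * Real.log r) (𝓝[<] 1)
        (𝓝 (2 * Real.log ‖z₁‖ - 2 * Real.log 1)) := by
      refine Tendsto.mono_left ?_ nhdsWithin_le_nhds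
      exact tendsto_const_nhds.sub
        (((Real.continuousAt_log one_ne_zero).tendsto).const_mul 2)
    rw [Real.log_one, mul_zero, sub_zero] at hlim
    refine ge_of_tendsto hlim ?_
    filter_upwards [Ioo_mem_nhdsLT hn1'] with r hr using H r hr.1 hr.2
  intro r hr1 hr
  have hr0 : 0 < r := hn1.trans hr1
  have hsubset : closedBall (0 : ℂ) r ⊆ ball 0 1 := closedBall_subset_ball hr
  obtain ⟨C₀, hC₀⟩ := helog r hr
  set C := max C₀ 0
  have hCpos : 0 ≤ C := le_max_right _ _
  have hC : ∀ z ∈ closedBall (0 : ℂ) r, e z ≠ 0 →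
      ContDiffAt ℝ 2 e z ∧ -C ≤ Δ (fun ζ => Real.log (e ζ)) z := fun z hz hez =>
    ⟨(hC₀ z hz hez).1, (neg_le_neg (le_max_left _ _)).trans (hC₀ z hz hez).2⟩
  obtain ⟨E₀, hE₀⟩ := (isCompact_closedBall (0 : ℂ) r).bddAbove_image (he.mono hsubset)
  set E₁ := max E₀ 1
  have hE₁ : ∀ z ∈ closedBall (0 : ℂ) r, e z ≤ E₁ := fun z hz =>
    (hE₀ ⟨z, hz, rfl⟩).trans (le_max_left _ _)
  set L₁ := Real.log E₁
  have hL₁ : 0 ≤ L₁ := Real.log_nonneg (le_max_right _ _)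
  have hlogE : ∀ z ∈ closedBall (0 : ℂ) r, e z ≠ 0 → Real.log (e z) ≤ L₁ := fun z hz hez =>
    Real.log_le_log (lt_of_le_of_ne (he0 z (hsubset hz)) (Ne.symm hez)) (hE₁ z hz)
  obtain ⟨M₀, hM₀⟩ : ∃ M₀, ∀ z ∈ closedBall (0 : ℂ) r, z ≠ 0 → t z ≠ 0 →
      W z - 2 * Real.log ‖z‖ ≤ M₀ := by
    obtain ⟨c, hc⟩ := hWlog
    rw [eventually_nhdsWithin_iff, Metric.eventually_nhds_iff_ball] at hc
    obtain ⟨κ, hκ, hc⟩ := hc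
    refine ⟨max c (-(2 * Real.log κ)), fun z hz hz0 htz => ?_⟩
    rcases lt_or_ge ‖z‖ κ with h | h
    · refine le_trans ?_ (le_max_left _ _)
      linarith [hc z (by simpa using h) hz0]
    · refine le_trans ?_ (le_max_right _ _)
      have := Real.log_le_log hκ h
      linarith [hW0 z (hsubset hz) htz]
  -- Three perturbations of size η: the weakened pole (1 - η) 2 log|z| sends G to -∞ at 0, the term
  -- log e sends it to -∞ at the zeros of e, and (C+1)|z|² makes the Laplacian of the smooth part
  -- strictly positive.
  have key : ∀ η : ℝ, 0 < η → η < 1 →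
      W z₁ + lam * V z₁ - (1 - η) * (2 * Real.log ‖z₁‖) +
        η * (Real.log (e z₁) + (C + 1) * ‖z₁‖ ^ 2) ≤
      -(1 - η) * (2 * Real.log r) + η * (L₁ + (C + 1)) := by
    intro η hη hη1
    set G : ℂ → ℝ := fun z => W z + lam * V z - (1 - η) * (2 * Real.log ‖z‖) +
        η * (Real.log (e z) + (C + 1) * ‖z‖ ^ 2) with hG
    change G z₁ ≤ _
    by_contra! hcon
    have hz₁r : z₁ ∈ closedBall (0 : ℂ) r := by simpa using hr1.le
    have hGle : ∀ z ∈ closedBall (0 : ℂ) r, z ≠ 0 → t z ≠ 0 →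
        G z ≤ M₀ + η * (2 * Real.log ‖z‖) + η * (Real.log (e z) + (C + 1)) := by
      intro z hz hz0 htz
      have h1 := hM₀ z hz hz0 htz
      have h2 := hV0 z (hsubset hz)
      have h3 : ‖z‖ ≤ 1 := by
        have : ‖z‖ < 1 := by simpa using hsubset hz
        exact this.le
      have h4 : ‖z‖ ^ 2 ≤ 1 := pow_le_one₀ (norm_nonneg _) h3
      have h5 : lam * V z ≤ 0 := mul_nonpos_of_nonneg_of_nonpos hlam.le h2
      have h6 : η * ((C + 1) * ‖z‖ ^ 2) ≤ η * (C + 1) := by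
        gcongr
        exact mul_le_of_le_one_right (by positivity) h4
      simp only [hG]
      linarith
    obtain ⟨N, hN0, hN⟩ : ∃ N : ℝ, 0 ≤ N ∧ M₀ + η * (L₁ + (C + 1)) - G z₁ < η * N := by
      refine ⟨max 0 ((M₀ + η * (L₁ + (C + 1)) - G z₁) / η + 1), le_max_left _ _, ?_⟩
      have : (M₀ + η * (L₁ + (C + 1)) - G z₁) / η <
        max 0 ((M₀ + η * (L₁ + (C + 1)) - G z₁) / η + 1) :=
        (lt_add_one _).trans_le (le_max_right _ _)
      rw [div_lt_iff₀ hη] at this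
      linarith
    -- N is so large that G < G(z₁) wherever |z| ≤ κ or e ≤ κ.
    set κ := Real.exp (-N) with hκ
    have hκ0 : 0 < κ := Real.exp_pos _
    have hlogκ : Real.log κ = -N := Real.log_exp _
    have hsmall : ∀ z ∈ closedBall (0 : ℂ) r, z ≠ 0 → t z ≠ 0 → e z ≠ 0 → ‖z‖ ≤ κ ∨ e z ≤ κ →
        G z < G z₁ := by
      intro z hz hz0 htz hez hor
      have h1 := hGle z hz hz0 htz
      have hzpos : 0 < ‖z‖ := norm_pos_iff.2 hz0
      have hzn : Real.log ‖z‖ ≤ 0 := by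
        have : ‖z‖ < 1 := by simpa using hsubset hz
        exact Real.log_nonpos (norm_nonneg _) this.le
      have hepos : 0 < e z := lt_of_le_of_ne (he0 z (hsubset hz)) (Ne.symm hez)
      have h2 := hlogE z hz hez
      rcases hor with h | h
      · have h3 : Real.log ‖z‖ ≤ -N := hlogκ ▸ Real.log_le_log hzpos h
        have h4 : η * (2 * Real.log ‖z‖) ≤ η * (-N) := by gcongr; linarith
        have h5 : η * (Real.log (e z) + (C + 1)) ≤ η * (L₁ + (C + 1)) := by gcongr
        linarith
      · have h3 : Real.log (e z) ≤ -N := hlogκ ▸ Real.log_le_log hepos h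
        have h4 : η * (2 * Real.log ‖z‖) ≤ 0 :=
          mul_nonpos_of_nonneg_of_nonpos hη.le (by linarith)
        have h5 : η * (Real.log (e z) + (C + 1)) ≤ η * (-N + (C + 1)) := by gcongr
        have h6 : 0 ≤ η * L₁ := by positivity
        nlinarith
    obtain ⟨ct, hct⟩ := hWt
    -- Once |z| > κ, the pole term is at most 2N, so W ≤ log t + ct forces G < G(z₁) where t ≤
    -- exp(-N₂). All competitors for the maximum then lie in the compact set K below, on which G is
    -- upper semicontinuous.
    set N₂ := ct + 2 * N + η * (L₁ + (C + 1)) - G z₁ + 1 with hN₂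
    set κ₂ := Real.exp (-N₂) with hκ₂
    have hκ₂0 : 0 < κ₂ := Real.exp_pos _
    have hsmall' : ∀ z ∈ closedBall (0 : ℂ) r, z ≠ 0 → t z ≠ 0 → e z ≠ 0 → t z ≤ κ₂ →
        G z < G z₁ := by
      intro z hz hz0 htz hez hle
      rcases le_or_gt ‖z‖ κ with hn | hn
      · exact hsmall z hz hz0 htz hez (Or.inl hn)
      · have h1 := hct z (hsubset hz) htz
        have h2 : Real.log (t z) ≤ -N₂ := by
          have := Real.log_le_log (lt_of_le_of_ne (ht0 z (hsubset hz)) (Ne.symm htz)) hle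
          rwa [hκ₂, Real.log_exp] at this
        have h3 : -N ≤ Real.log ‖z‖ := hlogκ ▸ Real.log_le_log hκ0 hn.le
        have h4 : lam * V z ≤ 0 := mul_nonpos_of_nonneg_of_nonpos hlam.le (hV0 z (hsubset hz))
        have h5 : (1 - η) * (2 * -N) ≤ (1 - η) * (2 * Real.log ‖z‖) :=
          mul_le_mul_of_nonneg_left (by linarith) (by linarith)
        have h6 : 0 ≤ η * N := by positivity
        have hz1 : ‖z‖ ≤ 1 := by
          have : ‖z‖ < 1 := by simpa using hsubset hz
          exact this.le
        have h7 : Real.log (e z) + (C + 1) * ‖z‖ ^ 2 ≤ L₁ + (C + 1) :=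
          add_le_add (hlogE z hz hez)
            (mul_le_of_le_one_right (by positivity) (pow_le_one₀ (norm_nonneg _) hz1))
        have h8 := mul_le_mul_of_nonneg_left h7 hη.le
        have h9 : G z = W z + lam * V z - (1 - η) * (2 * Real.log ‖z‖) +
          η * (Real.log (e z) + (C + 1) * ‖z‖ ^ 2) := rfl
        rw [h9]
        linarith
    set K : Set ℂ := {z ∈ closedBall (0 : ℂ) r | κ ≤ ‖z‖ ∧ κ ≤ e z ∧ κ₂ ≤ t z} with hK
    have hKz : ∀ z ∈ K, z ∈ closedBall (0 : ℂ) r ∧ z ≠ 0 ∧ t z ≠ 0 ∧ e z ≠ 0 := by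
      rintro z ⟨h1, h2, h3, h4⟩
      exact ⟨h1, norm_pos_iff.1 (hκ0.trans_le h2), (hκ₂0.trans_le h4).ne', (hκ0.trans_le h3).ne'⟩
    have hmemK : ∀ z ∈ closedBall (0 : ℂ) r, z ≠ 0 → t z ≠ 0 → e z ≠ 0 → G z₁ ≤ G z →
        κ < ‖z‖ ∧ κ < e z ∧ κ₂ < t z := by
      intro z hz hz0 htz hez hle
      refine ⟨lt_of_not_ge fun h => ?_, lt_of_not_ge fun h => ?_, lt_of_not_ge fun h => ?_⟩
      · exact absurd (hsmall z hz hz0 htz hez (Or.inl h)) (not_lt.2 hle)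
      · exact absurd (hsmall z hz hz0 htz hez (Or.inr h)) (not_lt.2 hle)
      · exact absurd (hsmall' z hz hz0 htz hez h) (not_lt.2 hle)
    have hz₁K : z₁ ∈ K := by
      have := hmemK z₁ hz₁r hz₁0 htz₁ hez₁ le_rfl
      exact ⟨hz₁r, this.1.le, this.2.1.le, this.2.2.le⟩
    have hKc : IsCompact K := by
      have h1 : IsClosed K := by
        have : K = closedBall (0 : ℂ) r ∩ (fun z => ((‖z‖ : ℝ), e z, t z)) ⁻¹'
            (Set.Ici κ ×ˢ Set.Ici κ ×ˢ Set.Ici κ₂) := by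
          ext z; simp [hK]
        rw [this]
        exact (continuousOn_id.norm.prodMk
          ((he.mono hsubset).prodMk (ht.mono hsubset))).preimage_isClosed_of_isClosed
          isClosed_closedBall (isClosed_Ici.prod (isClosed_Ici.prod isClosed_Ici))
      exact (isCompact_closedBall (0 : ℂ) r).of_isClosed_subset h1 (fun z hz => hz.1)
    have hKsub : K ⊆ ball 0 1 := fun z hz => hsubset hz.1
    have hGusc : UpperSemicontinuousOn G K := by
      have c1 : ContinuousOn W K := fun z hz =>
        (hW z (hKsub hz) (hKz z hz).2.1 (hKz z hz).2.2.1).continuousWithinAt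
      have c2 : ContinuousOn (fun z : ℂ => -((1 - η) * (2 * Real.log ‖z‖)) +
          η * (Real.log (e z) + (C + 1) * ‖z‖ ^ 2)) K := by
        have a1 : ContinuousOn (fun z : ℂ => Real.log ‖z‖) K :=
          continuousOn_id.norm.log fun z hz => norm_ne_zero_iff.2 (hKz z hz).2.1
        have a2 : ContinuousOn (fun z : ℂ => Real.log (e z)) K :=
          (he.mono hKsub).log fun z hz => (hKz z hz).2.2.2
        fun_prop
      have h := (upperSemicontinuousOn_const_mul (hV.mono hKsub) hlam.le).add
        (c1.add c2).upperSemicontinuousOn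
      have hEq : G = fun z => lam * V z + (W z + (-((1 - η) * (2 * Real.log ‖z‖)) +
          η * (Real.log (e z) + (C + 1) * ‖z‖ ^ 2))) := by
        ext z; simp only [hG]; ring
      rw [hEq]; exact h
    obtain ⟨z₀, hz₀K, hmax⟩ := hGusc.exists_isMaxOn ⟨z₁, hz₁K⟩ hKc
    obtain ⟨hz₀r, hz₀0, htz₀, hez₀⟩ := hKz z₀ hz₀K
    have hge : G z₁ ≤ G z₀ := hmax hz₁K
    obtain ⟨hk1, hk2, hk3⟩ := hmemK z₀ hz₀r hz₀0 htz₀ hez₀ hge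
    have hz₀le : ‖z₀‖ ≤ r := by simpa using hz₀r
    have hz₀1 : z₀ ∈ ball (0 : ℂ) 1 := hsubset hz₀r
    rcases hz₀le.lt_or_eq with hlt | heq
    · have hnhds : K ∈ 𝓝 z₀ := by
        have b1 : ∀ᶠ z in 𝓝 z₀, z ∈ ball (0 : ℂ) r := isOpen_ball.mem_nhds (by simpa using hlt)
        have b2 : ∀ᶠ z in 𝓝 z₀, κ < ‖z‖ := continuous_norm.continuousAt.eventually (lt_mem_nhds hk1)
        have b3 : ∀ᶠ z in 𝓝 z₀, κ < e z :=
          (he.continuousAt (isOpen_ball.mem_nhds hz₀1)).eventually (lt_mem_nhds hk2)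
        have b4 : ∀ᶠ z in 𝓝 z₀, κ₂ < t z :=
          (ht.continuousAt (isOpen_ball.mem_nhds hz₀1)).eventually (lt_mem_nhds hk3)
        filter_upwards [b1, b2, b3, b4] with z h1 h2 h3 h4 using
          ⟨ball_subset_closedBall h1, h2.le, h3.le, h4.le⟩
      obtain ⟨ψ, V₁, hψ, hψΔ, hV₁, heq⟩ := hsub z₀ hz₀1 hz₀0 htz₀ hez₀
      obtain ⟨hes, heΔ⟩ := hC z₀ hz₀r hez₀
      have hharm := (analyticAt_id (𝕜 := ℂ) (z := z₀)).harmonicAt_log_norm hz₀0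
      have s1 : ContDiffAt ℝ 2 (fun z : ℂ => Real.log ‖z‖) z₀ := hharm.1
      have s1Δ : Δ (fun z : ℂ => Real.log ‖z‖) z₀ = 0 := hharm.2.self_of_nhds
      have s2 : ContDiffAt ℝ 2 (fun z => Real.log (e z)) z₀ := hes.log hez₀
      have s3 : ContDiffAt ℝ 2 (fun z : ℂ => ‖z‖ ^ 2) z₀ := (contDiff_norm_sq ℝ).contDiffAt
      set χ : ℂ → ℝ := ψ + ((-(1 - η) * 2) • (fun z : ℂ => Real.log ‖z‖) +
        (η • (fun z => Real.log (e z)) + (η * (C + 1)) • fun z : ℂ => ‖z‖ ^ 2)) with hχ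
      have t1 : ContDiffAt ℝ 2 ((-(1 - η) * 2) • fun z : ℂ => Real.log ‖z‖) z₀ :=
        s1.const_smul (-(1 - η) * 2)
      have t2 : ContDiffAt ℝ 2 (η • fun z => Real.log (e z)) z₀ := s2.const_smul η
      have t3 : ContDiffAt ℝ 2 ((η * (C + 1)) • fun z : ℂ => ‖z‖ ^ 2) z₀ :=
        s3.const_smul (η * (C + 1))
      have t23 : ContDiffAt ℝ 2 ((η • fun z => Real.log (e z)) +
        (η * (C + 1)) • fun z : ℂ => ‖z‖ ^ 2) z₀ := t2.add t3
      have t123 : ContDiffAt ℝ 2 ((-(1 - η) * 2) • (fun z : ℂ => Real.log ‖z‖) +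
        ((η • fun z => Real.log (e z)) + (η * (C + 1)) • fun z : ℂ => ‖z‖ ^ 2)) z₀ := t1.add t23
      have hχs : ContDiffAt ℝ 2 χ z₀ := hψ.add t123
      -- The total is at least η(4(C+1) - C) > 0, since log|z| is harmonic and ψ has nonnegative
      -- Laplacian.
      have hχΔ : 0 < Δ χ z₀ := by
        rw [hχ, hψ.laplacian_add t123, t1.laplacian_add t23,
          t2.laplacian_add t3, laplacian_smul _ s1, laplacian_smul _ s2, laplacian_smul _ s3,
          s1Δ, laplacian_complex_norm_sq]
        simp only [smul_eq_mul]
        have : η * (-C) ≤ η * Δ (fun z => Real.log (e z)) z₀ := by gcongr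
        nlinarith
      refine absurd (hV₁.laplacian_nonpos_of_isLocalMax hχs ?_) (not_le.2 hχΔ)
      have hGχ : ∀ᶠ z in 𝓝 z₀, G z = χ z + V₁ z := by
        filter_upwards [heq] with z hz
        simp only [hG, hχ, Pi.add_apply, Pi.smul_apply, smul_eq_mul]
        linarith
      filter_upwards [hGχ, hnhds] with z h1 h2
      rw [← h1, ← hGχ.self_of_nhds]
      exact hmax h2
    -- A maximum on |z| = r: there W and V are nonpositive, so G already satisfies the claimed
    -- bound.
    · have h1 := hW0 z₀ hz₀1 htz₀
      have h2 : lam * V z₀ ≤ 0 := mul_nonpos_of_nonneg_of_nonpos hlam.le (hV0 z₀ hz₀1)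
      have h3 := hlogE z₀ hz₀r hez₀
      have h4 : ‖z₀‖ ^ 2 ≤ 1 := pow_le_one₀ (norm_nonneg _) (hz₀le.trans hr.le)
      have h5 : η * (Real.log (e z₀) + (C + 1) * ‖z₀‖ ^ 2) ≤ η * (L₁ + (C + 1)) := by
        gcongr
        exact mul_le_of_le_one_right (by positivity) h4
      have h6 : G z₀ ≤ -(1 - η) * (2 * Real.log r) + η * (L₁ + (C + 1)) := by
        simp only [hG, heq]
        rw [heq] at h5
        linarith
      linarith
  have hlim : ∀ a b : ℝ, (∀ η : ℝ, 0 < η → η < 1 → a ≤ b * η) → a ≤ 0 := by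
    intro a b h
    have hlim : Tendsto (fun η : ℝ => b * η) (𝓝[>] 0) (𝓝 (b * 0)) :=
      (tendsto_id.const_mul b).mono_left nhdsWithin_le_nhds
    rw [mul_zero] at hlim
    refine ge_of_tendsto hlim ?_
    filter_upwards [Ioo_mem_nhdsGT one_pos] with η hη using h η hη.1 hη.2
  have := hlim (W z₁ + lam * V z₁ - 2 * Real.log ‖z₁‖ + 2 * Real.log r)
    (2 * Real.log r + L₁ + (C + 1) - 2 * Real.log ‖z₁‖ - (Real.log (e z₁) + (C + 1) * ‖z₁‖ ^ 2))
    fun η h0 h1 => by linarith [key η h0 h1]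
  linarith

end Schwarz

/-! ### The one-variable profile with a logarithmic pole. -/

section Profile

/-- A `C²` function on `(0, ∞)`, nonpositive, with a logarithmic pole at `0` and equal to `0` on
`[1, ∞)`; its derivative is `(1 - t)₊² (1 / t + κ / √t)`. -/
def poleProfile (κ t : ℝ) : ℝ :=
  if t < 1 then Real.log t - 2 * t + t ^ 2 / 2 + 3 / 2 +
    κ * (2 * √t - 4 / 3 * (t * √t) + 2 / 5 * (t ^ 2 * √t) - 16 / 15) else 0

/-- The derivative of `poleProfile κ`. -/
def poleProfileDeriv (κ t : ℝ) : ℝ := max (1 - t) 0 ^ 2 * (1 / t + κ / √t)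

/-- The second derivative of `poleProfile κ`. -/
def poleProfileDeriv2 (κ t : ℝ) : ℝ :=
  -2 * max (1 - t) 0 * (1 / t + κ / √t) - max (1 - t) 0 ^ 2 * (1 / t ^ 2 + κ / (2 * (t * √t)))

/-- Squaring the truncated factor makes it C¹ across t = 1; hence the profile is C² there. -/
theorem hasDerivAt_max_sq (t : ℝ) :
    HasDerivAt (fun t : ℝ => max (1 - t) 0 ^ 2) (-2 * max (1 - t) 0) t := by
  have h0 : HasDerivAt (fun t : ℝ => (1 - t) ^ 2) (-2 * (1 - t)) t :=
    (((hasDerivAt_id t).const_sub 1).pow 2).congr_deriv (by simp)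
  rcases lt_trichotomy t 1 with h | rfl | h
  · have : (fun t : ℝ => max (1 - t) 0 ^ 2) =ᶠ[𝓝 t] fun t => (1 - t) ^ 2 := by
      filter_upwards [gt_mem_nhds h] with s hs
      rw [max_eq_left (by linarith)]
    rw [max_eq_left (by linarith)]
    exact h0.congr_of_eventuallyEq this
  · have h1 : HasDerivWithinAt (fun t : ℝ => max (1 - t) 0 ^ 2) 0 (Set.Iic 1) 1 := by
      refine (h0.hasDerivWithinAt.congr_deriv (by simp)).congr (fun s hs => ?_) (by simp)
      rw [max_eq_left (by linarith [Set.mem_Iic.1 hs])]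
    have h2 : HasDerivWithinAt (fun t : ℝ => max (1 - t) 0 ^ 2) 0 (Set.Ici 1) 1 := by
      refine ((hasDerivAt_const (1 : ℝ) (0 : ℝ)).hasDerivWithinAt).congr (fun s hs => ?_) (by simp)
      rw [max_eq_right (by linarith [Set.mem_Ici.1 hs])]; simp
    have := h1.union h2
    rw [Set.Iic_union_Ici, hasDerivWithinAt_univ] at this
    simpa using this
  · have : (fun t : ℝ => max (1 - t) 0 ^ 2) =ᶠ[𝓝 t] fun t => 0 := by
      filter_upwards [lt_mem_nhds h] with s hs
      rw [max_eq_right (by linarith)]; simp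
    rw [max_eq_right (by linarith), mul_zero]
    exact (hasDerivAt_const t (0 : ℝ)).congr_of_eventuallyEq this

theorem hasDerivAt_poleProfile (κ : ℝ) {t : ℝ} (ht : 0 < t) :
    HasDerivAt (poleProfile κ) (poleProfileDeriv κ t) t := by
  set F : ℝ → ℝ := fun t => Real.log t - 2 * t + t ^ 2 / 2 + 3 / 2 +
    κ * (2 * √t - 4 / 3 * (t * √t) + 2 / 5 * (t ^ 2 * √t) - 16 / 15) with hF
  have h0 : HasDerivAt F ((1 - t) ^ 2 * (1 / t + κ / √t)) t := by
    have hs := Real.hasDerivAt_sqrt ht.ne'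
    have hid := hasDerivAt_id t
    have d1 := (((Real.hasDerivAt_log ht.ne').sub (hid.const_mul 2)).add
      ((hid.pow 2).div_const 2)).add_const (3 / 2)
    have d2 := ((((hs.const_mul 2).sub ((hid.mul hs).const_mul (4 / 3))).add
      (((hid.pow 2).mul hs).const_mul (2 / 5))).sub_const (16 / 15)).const_mul κ
    have h := d1.add d2
    refine h.congr_deriv ?_
    have hsq : √t ^ 2 = t := Real.sq_sqrt ht.le
    have hs0 : √t ≠ 0 := (Real.sqrt_pos.2 ht).ne'
    simp only [id, Pi.pow_apply]
    generalize √t = r at *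
    subst hsq
    field_simp
    ring
  rcases lt_trichotomy t 1 with h | rfl | h
  · have : poleProfile κ =ᶠ[𝓝 t] F := by
      filter_upwards [gt_mem_nhds h] with s hs
      simp [poleProfile, hF, hs]
    rw [poleProfileDeriv, max_eq_left (by linarith)]
    exact h0.congr_of_eventuallyEq this
  · have hF1 : F 1 = 0 := by simp [hF]; norm_num
    have h1 : HasDerivWithinAt (poleProfile κ) 0 (Set.Iic 1) 1 := by
      refine (h0.hasDerivWithinAt.congr_deriv (by simp)).congr (fun s hs => ?_)
        (by simp [poleProfile, hF1])
      rcases (Set.mem_Iic.1 hs).lt_or_eq with hs | rfl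
      · simp [poleProfile, hF, hs]
      · simp [poleProfile, hF1]
    have h2 : HasDerivWithinAt (poleProfile κ) 0 (Set.Ici 1) 1 := by
      refine ((hasDerivAt_const (1 : ℝ) (0 : ℝ)).hasDerivWithinAt).congr (fun s hs => ?_)
        (by simp [poleProfile])
      simp [poleProfile, not_lt.2 (Set.mem_Ici.1 hs)]
    have := h1.union h2
    rw [Set.Iic_union_Ici, hasDerivWithinAt_univ] at this
    simpa [poleProfileDeriv] using this
  · have : poleProfile κ =ᶠ[𝓝 t] fun t => 0 := by
      filter_upwards [lt_mem_nhds h] with s hs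
      simp [poleProfile, not_lt.2 hs.le]
    rw [poleProfileDeriv, max_eq_right (by linarith)]
    simpa using (hasDerivAt_const t (0 : ℝ)).congr_of_eventuallyEq this

theorem hasDerivAt_poleProfileDeriv (κ : ℝ) {t : ℝ} (ht : 0 < t) :
    HasDerivAt (poleProfileDeriv κ) (poleProfileDeriv2 κ t) t := by
  have hs := Real.hasDerivAt_sqrt ht.ne'
  have hs0 : √t ≠ 0 := (Real.sqrt_pos.2 ht).ne'
  have h1 : HasDerivAt (fun t => 1 / t + κ / √t) (-(1 / t ^ 2 + κ / (2 * (t * √t)))) t := by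
    have := ((hasDerivAt_const t (1 : ℝ)).div (hasDerivAt_id t) ht.ne').add
      ((hasDerivAt_const t κ).div hs hs0)
    refine this.congr_deriv ?_
    have hsq : √t ^ 2 = t := Real.sq_sqrt ht.le
    simp only [id]
    generalize √t = r at *
    subst hsq
    field_simp
    ring
  refine ((hasDerivAt_max_sq t).mul h1).congr_deriv ?_
  rw [poleProfileDeriv2]; ring

theorem contDiffAt_poleProfile (κ : ℝ) {t : ℝ} (ht : 0 < t) :
    ContDiffAt ℝ 2 (poleProfile κ) t := by
  have hopen : IsOpen (Set.Ioi (0 : ℝ)) := isOpen_Ioi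
  suffices ContDiffOn ℝ 2 (poleProfile κ) (Set.Ioi 0) from this.contDiffAt (Ioi_mem_nhds ht)
  rw [show (2 : WithTop ℕ∞) = 1 + 1 by norm_num, contDiffOn_succ_iff_deriv_of_isOpen hopen]
  refine ⟨fun s hs => (hasDerivAt_poleProfile κ hs).differentiableAt.differentiableWithinAt,
    by simp, ?_⟩
  have h1 : ContDiffOn ℝ 1 (poleProfileDeriv κ) (Set.Ioi 0) := by
    rw [show (1 : WithTop ℕ∞) = 0 + 1 by norm_num, contDiffOn_succ_iff_deriv_of_isOpen hopen]
    refine ⟨fun s hs => (hasDerivAt_poleProfileDeriv κ hs).differentiableAt.differentiableWithinAt,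
      by simp, ?_⟩
    rw [contDiffOn_zero]
    have : ContinuousOn (poleProfileDeriv2 κ) (Set.Ioi 0) := by
      unfold poleProfileDeriv2
      have a1 : ∀ s ∈ Set.Ioi (0 : ℝ), s ≠ 0 := fun s hs => (Set.mem_Ioi.1 hs).ne'
      have a2 : ∀ s ∈ Set.Ioi (0 : ℝ), √s ≠ 0 := fun s hs => (Real.sqrt_pos.2 hs).ne'
      have a3 : ∀ s ∈ Set.Ioi (0 : ℝ), s ^ 2 ≠ 0 := fun s hs => pow_ne_zero 2 (a1 s hs)
      have a4 : ∀ s ∈ Set.Ioi (0 : ℝ), 2 * (s * √s) ≠ 0 := fun s hs =>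
        mul_ne_zero two_ne_zero (mul_ne_zero (a1 s hs) (a2 s hs))
      fun_prop (disch := assumption)
    exact this.congr fun s hs => (hasDerivAt_poleProfileDeriv κ hs).deriv
  exact h1.congr fun s hs => (hasDerivAt_poleProfile κ hs).deriv

theorem deriv_poleProfile (κ : ℝ) {t : ℝ} (ht : 0 < t) :
    deriv (poleProfile κ) t = poleProfileDeriv κ t :=
  (hasDerivAt_poleProfile κ ht).deriv

theorem deriv_deriv_poleProfile (κ : ℝ) {t : ℝ} (ht : 0 < t) :
    deriv (deriv (poleProfile κ)) t = poleProfileDeriv2 κ t := by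
  have : deriv (poleProfile κ) =ᶠ[𝓝 t] poleProfileDeriv κ := by
    filter_upwards [lt_mem_nhds ht] with s hs using deriv_poleProfile κ hs
  rw [this.deriv_eq]
  exact (hasDerivAt_poleProfileDeriv κ ht).deriv

theorem poleProfile_of_one_le (κ : ℝ) {t : ℝ} (ht : 1 ≤ t) : poleProfile κ t = 0 := by
  simp [poleProfile, not_lt.2 ht]

theorem poleProfile_bounds {κ : ℝ} (hκ : 0 ≤ κ) {t : ℝ} (ht : 0 < t) :
    poleProfile κ t ≤ 0 ∧ poleProfile κ t ≤ Real.log t + 2 ∧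
      (t < 1 → Real.log t - 2 * κ ≤ poleProfile κ t) := by
  rcases lt_or_ge t 1 with h | h
  · simp only [poleProfile, h, if_true]
    have hsq : √t ^ 2 = t := Real.sq_sqrt ht.le
    have hs0 : 0 < √t := Real.sqrt_pos.2 ht
    have hs1 : √t < 1 := by rw [Real.sqrt_lt' one_pos]; simpa
    have hlog : Real.log t ≤ 2 * t - t ^ 2 / 2 - 3 / 2 := by
      -- The derivative is 2 - t - 1/t = -(1-t)²/t, and the function vanishes at t = 1.
      have hanti : AntitoneOn (fun t => 2 * t - t ^ 2 / 2 - 3 / 2 - Real.log t) (Set.Ioc 0 1) := by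
        refine antitoneOn_of_deriv_nonpos (convex_Ioc 0 1) ?_ ?_ ?_
        · have : ContinuousOn Real.log (Set.Ioc 0 1) :=
            Real.continuousOn_log.mono fun s hs => hs.1.ne'
          fun_prop
        · intro s hs
          rw [interior_Ioc] at hs
          have : s ≠ 0 := hs.1.ne'
          exact (by fun_prop (disch := assumption) : DifferentiableAt ℝ _ s).differentiableWithinAt
        · intro s hs
          rw [interior_Ioc] at hs
          have hs0 : s ≠ 0 := hs.1.ne'
          have hid := hasDerivAt_id s
          have := (((hid.const_mul 2).sub ((hid.pow 2).div_const 2)).sub_const (3 / 2)).sub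
            (Real.hasDerivAt_log hs0)
          have hd : deriv (fun t => 2 * t - t ^ 2 / 2 - 3 / 2 - Real.log t) s = _ := this.deriv
          rw [hd]
          simp only [id]
          have : 1 < s⁻¹ := (one_lt_inv₀ hs.1).2 hs.2
          have h2 : s * s⁻¹ = 1 := mul_inv_cancel₀ hs0
          norm_num
          nlinarith [hs.1, hs.2, sq_nonneg (s - 1)]
      have := hanti ⟨ht, h.le⟩ ⟨one_pos, le_rfl⟩ h.le
      norm_num at this
      linarith
    generalize √t = r at *
    subst hsq
    have k1 : 2 * r - 4 / 3 * (r ^ 2 * r) + 2 / 5 * ((r ^ 2) ^ 2 * r) - 16 / 15 ≤ 0 := by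
      have : 0 ≤ (1 - r) ^ 3 * (16 / 15 + 6 / 5 * r + 2 / 5 * r ^ 2) := by
        have : 0 ≤ 1 - r := by linarith
        positivity
      nlinarith
    have k2 : -2 ≤ 2 * r - 4 / 3 * (r ^ 2 * r) + 2 / 5 * ((r ^ 2) ^ 2 * r) - 16 / 15 := by
      have : r ^ 2 * r ≤ r := by nlinarith
      have : 0 ≤ (r ^ 2) ^ 2 * r := by positivity
      nlinarith
    have k3 := mul_nonpos_of_nonneg_of_nonpos hκ k1
    have k4 := mul_le_mul_of_nonneg_left k2 hκ
    refine ⟨by linarith, by nlinarith, fun _ => ?_⟩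
    nlinarith
  · rw [poleProfile_of_one_le κ h]
    have := Real.log_nonneg h
    exact ⟨le_rfl, by linarith, fun h' => absurd h (not_le.2 h')⟩

/-- The lower bound for the Laplacian of the profile composed with a function `s` such that
`Δ s ≥ 4 e (1 - c √s)` and `|∇ s|² ≤ 4 s e (1 + c √s)`, in the variable `t = s / δ²`. -/
theorem poleProfile_laplacian_lower {c δ t e S G : ℝ} (hc : 0 ≤ c) (hδ : 0 ≤ δ) (hcδ : c * δ ≤ 1)
    (ht : 0 < t) (he : 0 ≤ e) (hS : 4 * e * (1 - c * (δ * √t)) ≤ S)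
    (hG : G ≤ 4 * t * e * (1 + c * (δ * √t))) :
    -(104 * e) ≤ poleProfileDeriv2 (4 * (c * δ)) t * G + poleProfileDeriv (4 * (c * δ)) t * S := by
  set b := c * δ with hb
  have hb0 : 0 ≤ b := by positivity
  have hsq : √t ^ 2 = t := Real.sq_sqrt ht.le
  have hs0 : 0 < √t := Real.sqrt_pos.2 ht
  rw [← mul_assoc, ← hb] at hS hG
  have hm0 : 0 ≤ max (1 - t) 0 := le_max_right _ _
  have hm1 : max (1 - t) 0 ≤ 1 := max_le (by linarith) zero_le_one
  have hd1 : 0 ≤ poleProfileDeriv (4 * b) t := by unfold poleProfileDeriv; positivity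
  have hd2 : poleProfileDeriv2 (4 * b) t ≤ 0 := by
    unfold poleProfileDeriv2
    have : 0 ≤ max (1 - t) 0 * (1 / t + 4 * b / √t) := by positivity
    have : 0 ≤ max (1 - t) 0 ^ 2 * (1 / t ^ 2 + 4 * b / (2 * (t * √t))) := by positivity
    linarith
  have h1 := mul_le_mul_of_nonneg_left hS hd1
  have h2 := mul_le_mul_of_nonpos_left hG hd2
  refine le_trans ?_ (add_le_add h2 h1)
  rcases le_or_gt 1 t with h | h
  · have : max (1 - t) 0 = 0 := max_eq_right (by linarith)
    simp only [poleProfileDeriv, poleProfileDeriv2, this]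
    simp; positivity
  · have hm : max (1 - t) 0 = 1 - t := max_eq_left (by linarith)
    simp only [poleProfileDeriv, poleProfileDeriv2, hm]
    have hs1 : √t < 1 := by rw [Real.sqrt_lt' one_pos]; simpa
    generalize √t = r at *
    subst hsq
    -- Here r = √t and b = cδ. The errors in S and G contribute -8eb/r near the pole; the √t part of
    -- the profile contributes +2κe/r. The choice κ = 4b cancels them exactly, and what remains is
    -- bounded.
    have key : (-2 * (1 - r ^ 2) * (1 / r ^ 2 + 4 * b / r) -
        (1 - r ^ 2) ^ 2 * (1 / (r ^ 2) ^ 2 + 4 * b / (2 * (r ^ 2 * r)))) *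
        (4 * r ^ 2 * e * (1 + b * r)) +
        (1 - r ^ 2) ^ 2 * (1 / r ^ 2 + 4 * b / r) * (4 * e * (1 - b * r)) =
        -(4 * e) * ((1 - r ^ 2) ^ 2 * (6 * b ^ 2) +
          2 * (1 - r ^ 2) * (1 + 4 * b * r) * (1 + b * r)) := by
      field_simp
      ring
    rw [key]
    have hr2 : r ^ 2 < 1 := h
    have hbr : b * r ≤ 1 := mul_le_one₀ hcδ hs0.le hs1.le
    have hbr0 : 0 ≤ b * r := by positivity
    have e1 : (1 - r ^ 2) ^ 2 * (6 * b ^ 2) ≤ 6 := by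
      have : (1 - r ^ 2) ^ 2 ≤ 1 := pow_le_one₀ (by linarith) (by nlinarith)
      have h3 : b ^ 2 ≤ 1 := pow_le_one₀ hb0 hcδ
      nlinarith [mul_le_one₀ this (sq_nonneg b) h3]
    have e2 : (1 - r ^ 2) * (1 + 4 * b * r) * (1 + b * r) ≤ 1 * 5 * 2 := by
      have i1 : 1 - r ^ 2 ≤ 1 := by nlinarith
      have i0 : 0 ≤ 1 - r ^ 2 := by linarith
      have i2 : 1 + 4 * b * r ≤ 5 := by linarith
      have i3 : 1 + b * r ≤ 2 := by linarith
      gcongr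
    -- The constant is 104 = 4 · (6 + 2 · 10), from `e1` and `e2`.
    nlinarith

end Profile

theorem mdifferentiable_of_mem_maximalAtlas {n : ℕ} {M : Type*} [TopologicalSpace M]
    [ChartedSpace (EuclideanSpace ℝ (Fin n)) M]
    {e : OpenPartialHomeomorph M (EuclideanSpace ℝ (Fin n))}
    (he : e ∈ IsManifold.maximalAtlas (𝓡 n) ∞ M) :
    e.MDifferentiable (𝓡 n) (𝓡 n) :=
  ⟨(contMDiffOn_of_mem_maximalAtlas he).mdifferentiableOn (by simp),
    (contMDiffOn_symm_of_mem_maximalAtlas he).mdifferentiableOn (by simp)⟩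

/-! ### The metric and the Levi-Civita connection in a chart, as bilinear maps. -/

section ChartGeometry

variable {n : ℕ} {M : Type*} [TopologicalSpace M] [ChartedSpace (EuclideanSpace ℝ (Fin n)) M]
  [IsManifold (𝓡 n) ∞ M]

local notation "𝔼" => EuclideanSpace ℝ (Fin n)

/-- The metric in the chart `e`, as a function of the coordinates with values in bilinear forms. -/
def metricForm (g : Metric n M) (e : OpenPartialHomeomorph M (EuclideanSpace ℝ (Fin n)))
    (y : EuclideanSpace ℝ (Fin n)) :
    EuclideanSpace ℝ (Fin n) →L[ℝ] EuclideanSpace ℝ (Fin n) →L[ℝ] ℝ :=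
  ∑ j, ∑ k, metricMatrix g e y j k •
    (EuclideanSpace.proj (𝕜 := ℝ) j : 𝔼 →L[ℝ] ℝ).smulRight
      (EuclideanSpace.proj (𝕜 := ℝ) k : 𝔼 →L[ℝ] ℝ)

/-- The Christoffel symbols in the chart `e` as a bilinear map. -/
def christoffelForm (g : Metric n M) (e : OpenPartialHomeomorph M (EuclideanSpace ℝ (Fin n)))
    (y : EuclideanSpace ℝ (Fin n)) :
    EuclideanSpace ℝ (Fin n) →L[ℝ] EuclideanSpace ℝ (Fin n) →L[ℝ] EuclideanSpace ℝ (Fin n) :=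
  ∑ i, ∑ j, ∑ k, christoffel g e y i j k •
    (EuclideanSpace.proj (𝕜 := ℝ) j : 𝔼 →L[ℝ] ℝ).smulRight
      ((EuclideanSpace.proj (𝕜 := ℝ) k : 𝔼 →L[ℝ] ℝ).smulRight (EuclideanSpace.single i (1 : ℝ)))

variable (g : Metric n M) {e : OpenPartialHomeomorph M (EuclideanSpace ℝ (Fin n))}

theorem metricForm_apply (y a b : 𝔼) :
    metricForm g e y a b = ∑ j, ∑ k, metricMatrix g e y j k * (a j * b k) := by
  simp [metricForm]

theorem christoffelForm_apply (y a b : 𝔼) (i : Fin n) :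
    christoffelForm g e y a b i = ∑ j, ∑ k, christoffel g e y i j k * (a j * b k) := by
  simp only [christoffelForm, _root_.sum_apply, _root_.smul_apply,
    ContinuousLinearMap.smulRight_apply, WithLp.ofLp_sum, Finset.sum_apply, PiLp.smul_apply,
    PiLp.single_apply, smul_eq_mul, PiLp.proj_apply]
  simp only [mul_ite, mul_one, mul_zero]
  rw [Finset.sum_eq_single i]
  · simp
  · intro j _ hj; simp [Ne.symm hj]
  · simp

theorem sum_smul_single (a : 𝔼) : a = ∑ j, a j • EuclideanSpace.single j (1 : ℝ) := by
  ext i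
  simp [WithLp.ofLp_sum, Finset.sum_apply, Pi.single_apply]

theorem metricForm_apply_eq_inner (y a b : 𝔼) :
    metricForm g e y a b = g.inner (e.symm y) (mfderiv (𝓡 n) (𝓡 n) e.symm y a)
      (mfderiv (𝓡 n) (𝓡 n) e.symm y b) := by
  set T : 𝔼 →L[ℝ] 𝔼 := mfderiv (𝓡 n) (𝓡 n) e.symm y with hT
  set I : 𝔼 →L[ℝ] 𝔼 →L[ℝ] ℝ := g.inner (e.symm y) with hI
  change _ = I (T a) (T b)
  have hm : ∀ j k, metricMatrix g e y j k =
      I (T (EuclideanSpace.single j 1)) (T (EuclideanSpace.single k 1)) := fun j k => rfl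
  rw [metricForm_apply]
  conv_rhs => rw [sum_smul_single a, sum_smul_single b]
  simp only [map_sum, map_smul, _root_.sum_apply, _root_.smul_apply, hm, smul_eq_mul,
    Finset.mul_sum]
  rw [Finset.sum_comm]
  refine Finset.sum_congr rfl fun j _ => Finset.sum_congr rfl fun k _ => ?_
  ring

theorem metricForm_symm (y a b : 𝔼) : metricForm g e y a b = metricForm g e y b a := by
  rw [metricForm_apply_eq_inner, metricForm_apply_eq_inner]
  exact g.symm _ _ _

theorem metricMatrix_symm (y : 𝔼) (j k : Fin n) :
    metricMatrix g e y j k = metricMatrix g e y k j :=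
  g.symm _ _ _

theorem metricForm_chart_apply (he : e ∈ IsManifold.maximalAtlas (𝓡 n) ∞ M) {q : M}
    (hq : q ∈ e.source) (ξ η : TangentSpace (𝓡 n) q) :
    metricForm g e (e q) (mfderiv (𝓡 n) (𝓡 n) e q ξ) (mfderiv (𝓡 n) (𝓡 n) e q η) =
      g.inner q ξ η := by
  have hc := (mdifferentiable_of_mem_maximalAtlas he).symm_comp_deriv hq
  have h1 : ∀ ξ : TangentSpace (𝓡 n) q,
      (mfderiv (𝓡 n) (𝓡 n) e.symm (e q) (mfderiv (𝓡 n) (𝓡 n) e q ξ) : 𝔼) = ξ := fun ξ =>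
    congrArg (fun T : TangentSpace (𝓡 n) q →L[ℝ] TangentSpace (𝓡 n) q => T ξ) hc
  -- The base point `e.symm (e q)` equals q only propositionally. Every tangent space unfolds to the
  -- model space, so the change of base point is made on bilinear forms there.
  have h2 : ∀ q' : M, q' = q → ∀ a b : 𝔼,
      (g.inner q' : 𝔼 →L[ℝ] 𝔼 →L[ℝ] ℝ) a b = (g.inner q : 𝔼 →L[ℝ] 𝔼 →L[ℝ] ℝ) a b := by
    rintro q' rfl a b; rfl
  have h3 := h2 _ (e.left_inv hq) (mfderiv (𝓡 n) (𝓡 n) e.symm (e q) (mfderiv (𝓡 n) (𝓡 n) e q ξ))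
    (mfderiv (𝓡 n) (𝓡 n) e.symm (e q) (mfderiv (𝓡 n) (𝓡 n) e q η))
  exact (metricForm_apply_eq_inner g (e q) _ _).trans (h3.trans
    (congrArg₂ (fun a b : 𝔼 => (g.inner q : 𝔼 →L[ℝ] 𝔼 →L[ℝ] ℝ) a b) (h1 ξ) (h1 η)))

theorem metricForm_pos (he : e ∈ IsManifold.maximalAtlas (𝓡 n) ∞ M) {y : 𝔼} (hy : y ∈ e.target)
    {a : 𝔼} (ha : a ≠ 0) : 0 < metricForm g e y a a := by
  rw [metricForm_apply_eq_inner]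
  refine g.pos _ _ fun h => ha ?_
  exact (mdifferentiable_of_mem_maximalAtlas he).symm.mfderiv_injective
    (by simpa using hy) (h.trans (map_zero _).symm)

/-- The coordinate fields are the tangent map of `e.symm` applied to constant fields, hence smooth
sections; pairing them with the smooth section g gives a smooth function. -/
theorem contDiffOn_metricMatrix (he : e ∈ IsManifold.maximalAtlas (𝓡 n) ∞ M) (j k : Fin n) :
    ContDiffOn ℝ ∞ (fun y => metricMatrix g e y j k) e.target := by
  have hsec : ∀ v : 𝔼, ContMDiffOn (𝓡 n) (𝓡 n).tangent ∞
      (fun y => (⟨e.symm y, mfderiv (𝓡 n) (𝓡 n) e.symm y v⟩ : TangentBundle (𝓡 n) M))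
      e.target := by
    intro v
    have h1 := (contMDiffOn_symm_of_mem_maximalAtlas he).contMDiffOn_tangentMapWithin
      (m := ∞) (by simp) e.open_target.uniqueMDiffOn
    have h2 : ContMDiff (𝓡 n) (𝓡 n).tangent ∞
        (fun y => (⟨y, v⟩ : TangentBundle (𝓡 n) 𝔼)) :=
      contMDiff_vectorSpace_iff_contDiff.2 contDiff_const
    have h3 := h1.comp (h2.contMDiffOn (s := e.target)) fun y hy => hy
    refine h3.congr fun y hy => ?_
    simp only [Function.comp, tangentMapWithin]
    rw [mfderivWithin_of_isOpen e.open_target hy]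
  refine contMDiffOn_iff_contDiffOn.1 fun y hy => ?_
  have hb := (contMDiffOn_symm_of_mem_maximalAtlas he) y hy
  have h4 : ContMDiffWithinAt (𝓡 n) ((𝓡 n).prod 𝓘(ℝ)) ∞
      (fun y => Bundle.TotalSpace.mk' ℝ (E := Bundle.Trivial M ℝ) (e.symm y)
        (g.inner (e.symm y) (coordVec e y j) (coordVec e y k))) e.target y := by
    apply ContMDiffWithinAt.clm_bundle_apply₂ (F₁ := 𝔼) (F₂ := 𝔼)
    · exact ContMDiffAt.comp_contMDiffWithinAt y g.contMDiff.contMDiffAt hb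
    · exact hsec _ y hy
    · exact hsec _ y hy
  simp only [Bundle.contMDiffWithinAt_totalSpace] at h4
  exact h4.2

theorem contDiffOn_metricForm (he : e ∈ IsManifold.maximalAtlas (𝓡 n) ∞ M) :
    ContDiffOn ℝ ∞ (metricForm g e) e.target := by
  unfold metricForm
  refine ContDiffOn.sum fun j _ => ContDiffOn.sum fun k _ => ?_
  exact (ContinuousLinearMap.toSpanSingleton ℝ _).contDiff.comp_contDiffOn
    (contDiffOn_metricMatrix g he j k)

theorem metricMatrix_det_ne_zero (he : e ∈ IsManifold.maximalAtlas (𝓡 n) ∞ M) {y : 𝔼}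
    (hy : y ∈ e.target) : (metricMatrix g e y).det ≠ 0 := by
  intro h0
  obtain ⟨v, hv, hv0⟩ := Matrix.exists_mulVec_eq_zero_iff.2 h0
  have hpos := metricForm_pos g he hy (a := WithLp.toLp 2 v) (by simpa using hv)
  rw [metricForm_apply] at hpos
  have : ∀ j, ∑ k, metricMatrix g e y j k * (v j * v k) = v j * (metricMatrix g e y).mulVec v j := by
    intro j
    simp only [Matrix.mulVec, dotProduct, Finset.mul_sum]
    exact Finset.sum_congr rfl fun k _ => by ring
  simp [this, hv0] at hpos

/-- By Cramer's rule the entries are polynomials in the g_jk divided by the nonvanishing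
determinant. -/
theorem contDiffOn_metricMatrix_inv (he : e ∈ IsManifold.maximalAtlas (𝓡 n) ∞ M) (j k : Fin n) :
    ContDiffOn ℝ ∞ (fun y => (metricMatrix g e y)⁻¹ j k) e.target := by
  have hdet : ∀ A : 𝔼 → Matrix (Fin n) (Fin n) ℝ,
      (∀ j k, ContDiffOn ℝ ∞ (fun y => A y j k) e.target) →
      ContDiffOn ℝ ∞ (fun y => (A y).det) e.target := by
    intro A hA
    simp only [Matrix.det_apply]
    refine ContDiffOn.sum fun σ _ => ContDiffOn.const_smul _ ?_
    exact contDiffOn_prod fun i _ => hA _ _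
  have h1 := hdet _ (contDiffOn_metricMatrix g he)
  have h2 : ContDiffOn ℝ ∞ (fun y => (metricMatrix g e y).adjugate j k) e.target := by
    simp only [Matrix.adjugate_apply]
    refine hdet _ fun a b => ?_
    by_cases ha : a = k
    · subst ha
      simp only [Matrix.updateRow_self]
      exact contDiffOn_const
    · simp only [Matrix.updateRow_ne ha]
      exact contDiffOn_metricMatrix g he a b
  have h3 := (h1.inv fun y hy => metricMatrix_det_ne_zero g he hy).mul h2
  refine h3.congr fun y hy => ?_
  simp [Matrix.inv_def]

theorem contDiffOn_metricDeriv (he : e ∈ IsManifold.maximalAtlas (𝓡 n) ∞ M) (l j k : Fin n) :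
    ContDiffOn ℝ ∞ (fun y => metricDeriv g e y l j k) e.target :=
  ((contDiffOn_metricMatrix g he j k).fderiv_of_isOpen e.open_target (by simp)).clm_apply
    contDiffOn_const

theorem contDiffOn_christoffelForm (he : e ∈ IsManifold.maximalAtlas (𝓡 n) ∞ M) :
    ContDiffOn ℝ ∞ (christoffelForm g e) e.target := by
  unfold christoffelForm
  refine ContDiffOn.sum fun i _ => ContDiffOn.sum fun j _ => ContDiffOn.sum fun k _ => ?_
  refine (ContinuousLinearMap.toSpanSingleton ℝ _).contDiff.comp_contDiffOn ?_
  refine contDiffOn_const.mul (ContDiffOn.sum fun l _ => ?_)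
  exact (contDiffOn_metricMatrix_inv g he i l).mul
    (((contDiffOn_metricDeriv g he j k l).add (contDiffOn_metricDeriv g he k j l)).sub
      (contDiffOn_metricDeriv g he l j k))

theorem metricDeriv_symm (y : 𝔼) (l j k : Fin n) :
    metricDeriv g e y l j k = metricDeriv g e y l k j := by
  unfold metricDeriv
  congr 2
  ext y'
  exact metricMatrix_symm g y' j k

/-- This is the absence of torsion; along a disc it gives ∇_x u_y = ∇_y u_x. -/
theorem christoffelForm_symm (y a b : 𝔼) : christoffelForm g e y a b = christoffelForm g e y b a := by
  ext i
  rw [christoffelForm_apply, christoffelForm_apply, Finset.sum_comm]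
  refine Finset.sum_congr rfl fun j _ => Finset.sum_congr rfl fun k _ => ?_
  have : christoffel g e y i k j = christoffel g e y i j k := by
    unfold christoffel
    congr 1
    refine Finset.sum_congr rfl fun l _ => ?_
    rw [metricDeriv_symm g y l j k]; ring
  rw [this]; ring

theorem sum_metricMatrix_mul_christoffel (he : e ∈ IsManifold.maximalAtlas (𝓡 n) ∞ M) {y : 𝔼}
    (hy : y ∈ e.target) (m j k : Fin n) :
    ∑ i, metricMatrix g e y m i * christoffel g e y i j k =
      (1 / 2) * (metricDeriv g e y j k m + metricDeriv g e y k j m - metricDeriv g e y m j k) := by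
  have hinv : metricMatrix g e y * (metricMatrix g e y)⁻¹ = 1 :=
    Matrix.mul_nonsing_inv _ (isUnit_iff_ne_zero.2 (metricMatrix_det_ne_zero g he hy))
  simp only [christoffel, Finset.mul_sum]
  rw [Finset.sum_comm]
  have : ∀ l, ∑ i, metricMatrix g e y m i * (1 / 2 * ((metricMatrix g e y)⁻¹ i l *
      (metricDeriv g e y j k l + metricDeriv g e y k j l - metricDeriv g e y l j k))) =
      (1 : Matrix (Fin n) (Fin n) ℝ) m l * (1 / 2 *
      (metricDeriv g e y j k l + metricDeriv g e y k j l - metricDeriv g e y l j k)) := by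
    intro l
    rw [← hinv, Matrix.mul_apply, Finset.sum_mul]
    exact Finset.sum_congr rfl fun i _ => by ring
  simp only [this, Matrix.one_apply]
  simp

/-- The Christoffel symbols define a connection compatible with the metric. -/
theorem fderiv_metricForm (he : e ∈ IsManifold.maximalAtlas (𝓡 n) ∞ M) {y : 𝔼}
    (hy : y ∈ e.target) (c a b : 𝔼) :
    fderiv ℝ (metricForm g e) y c a b =
      metricForm g e y (christoffelForm g e y c a) b +
        metricForm g e y a (christoffelForm g e y c b) := by
  have hd : ∀ j k, DifferentiableAt ℝ (fun y => metricMatrix g e y j k) y := fun j k =>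
    ((contDiffOn_metricMatrix g he j k).contDiffAt (e.open_target.mem_nhds hy)).differentiableAt
      (by simp)
  have hdir : ∀ j k, fderiv ℝ (fun y => metricMatrix g e y j k) y c =
      ∑ l, c l * metricDeriv g e y l j k := by
    intro j k
    conv_lhs => rw [sum_smul_single c]
    simp [metricDeriv]
  have hF : DifferentiableAt ℝ (metricForm g e) y :=
    ((contDiffOn_metricForm g he).contDiffAt (e.open_target.mem_nhds hy)).differentiableAt (by simp)
  have hL : fderiv ℝ (metricForm g e) y c a b =
      ∑ j, ∑ k, (∑ l, c l * metricDeriv g e y l j k) * (a j * b k) := by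
    have h1 : HasFDerivAt (fun y => metricForm g e y a b)
        (((fderiv ℝ (metricForm g e) y).flip a).flip b) y := by
      have := (hF.hasFDerivAt.clm_apply (hasFDerivAt_const a y)).clm_apply (hasFDerivAt_const b y)
      refine this.congr_fderiv ?_
      ext v; simp
    have h2 : HasFDerivAt (fun y => metricForm g e y a b)
        (∑ j, ∑ k, (a j * b k) • fderiv ℝ (fun y => metricMatrix g e y j k) y) y := by
      simp only [metricForm_apply]
      refine HasFDerivAt.fun_sum fun j _ => HasFDerivAt.fun_sum fun k _ => ?_
      exact (hd j k).hasFDerivAt.mul_const (a j * b k)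
    have h3 := congrArg (fun T : 𝔼 →L[ℝ] ℝ => T c) (h1.unique h2)
    simp only [ContinuousLinearMap.flip_apply, _root_.sum_apply, _root_.smul_apply,
      hdir, smul_eq_mul] at h3
    rw [h3]
    exact Finset.sum_congr rfl fun j _ => Finset.sum_congr rfl fun k _ => mul_comm _ _
  have hR : ∀ a b : 𝔼, metricForm g e y a (christoffelForm g e y c b) =
      ∑ j, ∑ k, (∑ l, c l * ((1 / 2) * (metricDeriv g e y l k j + metricDeriv g e y k l j -
        metricDeriv g e y j l k))) * (a j * b k) := by
    intro a b
    simp only [metricForm_apply, christoffelForm_apply]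
    refine Finset.sum_congr rfl fun j _ => ?_
    calc ∑ i, metricMatrix g e y j i * (a j * ∑ l, ∑ k, christoffel g e y i l k * (c l * b k))
        = ∑ i, ∑ l, ∑ k, (metricMatrix g e y j i * christoffel g e y i l k) *
            (a j * (c l * b k)) := by
          refine Finset.sum_congr rfl fun i _ => ?_
          simp only [Finset.mul_sum]
          exact Finset.sum_congr rfl fun l _ => Finset.sum_congr rfl fun k _ => by ring
      _ = ∑ l, ∑ k, ∑ i, (metricMatrix g e y j i * christoffel g e y i l k) *
            (a j * (c l * b k)) := by
          rw [Finset.sum_comm]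
          exact Finset.sum_congr rfl fun l _ => Finset.sum_comm
      _ = ∑ l, ∑ k, ((1 / 2) * (metricDeriv g e y l k j + metricDeriv g e y k l j -
            metricDeriv g e y j l k)) * (a j * (c l * b k)) := by
          refine Finset.sum_congr rfl fun l _ => Finset.sum_congr rfl fun k _ => ?_
          rw [← Finset.sum_mul, sum_metricMatrix_mul_christoffel g he hy]
      _ = _ := by
          rw [Finset.sum_comm]
          refine Finset.sum_congr rfl fun k _ => ?_
          rw [Finset.sum_mul]
          exact Finset.sum_congr rfl fun l _ => by ring
  -- In the sum of the two Christoffel terms the other two derivatives cancel in pairs, leaving ∂_l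
  -- g_jk.
  rw [hL, metricForm_symm g y (christoffelForm g e y c a) b, hR, hR]
  conv_rhs => lhs; rw [Finset.sum_comm]
  rw [← Finset.sum_add_distrib]
  refine Finset.sum_congr rfl fun j _ => ?_
  rw [← Finset.sum_add_distrib]
  refine Finset.sum_congr rfl fun k _ => ?_
  rw [mul_comm (b k) (a j), ← add_mul, ← Finset.sum_add_distrib]
  congr 1
  refine Finset.sum_congr rfl fun l _ => ?_
  rw [metricDeriv_symm g y l k j]
  ring

end ChartGeometry

/-! ### Bochner's formula for the conformal factor. -/

section Bochner

variable {E : Type*} [NormedAddCommGroup E] [NormedSpace ℝ E]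

/-- Bessel's inequality for the orthogonal pair p, q of equal length: expand B on a multiple of a
minus its projection to their span. If B p p = 0, semidefiniteness forces B a p = B a q = 0. -/
theorem sq_add_sq_le_of_conformal (B : E →L[ℝ] E →L[ℝ] ℝ) (hsymm : ∀ a b, B a b = B b a)
    (hnonneg : ∀ a, 0 ≤ B a a) {p q : E} (hpq : B p p = B q q) (horth : B p q = 0) (a : E) :
    B a p ^ 2 + B a q ^ 2 ≤ B a a * B p p := by
  rcases (hnonneg p).eq_or_lt with h0 | hpos
  · have hz : ∀ r : E, B r r = 0 → B a r = 0 := by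
      intro r hr
      by_contra hne
      have h := hnonneg (B a r • a - (B a a + 1) • r)
      simp only [map_sub, map_smul, _root_.sub_apply, _root_.smul_apply, smul_eq_mul, hr,
        hsymm r a] at h
      have : 0 < B a r ^ 2 := by positivity
      nlinarith [hnonneg a]
    rw [hz p h0.symm, hz q (hpq ▸ h0.symm), ← h0]
    simp
  · have h := hnonneg (B p p • a - (B a p • p + B a q • q))
    simp only [map_sub, map_add, map_smul, _root_.sub_apply, _root_.add_apply, _root_.smul_apply,
      smul_eq_mul, ← hpq, hsymm p a, hsymm q a, hsymm q p, horth] at h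
    have : 0 ≤ B p p * (B a a * B p p - (B a p ^ 2 + B a q ^ 2)) := by linarith
    nlinarith [nonneg_of_mul_nonneg_right this hpos]

/-- The covariant derivative in the direction `v`, along the map `X`, of the vector field `α`. -/
def covDeriv (Γ : E → E →L[ℝ] E →L[ℝ] E) (X : ℂ → E) (v : ℂ) (α : ℂ → E) (ζ : ℂ) : E :=
  fderiv ℝ α ζ v + Γ (X ζ) (fderiv ℝ X ζ v) (α ζ)

/-- The curvature operator of the pulled back connection. -/
def curvOp (Γ : E → E →L[ℝ] E →L[ℝ] E) (X : ℂ → E) (v w ζ : ℂ) : E →L[ℝ] E :=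
  fderiv ℝ (fun ζ => Γ (X ζ) (fderiv ℝ X ζ w)) ζ v -
    fderiv ℝ (fun ζ => Γ (X ζ) (fderiv ℝ X ζ v)) ζ w +
    (Γ (X ζ) (fderiv ℝ X ζ v)).comp (Γ (X ζ) (fderiv ℝ X ζ w)) -
    (Γ (X ζ) (fderiv ℝ X ζ w)).comp (Γ (X ζ) (fderiv ℝ X ζ v))

theorem fderiv_form_along {Gf : E → E →L[ℝ] E →L[ℝ] ℝ} {Γ : E → E →L[ℝ] E →L[ℝ] E} {X α β : ℂ → E}
    {ζ : ℂ} (hG : DifferentiableAt ℝ Gf (X ζ)) (hX : DifferentiableAt ℝ X ζ)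
    (hα : DifferentiableAt ℝ α ζ) (hβ : DifferentiableAt ℝ β ζ)
    (hcompat : ∀ c a b, fderiv ℝ Gf (X ζ) c a b =
      Gf (X ζ) (Γ (X ζ) c a) b + Gf (X ζ) a (Γ (X ζ) c b))
    (v : ℂ) :
    fderiv ℝ (fun ζ => Gf (X ζ) (α ζ) (β ζ)) ζ v =
      Gf (X ζ) (covDeriv Γ X v α ζ) (β ζ) + Gf (X ζ) (α ζ) (covDeriv Γ X v β ζ) := by
  have h1 : HasFDerivAt (fun ζ => Gf (X ζ)) ((fderiv ℝ Gf (X ζ)).comp (fderiv ℝ X ζ)) ζ :=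
    HasFDerivAt.comp (g := Gf) ζ hG.hasFDerivAt hX.hasFDerivAt
  have h2 := (h1.clm_apply hα.hasFDerivAt).clm_apply hβ.hasFDerivAt
  rw [h2.fderiv]
  simp [covDeriv, hcompat]
  abel

theorem fderiv_fderiv_apply {F : Type*} [NormedAddCommGroup F] [NormedSpace ℝ F] {f : ℂ → F}
    {ζ : ℂ} (hf : ContDiffAt ℝ 2 f ζ) (v w : ℂ) :
    fderiv ℝ (fun ζ => fderiv ℝ f ζ w) ζ v = fderiv ℝ (fderiv ℝ f) ζ v w := by
  have hd : DifferentiableAt ℝ (fderiv ℝ f) ζ :=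
    (hf.fderiv_right (m := 1) (by norm_num)).differentiableAt (by norm_num)
  rw [fderiv_clm_apply hd (by fun_prop)]
  simp

/-- The second derivatives of α cancel by symmetry and constant directions in the plane commute, so
the commutator of covariant derivatives is of order zero in α. -/
theorem covDeriv_covDeriv_sub {Γ : E → E →L[ℝ] E →L[ℝ] E} {X α : ℂ → E} {ζ : ℂ} {v w : ℂ}
    (hP : ∀ v, DifferentiableAt ℝ (fun ζ => Γ (X ζ) (fderiv ℝ X ζ v)) ζ)
    (hα : ContDiffAt ℝ 2 α ζ) :
    covDeriv Γ X v (covDeriv Γ X w α) ζ - covDeriv Γ X w (covDeriv Γ X v α) ζ =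
      curvOp Γ X v w ζ (α ζ) := by
  have hαd : DifferentiableAt ℝ α ζ := hα.differentiableAt (by norm_num)
  have hd : DifferentiableAt ℝ (fderiv ℝ α) ζ :=
    (hα.fderiv_right (m := 1) (by norm_num)).differentiableAt (by norm_num)
  have key : ∀ v w : ℂ, fderiv ℝ (covDeriv Γ X w α) ζ v = fderiv ℝ (fderiv ℝ α) ζ v w +
      (fderiv ℝ (fun ζ => Γ (X ζ) (fderiv ℝ X ζ w)) ζ v (α ζ) +
        Γ (X ζ) (fderiv ℝ X ζ w) (fderiv ℝ α ζ v)) := by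
    intro v w
    have h1 : HasFDerivAt (fun ζ => fderiv ℝ α ζ w) _ ζ :=
      hd.hasFDerivAt.clm_apply (hasFDerivAt_const w ζ)
    have h2 := (hP w).hasFDerivAt.clm_apply hαd.hasFDerivAt
    have h3 : HasFDerivAt (covDeriv Γ X w α) _ ζ := h1.add h2
    rw [h3.fderiv]
    simp
    abel
  have hsym := (hα.isSymmSndFDerivAt (by simp)).eq v w
  have hcd : ∀ (v : ℂ) (β : ℂ → E), covDeriv Γ X v β ζ =
      fderiv ℝ β ζ v + Γ (X ζ) (fderiv ℝ X ζ v) (β ζ) := fun _ _ => rfl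
  rw [hcd v (covDeriv Γ X w α), hcd w (covDeriv Γ X v α), key, key, hsym]
  simp only [covDeriv, curvOp, map_add, _root_.sub_apply, _root_.add_apply,
    ContinuousLinearMap.comp_apply]
  abel

/-- Bochner's inequality: the logarithm of the conformal factor of a conformal harmonic map has
locally bounded below Laplacian, away from the zeros of the conformal factor. -/
theorem laplacian_log_conformalFactor_bound {Gf : E → E →L[ℝ] E →L[ℝ] ℝ}
    {Γ : E → E →L[ℝ] E →L[ℝ] E} {X : ℂ → E} {N : Set ℂ} {T : Set E} (hN : IsOpen N) (hT : IsOpen T)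
    (hX : ContDiffOn ℝ ∞ X N) (hXT : Set.MapsTo X N T) (hG : ContDiffOn ℝ ∞ Gf T)
    (hΓ : ContDiffOn ℝ ∞ Γ T) (hGs : ∀ y a b, Gf y a b = Gf y b a)
    (hΓs : ∀ y a b, Γ y a b = Γ y b a)
    (hcompat : ∀ y ∈ T, ∀ c a b, fderiv ℝ Gf y c a b = Gf y (Γ y c a) b + Gf y a (Γ y c b))
    {m : ℝ} (hm : 0 < m) (hpos : ∀ y ∈ T, ∀ a, m * ‖a‖ ^ 2 ≤ Gf y a a)
    (hharm : ∀ ζ ∈ N, Δ X ζ + (Γ (X ζ) (fderiv ℝ X ζ 1) (fderiv ℝ X ζ 1) +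
      Γ (X ζ) (fderiv ℝ X ζ Complex.I) (fderiv ℝ X ζ Complex.I)) = 0)
    (hconf : ∀ ζ ∈ N, Gf (X ζ) (fderiv ℝ X ζ 1) (fderiv ℝ X ζ 1) =
      Gf (X ζ) (fderiv ℝ X ζ Complex.I) (fderiv ℝ X ζ Complex.I))
    (horth : ∀ ζ ∈ N, Gf (X ζ) (fderiv ℝ X ζ 1) (fderiv ℝ X ζ Complex.I) = 0)
    {e : ℂ → ℝ} (he : ∀ ζ ∈ N, e ζ = Gf (X ζ) (fderiv ℝ X ζ 1) (fderiv ℝ X ζ 1))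
    {z : ℂ} (hz : z ∈ N) :
    ∃ C, ∀ᶠ ζ in 𝓝 z, e ζ ≠ 0 → ContDiffAt ℝ 2 e ζ ∧ -C ≤ Δ (fun ζ => Real.log (e ζ)) ζ := by
  have hXs : ∀ ζ ∈ N, ContDiffAt ℝ ∞ X ζ := fun ζ h => hX.contDiffAt (hN.mem_nhds h)
  have hXv : ∀ v : ℂ, ∀ ζ ∈ N, ContDiffAt ℝ ∞ (fun ζ => fderiv ℝ X ζ v) ζ := fun v ζ h =>
    ((hXs ζ h).fderiv_right (m := ∞) (by simp)).clm_apply contDiffAt_const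
  have hGX : ∀ ζ ∈ N, ContDiffAt ℝ ∞ (fun ζ => Gf (X ζ)) ζ := fun ζ h =>
    (hG.contDiffAt (hT.mem_nhds (hXT h))).comp ζ (hXs ζ h)
  have hΓX : ∀ ζ ∈ N, ContDiffAt ℝ ∞ (fun ζ => Γ (X ζ)) ζ := fun ζ h =>
    (hΓ.contDiffAt (hT.mem_nhds (hXT h))).comp ζ (hXs ζ h)
  have hP : ∀ v : ℂ, ∀ ζ ∈ N, ContDiffAt ℝ ∞ (fun ζ => Γ (X ζ) (fderiv ℝ X ζ v)) ζ :=
    fun v ζ h => (hΓX ζ h).clm_apply (hXv v ζ h)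
  have hDs : ∀ v : ℂ, ∀ α : ℂ → E, (∀ ζ ∈ N, ContDiffAt ℝ ∞ α ζ) →
      ∀ ζ ∈ N, ContDiffAt ℝ ∞ (covDeriv Γ X v α) ζ := fun v α hα ζ h =>
    (((hα ζ h).fderiv_right (m := ∞) (by simp)).clm_apply contDiffAt_const).add
      ((hP v ζ h).clm_apply (hα ζ h))
  have hin : ∀ v : ℂ, ∀ α β : ℂ → E, (∀ ζ ∈ N, ContDiffAt ℝ ∞ α ζ) →
      (∀ ζ ∈ N, ContDiffAt ℝ ∞ β ζ) → ∀ ζ ∈ N, fderiv ℝ (fun ζ => Gf (X ζ) (α ζ) (β ζ)) ζ v =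
      Gf (X ζ) (covDeriv Γ X v α ζ) (β ζ) + Gf (X ζ) (α ζ) (covDeriv Γ X v β ζ) :=
    fun v α β hα hβ ζ h => fderiv_form_along
      ((hG.contDiffAt (hT.mem_nhds (hXT h))).differentiableAt (by simp))
      ((hXs ζ h).differentiableAt (by simp)) ((hα ζ h).differentiableAt (by simp))
      ((hβ ζ h).differentiableAt (by simp)) (hcompat _ (hXT h)) v
  set p : ℂ → E := fun ζ => fderiv ℝ X ζ 1 with hp
  set q : ℂ → E := fun ζ => fderiv ℝ X ζ Complex.I with hq
  have hps : ∀ ζ ∈ N, ContDiffAt ℝ ∞ p ζ := hXv 1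
  have hqs : ∀ ζ ∈ N, ContDiffAt ℝ ∞ q ζ := hXv Complex.I
  have h2le : (2 : WithTop ℕ∞) ≤ ∞ := WithTop.coe_le_coe.2 le_top
  have hX2 : ∀ ζ ∈ N, ContDiffAt ℝ 2 X ζ := fun ζ h => (hXs ζ h).of_le h2le
  set a : ℂ → E := covDeriv Γ X 1 p with ha
  set b : ℂ → E := covDeriv Γ X Complex.I p with hb
  have has := hDs 1 p hps
  have hbs := hDs Complex.I p hps
  have hbq : ∀ ζ ∈ N, covDeriv Γ X 1 q ζ = b ζ := by
    intro ζ h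
    simp only [hb, covDeriv, hp, hq]
    rw [fderiv_fderiv_apply (hX2 ζ h), fderiv_fderiv_apply (hX2 ζ h), hΓs,
      ((hX2 ζ h).isSymmSndFDerivAt (by simp)).eq]
  have haq : ∀ ζ ∈ N, covDeriv Γ X Complex.I q ζ = -a ζ := by
    intro ζ h
    have h1 := hharm ζ h
    rw [laplacian_eq_fderiv_fderiv] at h1
    simp only [ha, covDeriv, hp, hq]
    rw [fderiv_fderiv_apply (hX2 ζ h), fderiv_fderiv_apply (hX2 ζ h), eq_neg_iff_add_eq_zero,
      ← h1]
    abel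
  have hee : ∀ ζ ∈ N, e =ᶠ[𝓝 ζ] fun ζ => Gf (X ζ) (p ζ) (p ζ) := fun ζ h => by
    filter_upwards [hN.mem_nhds h] with ξ hξ using he ξ hξ
  have heq' : ∀ ζ ∈ N, e =ᶠ[𝓝 ζ] fun ζ => Gf (X ζ) (q ζ) (q ζ) := fun ζ h => by
    filter_upwards [hN.mem_nhds h] with ξ hξ using (he ξ hξ).trans (hconf ξ hξ)
  have hes : ∀ ζ ∈ N, ContDiffAt ℝ 2 e ζ := fun ζ h =>
    ((((hGX ζ h).clm_apply (hps ζ h)).clm_apply (hps ζ h)).of_le h2le).congr_of_eventuallyEq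
      (hee ζ h)
  have hde : ∀ v : ℂ, ∀ ζ ∈ N, fderiv ℝ e ζ v = 2 * Gf (X ζ) (covDeriv Γ X v p ζ) (p ζ) := by
    intro v ζ h
    rw [(hee ζ h).fderiv_eq, hin v p p hps hps ζ h, hGs _ (p ζ)]
    ring
  have hde' : ∀ v : ℂ, ∀ ζ ∈ N, fderiv ℝ e ζ v = 2 * Gf (X ζ) (covDeriv Γ X v q ζ) (q ζ) := by
    intro v ζ h
    rw [(heq' ζ h).fderiv_eq, hin v q q hqs hqs ζ h, hGs _ (q ζ)]
    ring
  have hdde : ∀ v : ℂ, ∀ ζ ∈ N, fderiv ℝ (fderiv ℝ e) ζ v v =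
      2 * (Gf (X ζ) (covDeriv Γ X v (covDeriv Γ X v p) ζ) (p ζ) +
        Gf (X ζ) (covDeriv Γ X v p ζ) (covDeriv Γ X v p ζ)) := by
    intro v ζ h
    have hev : (fun ζ => fderiv ℝ e ζ v) =ᶠ[𝓝 ζ]
        fun ζ => 2 * Gf (X ζ) (covDeriv Γ X v p ζ) (p ζ) := by
      filter_upwards [hN.mem_nhds h] with ξ hξ using hde v ξ hξ
    have hd : DifferentiableAt ℝ (fun ζ => Gf (X ζ) (covDeriv Γ X v p ζ) (p ζ)) ζ :=
      (((hGX ζ h).clm_apply (hDs v p hps ζ h)).clm_apply (hps ζ h)).differentiableAt (by simp)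
    rw [← fderiv_fderiv_apply (hes ζ h), hev.fderiv_eq, fderiv_const_mul hd,
      _root_.smul_apply, hin v _ p (hDs v p hps) hps ζ h, smul_eq_mul]
  set R : ℂ → E →L[ℝ] E := curvOp Γ X 1 Complex.I with hR
  have hRc : ContinuousAt R z := by
    have c : ∀ v : ℂ, ContinuousAt (fun ζ => Γ (X ζ) (fderiv ℝ X ζ v)) z := fun v =>
      (hP v z hz).continuousAt
    have d : ∀ v w : ℂ, ContinuousAt
        (fun ζ => fderiv ℝ (fun ζ => Γ (X ζ) (fderiv ℝ X ζ v)) ζ w) z := fun v w =>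
      ((((hP v z hz).fderiv_right (m := ∞) (by simp)).clm_apply
        contDiffAt_const : ContDiffAt ℝ ∞ _ z)).continuousAt
    exact (((d _ _).sub (d _ _)).add ((c 1).clm_comp (c Complex.I))).sub
      ((c Complex.I).clm_comp (c 1))
  -- Here a = ∇_x u_x = -∇_y u_y by harmonicity and b = ∇_y u_x = ∇_x u_y by symmetry. So ∇_x a +
  -- ∇_y b is, up to sign, the commutator of covariant derivatives applied to u_y, which is
  -- curvature.
  have hsum : ∀ ζ ∈ N, covDeriv Γ X 1 a ζ + covDeriv Γ X Complex.I b ζ = -R ζ (q ζ) := by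
    intro ζ h
    have h1 := covDeriv_covDeriv_sub (v := 1) (w := Complex.I) (α := q)
      (fun v => (hP v ζ h).differentiableAt (by simp)) ((hqs ζ h).of_le h2le)
    have e1 : covDeriv Γ X 1 (covDeriv Γ X Complex.I q) ζ = -covDeriv Γ X 1 a ζ := by
      have hev : covDeriv Γ X Complex.I q =ᶠ[𝓝 ζ] fun ζ => -a ζ := by
        filter_upwards [hN.mem_nhds h] with ξ hξ using haq ξ hξ
      rw [covDeriv, hev.fderiv_eq, hev.self_of_nhds, fderiv_fun_neg, covDeriv]
      simp
      abel
    have e2 : covDeriv Γ X Complex.I (covDeriv Γ X 1 q) ζ = covDeriv Γ X Complex.I b ζ := by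
      have hev : covDeriv Γ X 1 q =ᶠ[𝓝 ζ] b := by
        filter_upwards [hN.mem_nhds h] with ξ hξ using hbq ξ hξ
      rw [covDeriv, hev.fderiv_eq, hev.self_of_nhds, covDeriv]
    rw [e1, e2] at h1
    rw [hR, ← h1]
    abel
  have hbR : ∀ᶠ ζ in 𝓝 z, ‖R ζ‖ < ‖R z‖ + 1 :=
    hRc.norm.eventually (gt_mem_nhds (lt_add_one _))
  have hGXc : ContinuousAt (fun ζ => Gf (X ζ)) z := (hGX z hz).continuousAt
  have hGXn : ContinuousAt (fun ζ => ‖Gf (X ζ)‖) z :=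
    (continuous_norm (E := E →L[ℝ] E →L[ℝ] ℝ)).continuousAt.comp hGXc
  have hbG : ∀ᶠ ζ in 𝓝 z, ‖Gf (X ζ)‖ < ‖Gf (X z)‖ + 1 :=
    hGXn.eventually (gt_mem_nhds (lt_add_one _))
  refine ⟨2 * (‖Gf (X z)‖ + 1) * (‖R z‖ + 1) / m, ?_⟩
  filter_upwards [hbR, hbG, hN.mem_nhds hz] with ζ h1 h2 h hez
  refine ⟨hes ζ h, ?_⟩
  have hnn : ∀ v, 0 ≤ Gf (X ζ) v v := fun v => le_trans (by positivity) (hpos _ (hXT h) v)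
  have hepos : 0 < e ζ := lt_of_le_of_ne (he ζ h ▸ hnn _) (Ne.symm hez)
  rw [laplacian_real_comp (Real.contDiffAt_log.2 hez) (hes ζ h)]
  have hdl : deriv (deriv Real.log) (e ζ) = -(e ζ ^ 2)⁻¹ := by
    rw [Real.deriv_log']; simp
  rw [hdl, Real.deriv_log]
  have hLap : Δ e ζ = 2 * (Gf (X ζ) (a ζ) (a ζ) + Gf (X ζ) (b ζ) (b ζ)) -
      2 * Gf (X ζ) (R ζ (q ζ)) (p ζ) := by
    rw [laplacian_eq_fderiv_fderiv, hdde _ ζ h, hdde _ ζ h]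
    have := congrArg (fun w => Gf (X ζ) w (p ζ)) (hsum ζ h)
    simp only [map_add, map_neg, _root_.add_apply, _root_.neg_apply] at this
    linarith
  have hgrad : fderiv ℝ e ζ 1 ^ 2 + fderiv ℝ e ζ Complex.I ^ 2 ≤
      2 * (Gf (X ζ) (a ζ) (a ζ) + Gf (X ζ) (b ζ) (b ζ)) * e ζ := by
    -- Both derivatives of e can be written with a alone or with b alone, using u_x or u_y. Bessel
    -- therefore gives |∇e|² ≤ 4|a|²e and |∇e|² ≤ 4|b|²e; their mean is exactly what the term 2(|a|²
    -- + |b|²) of Δe absorbs in Δ log e.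
    have b1 := sq_add_sq_le_of_conformal (Gf (X ζ)) (hGs _) hnn (hconf ζ h) (horth ζ h) (a ζ)
    have b2 := sq_add_sq_le_of_conformal (Gf (X ζ)) (hGs _) hnn (hconf ζ h) (horth ζ h) (b ζ)
    rw [← he ζ h] at b1 b2
    have c1 : fderiv ℝ e ζ 1 = 2 * Gf (X ζ) (a ζ) (p ζ) := hde 1 ζ h
    have c2 : fderiv ℝ e ζ Complex.I = 2 * Gf (X ζ) (b ζ) (p ζ) := hde Complex.I ζ h
    have c3 : fderiv ℝ e ζ 1 = 2 * Gf (X ζ) (b ζ) (q ζ) := by rw [hde' 1 ζ h, hbq ζ h]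
    have c4 : fderiv ℝ e ζ Complex.I = -(2 * Gf (X ζ) (a ζ) (q ζ)) := by
      rw [hde' Complex.I ζ h, haq ζ h]; simp
    have d1 : Gf (X ζ) (a ζ) (p ζ) ^ 2 = fderiv ℝ e ζ 1 ^ 2 / 4 := by rw [c1]; ring
    have d2 : Gf (X ζ) (b ζ) (p ζ) ^ 2 = fderiv ℝ e ζ Complex.I ^ 2 / 4 := by rw [c2]; ring
    have d3 : Gf (X ζ) (b ζ) (q ζ) ^ 2 = fderiv ℝ e ζ 1 ^ 2 / 4 := by rw [c3]; ring
    have d4 : Gf (X ζ) (a ζ) (q ζ) ^ 2 = fderiv ℝ e ζ Complex.I ^ 2 / 4 := by rw [c4]; ring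
    change Gf (X ζ) (a ζ) (p ζ) ^ 2 + Gf (X ζ) (a ζ) (q ζ) ^ 2 ≤ _ at b1
    change Gf (X ζ) (b ζ) (p ζ) ^ 2 + Gf (X ζ) (b ζ) (q ζ) ^ 2 ≤ _ at b2
    rw [d1, d4] at b1
    rw [d2, d3] at b2
    linarith
  have hcurv : Gf (X ζ) (R ζ (q ζ)) (p ζ) ≤ (‖Gf (X z)‖ + 1) * (‖R z‖ + 1) / m * e ζ := by
    have hp2 : m * ‖p ζ‖ ^ 2 ≤ e ζ := he ζ h ▸ hpos _ (hXT h) _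
    have hq2 : m * ‖q ζ‖ ^ 2 ≤ e ζ := by rw [he ζ h, hconf ζ h]; exact hpos _ (hXT h) _
    have hpq : ‖q ζ‖ * ‖p ζ‖ ≤ e ζ / m := by
      rw [le_div_iff₀ hm]
      nlinarith [sq_nonneg (‖q ζ‖ - ‖p ζ‖)]
    calc Gf (X ζ) (R ζ (q ζ)) (p ζ) ≤ ‖Gf (X ζ) (R ζ (q ζ)) (p ζ)‖ := Real.le_norm_self _
      _ ≤ ‖Gf (X ζ)‖ * ‖R ζ (q ζ)‖ * ‖p ζ‖ := ContinuousLinearMap.le_opNorm₂ _ _ _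
      _ ≤ (‖Gf (X z)‖ + 1) * ((‖R z‖ + 1) * ‖q ζ‖) * ‖p ζ‖ := by
          gcongr
          exact ((R ζ).le_opNorm _).trans (by gcongr)
      _ = (‖Gf (X z)‖ + 1) * (‖R z‖ + 1) * (‖q ζ‖ * ‖p ζ‖) := by ring
      _ ≤ (‖Gf (X z)‖ + 1) * (‖R z‖ + 1) * (e ζ / m) := by gcongr
      _ = _ := by ring
  rw [hLap]
  set S := Gf (X ζ) (a ζ) (a ζ) + Gf (X ζ) (b ζ) (b ζ)
  have k1 : (e ζ ^ 2)⁻¹ * (fderiv ℝ e ζ 1 ^ 2 + fderiv ℝ e ζ Complex.I ^ 2) ≤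
      (e ζ ^ 2)⁻¹ * (2 * S * e ζ) := by gcongr
  have k2 : (e ζ ^ 2)⁻¹ * (2 * S * e ζ) = (e ζ)⁻¹ * (2 * S) := by field_simp
  have k3 : (e ζ)⁻¹ * Gf (X ζ) (R ζ (q ζ)) (p ζ) ≤
      (e ζ)⁻¹ * ((‖Gf (X z)‖ + 1) * (‖R z‖ + 1) / m * e ζ) := by gcongr
  have k4 : (e ζ)⁻¹ * ((‖Gf (X z)‖ + 1) * (‖R z‖ + 1) / m * e ζ) =
      (‖Gf (X z)‖ + 1) * (‖R z‖ + 1) / m := by field_simp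
  have k5 : 2 * (‖Gf (X z)‖ + 1) * (‖R z‖ + 1) / m =
    2 * ((‖Gf (X z)‖ + 1) * (‖R z‖ + 1) / m) := by ring
  rw [k5]
  linarith

end Bochner

/-! ### Conformal harmonic discs read in charts, and MPSH functions along them. -/

section Discs

variable {n : ℕ} {M : Type*} [TopologicalSpace M] [ChartedSpace (EuclideanSpace ℝ (Fin n)) M]
  [IsManifold (𝓡 n) ∞ M]

local notation "𝔼" => EuclideanSpace ℝ (Fin n)

/-- A positive continuous function on the compact set K × unit sphere has a positive minimum;
homogeneity does the rest. -/
theorem exists_metricForm_lower_bound (g : Metric n M)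
    {e : OpenPartialHomeomorph M (EuclideanSpace ℝ (Fin n))}
    (he : e ∈ IsManifold.maximalAtlas (𝓡 n) ∞ M) {K : Set 𝔼} (hK : IsCompact K)
    (hKe : K ⊆ e.target) :
    ∃ m > 0, ∀ y ∈ K, ∀ a : 𝔼, m * ‖a‖ ^ 2 ≤ metricForm g e y a a := by
  have hcont : ContinuousOn (fun w : 𝔼 × 𝔼 => metricForm g e w.1 w.2 w.2)
      (K ×ˢ sphere (0 : 𝔼) 1) := by
    have h1 : ContinuousOn (fun w : 𝔼 × 𝔼 => metricForm g e w.1) (K ×ˢ sphere (0 : 𝔼) 1) :=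
      ((contDiffOn_metricForm g he).continuousOn.mono hKe).comp continuousOn_fst fun w hw => hw.1
    exact (h1.clm_apply continuousOn_snd).clm_apply continuousOn_snd
  obtain ⟨m, hm, hle⟩ : ∃ m > 0, ∀ w ∈ K ×ˢ sphere (0 : 𝔼) 1, m ≤ metricForm g e w.1 w.2 w.2 := by
    rcases (K ×ˢ sphere (0 : 𝔼) 1).eq_empty_or_nonempty with h | h
    · exact ⟨1, one_pos, by simp [h]⟩
    · obtain ⟨w, hw, hmin⟩ := (hK.prod (isCompact_sphere _ _)).exists_isMinOn h hcont
      refine ⟨_, metricForm_pos g he (hKe hw.1) (a := w.2) ?_, fun w' hw' => hmin hw'⟩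
      intro h0
      have := hw.2
      simp [h0] at this
  refine ⟨m, hm, fun y hy a => ?_⟩
  rcases eq_or_ne a 0 with rfl | ha
  · simp
  · have hn : ‖a‖ ≠ 0 := norm_ne_zero_iff.2 ha
    have h := hle (y, ‖a‖⁻¹ • a) ⟨hy, by simp [norm_smul, hn]⟩
    simp only [map_smul, _root_.smul_apply, smul_eq_mul] at h
    calc m * ‖a‖ ^ 2 ≤ ‖a‖⁻¹ * (‖a‖⁻¹ * metricForm g e y a a) * ‖a‖ ^ 2 := by gcongr
      _ = metricForm g e y a a := by field_simp

/-- The conformal factor `|u_x|²` of a conformal disc. -/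
def conformalFactor (g : Metric n M) (u : ℂ → M) (z : ℂ) : ℝ :=
  g.inner (u z) (discDeriv u z 1) (discDeriv u z 1)

variable {g : Metric n M} {e : OpenPartialHomeomorph M (EuclideanSpace ℝ (Fin n))} {V : Set M}
  {u : ℂ → M} {z : ℂ}

theorem conformalFactor_nonneg (g : Metric n M) (u : ℂ → M) (z : ℂ) :
    0 ≤ conformalFactor g u z := by
  unfold conformalFactor
  by_cases h : discDeriv (n := n) u z 1 = 0
  · rw [h]; simp
  · exact (g.pos _ _ h).le

namespace IsConformalHarmonicDisc

theorem contMDiffAt (hu : IsConformalHarmonicDisc g V u)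
    (hz : z ∈ ball (0 : ℂ) 1) : ContMDiffAt 𝓘(ℝ, ℂ) (𝓡 n) ∞ u z :=
  hu.smooth.contMDiffAt (isOpen_ball.mem_nhds hz)

theorem contDiffAt_chart (hu : IsConformalHarmonicDisc g V u)
    (he : e ∈ IsManifold.maximalAtlas (𝓡 n) ∞ M) (hz : z ∈ ball (0 : ℂ) 1)
    (hzs : u z ∈ e.source) : ContDiffAt ℝ ∞ (fun ζ => e (u ζ)) z :=
  contMDiffAt_iff_contDiffAt.1
    ((contMDiffAt_of_mem_maximalAtlas he hzs).comp z (hu.contMDiffAt hz))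

theorem isOpen_preimage (hu : IsConformalHarmonicDisc g V u) {W : Set M} (hW : IsOpen W) :
    IsOpen (ball (0 : ℂ) 1 ∩ u ⁻¹' W) :=
  hu.smooth.continuousOn.isOpen_inter_preimage isOpen_ball hW

theorem fderiv_chart (hu : IsConformalHarmonicDisc g V u)
    (he : e ∈ IsManifold.maximalAtlas (𝓡 n) ∞ M) (hz : z ∈ ball (0 : ℂ) 1)
    (hzs : u z ∈ e.source) (v : ℂ) :
    fderiv ℝ (fun ζ => e (u ζ)) z v = mfderiv (𝓡 n) (𝓡 n) e (u z) (discDeriv u z v) := by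
  have h1 : MDifferentiableAt 𝓘(ℝ, ℂ) (𝓡 n) u z := (hu.contMDiffAt hz).mdifferentiableAt (by simp)
  have h2 := (mdifferentiable_of_mem_maximalAtlas he).mdifferentiableAt hzs
  have h3 := mfderiv_comp z h2 h1
  rw [← mfderiv_eq_fderiv]
  exact congrArg (fun T : ℂ →L[ℝ] 𝔼 => T v) h3

theorem metricForm_chart (hu : IsConformalHarmonicDisc g V u)
    (he : e ∈ IsManifold.maximalAtlas (𝓡 n) ∞ M) (hz : z ∈ ball (0 : ℂ) 1)
    (hzs : u z ∈ e.source) (v w : ℂ) :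
    metricForm g e (e (u z)) (fderiv ℝ (fun ζ => e (u ζ)) z v) (fderiv ℝ (fun ζ => e (u ζ)) z w) =
      g.inner (u z) (discDeriv u z v) (discDeriv u z w) := by
  rw [hu.fderiv_chart he hz hzs, hu.fderiv_chart he hz hzs]
  exact metricForm_chart_apply g he hzs _ _

theorem conformalFactor_eq_one (hu : IsConformalHarmonicDisc g V u)
    (he : e ∈ IsManifold.maximalAtlas (𝓡 n) ∞ M)
    (hz : z ∈ ball (0 : ℂ) 1) (hzs : u z ∈ e.source) :
    conformalFactor g u z = metricForm g e (e (u z)) (fderiv ℝ (fun ζ => e (u ζ)) z 1)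
      (fderiv ℝ (fun ζ => e (u ζ)) z 1) :=
  (hu.metricForm_chart he hz hzs 1 1).symm

theorem conformalFactor_eq_I (hu : IsConformalHarmonicDisc g V u)
    (he : e ∈ IsManifold.maximalAtlas (𝓡 n) ∞ M)
    (hz : z ∈ ball (0 : ℂ) 1) (hzs : u z ∈ e.source) :
    conformalFactor g u z = metricForm g e (e (u z)) (fderiv ℝ (fun ζ => e (u ζ)) z Complex.I)
      (fderiv ℝ (fun ζ => e (u ζ)) z Complex.I) :=
  (hu.conformal_norm z hz).trans (hu.metricForm_chart he hz hzs Complex.I Complex.I).symm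

theorem metricForm_one_I (hu : IsConformalHarmonicDisc g V u)
    (he : e ∈ IsManifold.maximalAtlas (𝓡 n) ∞ M)
    (hz : z ∈ ball (0 : ℂ) 1) (hzs : u z ∈ e.source) :
    metricForm g e (e (u z)) (fderiv ℝ (fun ζ => e (u ζ)) z 1)
      (fderiv ℝ (fun ζ => e (u ζ)) z Complex.I) = 0 :=
  (hu.metricForm_chart he hz hzs 1 Complex.I).trans (hu.conformal_orthogonal z hz)

theorem laplacian_chart (hu : IsConformalHarmonicDisc g V u)
    (he : e ∈ IsManifold.maximalAtlas (𝓡 n) ∞ M) (hz : z ∈ ball (0 : ℂ) 1)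
    (hzs : u z ∈ e.source) :
    Δ (fun ζ => e (u ζ)) z +
      (christoffelForm g e (e (u z)) (fderiv ℝ (fun ζ => e (u ζ)) z 1)
        (fderiv ℝ (fun ζ => e (u ζ)) z 1) +
      christoffelForm g e (e (u z)) (fderiv ℝ (fun ζ => e (u ζ)) z Complex.I)
        (fderiv ℝ (fun ζ => e (u ζ)) z Complex.I)) = 0 := by
  have hX := hu.contDiffAt_chart he hz hzs
  have hX2 : ContDiffAt ℝ 2 (fun ζ => e (u ζ)) z := hX.of_le (WithTop.coe_le_coe.2 le_top)
  ext i
  have h := hu.harmonic z hz e he hzs i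
  have hL : Δ (fun ζ => e (u ζ) i) z = Δ (fun ζ => e (u ζ)) z i :=
    hX2.laplacian_CLM_comp_left (l := (EuclideanSpace.proj (𝕜 := ℝ) i : 𝔼 →L[ℝ] ℝ))
  have hF : ∀ (j : Fin n) (v : ℂ), fderiv ℝ (fun ζ => e (u ζ) j) z v =
      fderiv ℝ (fun ζ => e (u ζ)) z v j := by
    intro j v
    have h1 := (EuclideanSpace.proj (𝕜 := ℝ) j : 𝔼 →L[ℝ] ℝ).hasFDerivAt.comp z
      (hX.differentiableAt (by simp)).hasFDerivAt
    have h2 : fderiv ℝ (fun ζ => e (u ζ) j) z = _ := h1.fderiv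
    rw [h2]; simp
  rw [hL] at h
  simp only [hF] at h
  rw [PiLp.add_apply, PiLp.add_apply, christoffelForm_apply, christoffelForm_apply]
  rw [PiLp.zero_apply, ← h]
  simp only [mul_add, Finset.sum_add_distrib]

theorem contDiffAt_conformalFactor (hu : IsConformalHarmonicDisc g V u) (hz : z ∈ ball (0 : ℂ) 1) :
    ContDiffAt ℝ ∞ (conformalFactor g u) z := by
  set e := chartAt 𝔼 (u z)
  have he : e ∈ IsManifold.maximalAtlas (𝓡 n) ∞ M := IsManifold.chart_mem_maximalAtlas _
  have hzs : u z ∈ e.source := mem_chart_source _ _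
  have hX := hu.contDiffAt_chart he hz hzs
  have hG := ((contDiffOn_metricForm g he).contDiffAt
    (e.open_target.mem_nhds (e.map_source hzs))).comp z hX
  have hp : ContDiffAt ℝ ∞ (fun ζ => fderiv ℝ (fun ζ => e (u ζ)) ζ 1) z :=
    (hX.fderiv_right (m := ∞) (by simp)).clm_apply contDiffAt_const
  refine ((hG.clm_apply hp).clm_apply hp).congr_of_eventuallyEq ?_
  filter_upwards [(hu.isOpen_preimage e.open_source).mem_nhds ⟨hz, hzs⟩] with ζ hζ
  exact hu.conformalFactor_eq_one he hζ.1 hζ.2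

/-- The Laplacian of the logarithm of the conformal factor is bounded below on compact subsets. -/
theorem laplacian_log_conformalFactor_ge (hu : IsConformalHarmonicDisc g V u) {r : ℝ} (hr : r < 1) :
    ∃ C, ∀ z ∈ closedBall (0 : ℂ) r, conformalFactor g u z ≠ 0 →
      ContDiffAt ℝ 2 (conformalFactor g u) z ∧
        -C ≤ Δ (fun ζ => Real.log (conformalFactor g u ζ)) z := by
  refine (isCompact_closedBall (0 : ℂ) r).induction_on (p := fun s => ∃ C, ∀ z ∈ s,
    conformalFactor g u z ≠ 0 → ContDiffAt ℝ 2 (conformalFactor g u) z ∧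
      -C ≤ Δ (fun ζ => Real.log (conformalFactor g u ζ)) z) ⟨0, by simp⟩ ?_ ?_ ?_
  · rintro s t hst ⟨C, hC⟩
    exact ⟨C, fun z hz => hC z (hst hz)⟩
  · rintro s t ⟨C, hC⟩ ⟨C', hC'⟩
    refine ⟨max C C', fun z hz hne => ?_⟩
    rcases hz with hz | hz
    · exact ⟨(hC z hz hne).1, (neg_le_neg (le_max_left _ _)).trans (hC z hz hne).2⟩
    · exact ⟨(hC' z hz hne).1, (neg_le_neg (le_max_right _ _)).trans (hC' z hz hne).2⟩
  · intro z hz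
    have hz1 : z ∈ ball (0 : ℂ) 1 := closedBall_subset_ball hr hz
    -- The estimate is local: a closed coordinate ball around u z provides the uniform lower bound
    -- of the metric required by Bochner's inequality.
    set e := chartAt 𝔼 (u z)
    have he : e ∈ IsManifold.maximalAtlas (𝓡 n) ∞ M := IsManifold.chart_mem_maximalAtlas _
    have hzs : u z ∈ e.source := mem_chart_source _ _
    obtain ⟨R, hR, hRsub⟩ := Metric.nhds_basis_closedBall.mem_iff.1
      (e.open_target.mem_nhds (e.map_source hzs))
    set T := ball (e (u z)) R with hT
    have hTsub : T ⊆ e.target := ball_subset_closedBall.trans hRsub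
    obtain ⟨m, hm, hmpos⟩ := exists_metricForm_lower_bound g he (isCompact_closedBall (e (u z)) R)
      hRsub
    set N := ball (0 : ℂ) 1 ∩ u ⁻¹' (e.source ∩ e ⁻¹' T) with hNdef
    have hN : IsOpen N := hu.isOpen_preimage (e.isOpen_inter_preimage isOpen_ball)
    obtain ⟨C, hC⟩ := laplacian_log_conformalFactor_bound (Gf := metricForm g e)
      (Γ := christoffelForm g e) (X := fun ζ => e (u ζ)) (N := N) (T := T)
      (e := conformalFactor g u) hN isOpen_ball
      (fun ζ hζ => (hu.contDiffAt_chart he hζ.1 hζ.2.1).contDiffWithinAt) (fun ζ hζ => hζ.2.2)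
      ((contDiffOn_metricForm g he).mono hTsub) ((contDiffOn_christoffelForm g he).mono hTsub)
      (metricForm_symm g) (christoffelForm_symm g)
      (fun y hy => fderiv_metricForm g he (hTsub hy)) hm
      (fun y hy => hmpos y (ball_subset_closedBall hy))
      (fun ζ hζ => hu.laplacian_chart he hζ.1 hζ.2.1)
      (fun ζ hζ => (hu.conformalFactor_eq_one he hζ.1 hζ.2.1).symm.trans
        (hu.conformalFactor_eq_I he hζ.1 hζ.2.1))
      (fun ζ hζ => hu.metricForm_one_I he hζ.1 hζ.2.1)
      (fun ζ hζ => hu.conformalFactor_eq_one he hζ.1 hζ.2.1)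
      (z := z) ⟨hz1, hzs, mem_ball_self hR⟩
    exact ⟨_, mem_nhdsWithin_of_mem_nhds hC, C, fun ζ hζ => hζ⟩

/-- MPSH functions are tested on immersed unit discs, so u is restricted to a round ball without
zeros of the conformal factor and rescaled. The harmonic map equation and the conformality relations
are all homogeneous of degree 2 in r. -/
theorem comp_affine (hu : IsConformalHarmonicDisc g V u) {z₀ : ℂ} {r : ℝ} (hr : 0 < r)
    (hball : ball z₀ r ⊆ ball (0 : ℂ) 1)
    {V' : Set M} (hV' : Set.MapsTo u (ball z₀ r) V')
    (hne : ∀ ζ ∈ ball z₀ r, conformalFactor g u ζ ≠ 0) :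
    IsImmersedConformalHarmonicDisc g V' (fun ζ => u (z₀ + r * ζ)) := by
  have hA : ∀ ζ ∈ ball (0 : ℂ) 1, z₀ + r * ζ ∈ ball z₀ r := by
    intro ζ hζ
    rw [mem_ball_zero_iff] at hζ
    rw [mem_ball_iff_norm, add_sub_cancel_left, norm_mul, Complex.norm_real,
      Real.norm_of_nonneg hr.le]
    nlinarith
  have hAd : ∀ ζ : ℂ, HasFDerivAt (fun ζ : ℂ => z₀ + r * ζ) (r • ContinuousLinearMap.id ℝ ℂ) ζ := by
    intro ζ
    have := ((hasFDerivAt_id (𝕜 := ℝ) ζ).const_smul r).const_add z₀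
    simpa [Complex.real_smul] using this
  have hAs : ContDiff ℝ ∞ (fun ζ : ℂ => z₀ + r * ζ) := by fun_prop
  have hD : ∀ ζ ∈ ball (0 : ℂ) 1, ∀ a : ℂ,
      discDeriv (n := n) (fun ζ => u (z₀ + r * ζ)) ζ a = r • discDeriv u (z₀ + r * ζ) a := by
    intro ζ hζ a
    have h1 : MDifferentiableAt 𝓘(ℝ, ℂ) (𝓡 n) u (z₀ + r * ζ) :=
      (hu.contMDiffAt (hball (hA ζ hζ))).mdifferentiableAt (by simp)
    have h3 := (h1.hasMFDerivAt.comp ζ (hAd ζ).hasMFDerivAt).mfderiv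
    have h4 : discDeriv (n := n) (fun ζ => u (z₀ + r * ζ)) ζ a =
        (mfderiv 𝓘(ℝ, ℂ) (𝓡 n) u (z₀ + r * ζ) : ℂ →L[ℝ] 𝔼) (r • a) :=
      congrArg (fun T : ℂ →L[ℝ] 𝔼 => T a) h3
    exact h4.trans ((mfderiv 𝓘(ℝ, ℂ) (𝓡 n) u (z₀ + r * ζ) : ℂ →L[ℝ] 𝔼).map_smul r a)
  have hin : ∀ ζ ∈ ball (0 : ℂ) 1, ∀ a b : ℂ,
      g.inner (u (z₀ + r * ζ)) (discDeriv (fun ζ => u (z₀ + r * ζ)) ζ a)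
        (discDeriv (fun ζ => u (z₀ + r * ζ)) ζ b) =
      r ^ 2 * g.inner (u (z₀ + r * ζ)) (discDeriv u (z₀ + r * ζ) a) (discDeriv u (z₀ + r * ζ) b) := by
    intro ζ hζ a b
    rw [hD ζ hζ, hD ζ hζ]
    simp only [map_smul, _root_.smul_apply, smul_eq_mul]
    ring
  refine ⟨⟨fun ζ hζ => hV' (hA ζ hζ), ?_, ?_, ?_, ?_⟩, ?_⟩
  · exact hu.smooth.comp hAs.contMDiff.contMDiffOn fun ζ hζ => hball (hA ζ hζ)
  · intro ζ hζ
    rw [hin ζ hζ, hin ζ hζ, hu.conformal_norm _ (hball (hA ζ hζ))]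
  · intro ζ hζ
    rw [hin ζ hζ, hu.conformal_orthogonal _ (hball (hA ζ hζ)), mul_zero]
  · intro ζ hζ e he hes i
    have h := hu.harmonic _ (hball (hA ζ hζ)) e he hes i
    have hX := hu.contDiffAt_chart he (hball (hA ζ hζ)) hes
    have hXi : ∀ i, ContDiffAt ℝ 2 (fun ζ => e (u ζ) i) (z₀ + r * ζ) := fun i =>
      ((EuclideanSpace.proj (𝕜 := ℝ) i : 𝔼 →L[ℝ] ℝ).contDiff.contDiffAt.comp _ hX).of_le
        (WithTop.coe_le_coe.2 le_top)
    have hF : ∀ i (a : ℂ), fderiv ℝ (fun ζ => e (u (z₀ + r * ζ)) i) ζ a =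
        r * fderiv ℝ (fun ζ => e (u ζ) i) (z₀ + r * ζ) a := by
      intro i a
      have h1 := ((hXi i).differentiableAt (by norm_num)).hasFDerivAt.comp ζ (hAd ζ)
      have h2 : fderiv ℝ (fun ζ => e (u (z₀ + r * ζ)) i) ζ = _ := h1.fderiv
      rw [h2]; simp
    have hΔA : Δ (fun ζ : ℂ => z₀ + r * ζ) ζ = 0 := by
      have : (fderiv ℝ fun ζ : ℂ => z₀ + r * ζ) = fun _ => r • ContinuousLinearMap.id ℝ ℂ := by
        ext1 ζ; exact (hAd ζ).fderiv
      rw [laplacian_eq_fderiv_fderiv, this]; simp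
    have hL : Δ (fun ζ => e (u (z₀ + r * ζ)) i) ζ =
        r ^ 2 * Δ (fun ζ => e (u ζ) i) (z₀ + r * ζ) := by
      have := laplacian_comp (φ := fun ζ => e (u ζ) i) (X := fun ζ : ℂ => z₀ + r * ζ) (z := ζ)
        (hXi i) (hAs.contDiffAt.of_le (WithTop.coe_le_coe.2 le_top))
      rw [this, hΔA, (hAd ζ).fderiv, laplacian_eq_fderiv_fderiv]
      simp only [_root_.smul_apply, ContinuousLinearMap.id_apply, map_smul, smul_eq_mul, map_zero]
      ring
    simp only [hF, hL]
    have : ∀ A B C : ℝ, A + B = 0 → C = r ^ 2 * B → r ^ 2 * A + C = 0 := by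
      rintro A B C h rfl; rw [← mul_add, h, mul_zero]
    refine this _ _ _ h ?_
    rw [Finset.mul_sum]
    refine Finset.sum_congr rfl fun j _ => ?_
    rw [Finset.mul_sum]
    exact Finset.sum_congr rfl fun k _ => by ring
  · intro ζ hζ
    have hζ' := hball (hA ζ hζ)
    suffices H : ∀ a : ℂ, discDeriv (n := n) (fun ζ => u (z₀ + r * ζ)) ζ a = 0 → a = 0 from
      (injective_iff_map_eq_zero _).2 H
    intro a h0
    rw [hD ζ hζ] at h0
    have h1 : discDeriv (n := n) u (z₀ + r * ζ) a = 0 := (smul_eq_zero.1 h0).resolve_left hr.ne'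
    have h2 : discDeriv (n := n) u (z₀ + r * ζ) a = a.re • discDeriv u (z₀ + r * ζ) 1 +
        a.im • discDeriv u (z₀ + r * ζ) Complex.I := by
      have ha : a = a.re • (1 : ℂ) + a.im • Complex.I := by simp [Complex.re_add_im]
      have hlin : ∀ T : ℂ →L[ℝ] 𝔼, T a = a.re • T 1 + a.im • T Complex.I := by
        intro T
        conv_lhs => rw [ha]
        simp only [map_add, map_smul]
      exact hlin (mfderiv 𝓘(ℝ, ℂ) (𝓡 n) u (z₀ + r * ζ))
    -- By conformality the squared length of du(a) is |a|² times the conformal factor, so du is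
    -- injective.
    have h3 := congrArg (fun w => g.inner (u (z₀ + r * ζ)) w w) (h2.symm.trans h1)
    simp only [map_add, map_smul, _root_.add_apply, _root_.smul_apply, smul_eq_mul, map_zero,
      g.symm _ (discDeriv u (z₀ + r * ζ) Complex.I) (discDeriv u (z₀ + r * ζ) 1),
      hu.conformal_orthogonal _ hζ', ← hu.conformal_norm _ hζ'] at h3
    have h4 : (a.re ^ 2 + a.im ^ 2) * conformalFactor g u (z₀ + r * ζ) = 0 := by
      unfold conformalFactor
      linarith
    have h5 := (mul_eq_zero.1 h4).resolve_right (hne _ (hA ζ hζ))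
    have h6 : a.re = 0 := by nlinarith [sq_nonneg a.re, sq_nonneg a.im]
    have h7 : a.im = 0 := by nlinarith [sq_nonneg a.re, sq_nonneg a.im]
    exact Complex.ext h6 h7

/-- The sub-mean value inequality, for small circles, for an MPSH function along a conformal
harmonic disc at a point where the disc is immersed. -/
theorem eventually_le_circleAverage (hu : IsConformalHarmonicDisc g V u)
    {ρ : M → EReal} {V' : Set M} (hρ : IsMPSHOn g ρ V')
    (hV' : IsOpen V') (hz : z ∈ ball (0 : ℂ) 1) (huz : u z ∈ V') (hne : conformalFactor g u z ≠ 0) :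
    ∀ᶠ r in 𝓝[>] (0 : ℝ), ∀ φ : ℂ → ℝ, ContinuousOn φ (sphere z r) →
      (∀ ζ ∈ sphere z r, ρ (u ζ) ≤ (φ ζ : EReal)) →
        ρ (u z) ≤ ((Real.circleAverage φ z r : ℝ) : EReal) := by
  have h1 : ∀ᶠ ζ in 𝓝 z, ζ ∈ ball (0 : ℂ) 1 ∩ u ⁻¹' V' :=
    (hu.isOpen_preimage hV').mem_nhds ⟨hz, huz⟩
  have h2 : ∀ᶠ ζ in 𝓝 z, conformalFactor g u ζ ≠ 0 :=
    (hu.contDiffAt_conformalFactor hz).continuousAt.eventually_ne hne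
  obtain ⟨R, hR, hball⟩ := Metric.eventually_nhds_iff_ball.1 (h1.and h2)
  have hd := hu.comp_affine (V' := V') hR (fun ζ hζ => (hball ζ hζ).1.1)
    (fun ζ hζ => (hball ζ hζ).1.2) (fun ζ hζ => (hball ζ hζ).2)
  filter_upwards [Ioo_mem_nhdsGT hR] with r hr φ hφ hle
  have hmem : ∀ ζ ∈ sphere (0 : ℂ) (r / R), z + R * ζ ∈ sphere z r := by
    intro ζ hζ
    rw [mem_sphere_zero_iff_norm] at hζ
    rw [mem_sphere_iff_norm, add_sub_cancel_left, norm_mul, hζ, Complex.norm_real,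
      Real.norm_of_nonneg hR.le]
    field_simp
  have h := (hρ.subharmonic _ hd).le_mean 0 (r / R) (div_pos hr.1 hR)
    (closedBall_subset_ball ((div_lt_one hR).2 hr.2)) (fun ζ => φ (z + R * ζ))
    (hφ.comp (by fun_prop) hmem) (fun ζ hζ => hle _ (hmem ζ hζ))
  have hav : Real.circleAverage (fun ζ => φ (z + R * ζ)) 0 (r / R) = Real.circleAverage φ z r := by
    simp only [Real.circleAverage_def, circleMap]
    congr 1
    refine intervalIntegral.integral_congr fun θ _ => ?_
    have : (R : ℂ) ≠ 0 := by exact_mod_cast hR.ne'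
    congr 2
    push_cast
    field_simp
    ring
  rw [hav] at h
  simpa using h

end IsConformalHarmonicDisc

end Discs

/-! ### Strict minimal plurisubharmonicity of |x|² in quantitative form. -/

section Strict

variable {n : ℕ} {M : Type*} [TopologicalSpace M] [ChartedSpace (EuclideanSpace ℝ (Fin n)) M]
  [IsManifold (𝓡 n) ∞ M]

local notation "𝔼" => EuclideanSpace ℝ (Fin n)

variable {g : Metric n M} {x : OpenPartialHomeomorph M (EuclideanSpace ℝ (Fin n))}

theorem norm_inner_laplacian_le {Γ : 𝔼 →L[ℝ] 𝔼 →L[ℝ] 𝔼} {Y L p q : 𝔼}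
    (h : L + (Γ p p + Γ q q) = 0) : |inner ℝ Y L| ≤ ‖Y‖ * ‖Γ‖ * (‖p‖ ^ 2 + ‖q‖ ^ 2) := by
  have hL : L = -(Γ p p + Γ q q) := eq_neg_of_add_eq_zero_left h
  have h1 : ‖L‖ ≤ ‖Γ‖ * (‖p‖ ^ 2 + ‖q‖ ^ 2) := by
    rw [hL, norm_neg]
    refine (norm_add_le _ _).trans ?_
    have a1 := Γ.le_opNorm₂ p p
    have a2 := Γ.le_opNorm₂ q q
    nlinarith
  calc |inner ℝ Y L| ≤ ‖Y‖ * ‖L‖ := abs_real_inner_le_norm _ _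
    _ ≤ ‖Y‖ * (‖Γ‖ * (‖p‖ ^ 2 + ‖q‖ ^ 2)) := by gcongr
    _ = _ := by ring

/-- Near q₀ the function |x|² - c|y|² is MPSH, so Δ|X|² ≥ c Δ|Y|² along immersed points, where X =
x∘u and Y = y∘u. Because y vanishes at q₀, the Christoffel term in Δ|Y|² = 2|dY|² + 2⟨Y, ΔY⟩ is at
most |dY|² close to q₀. The change of coordinates, with derivative bounded by K, turns |dY|² into
|dX|². -/
theorem exists_laplacian_norm_sq_ge (hx : x ∈ IsManifold.maximalAtlas (𝓡 n) ∞ M)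
    (hU : IsStrictlyMPSHOn g (fun q => ‖x q‖ ^ 2) x.source) {q₀ : M} (hq₀ : q₀ ∈ x.source) :
    ∃ c > 0, ∀ᶠ q in 𝓝 q₀, ∀ (V : Set M) (u : ℂ → M), IsConformalHarmonicDisc g V u →
      ∀ z ∈ ball (0 : ℂ) 1, u z = q →
        c * (‖fderiv ℝ (fun ζ => x (u ζ)) z 1‖ ^ 2 +
          ‖fderiv ℝ (fun ζ => x (u ζ)) z Complex.I‖ ^ 2) ≤ Δ (fun ζ => ‖x (u ζ)‖ ^ 2) z := by
  obtain ⟨y, R, hy, c, hc, W, hW, hq₀W, hWsub, hmpsh⟩ := hU.strict q₀ hq₀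
  have hya := hy.mem_atlas
  have hyq : q₀ ∈ y.source := hy.mem_source
  have hycont : ContinuousAt y q₀ := y.continuousAt hyq
  have hΓc : ContinuousAt (fun q => christoffelForm g y (y q)) q₀ :=
    (((contDiffOn_christoffelForm g hya).contDiffAt
      (y.open_target.mem_nhds (y.map_source hyq))).continuousAt).comp hycont
  have hΓn : ContinuousAt (fun q => ‖christoffelForm g y (y q)‖) q₀ :=
    (continuous_norm (E := 𝔼 →L[ℝ] 𝔼 →L[ℝ] 𝔼)).continuousAt.comp hΓc
  have hsmall : ∀ᶠ q in 𝓝 q₀, ‖y q‖ * ‖christoffelForm g y (y q)‖ < 1 / 2 := by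
    have : ContinuousAt (fun q => ‖y q‖ * ‖christoffelForm g y (y q)‖) q₀ := hycont.norm.mul hΓn
    refine this.eventually (gt_mem_nhds ?_)
    simp [hy.map_center]
  set τ : 𝔼 → 𝔼 := fun w => x (y.symm w) with hτ
  have hτs : ∀ w ∈ y.target, y.symm w ∈ x.source → ContDiffAt ℝ ∞ τ w := fun w hw hwx =>
    contMDiffAt_iff_contDiffAt.1 ((contMDiffAt_of_mem_maximalAtlas hx hwx).comp w
      (contMDiffAt_symm_of_mem_maximalAtlas hya hw))
  have hτq : ContDiffAt ℝ ∞ τ (y q₀) := hτs _ (y.map_source hyq) (by rwa [y.left_inv hyq])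
  set K := ‖fderiv ℝ τ (y q₀)‖ + 1 with hK
  have hKpos : 0 < K := by positivity
  have hτc : ContinuousAt (fun q => fderiv ℝ τ (y q)) q₀ :=
    ((hτq.fderiv_right (m := ∞) (by simp)).continuousAt).comp hycont
  have hτb : ∀ᶠ q in 𝓝 q₀, ‖fderiv ℝ τ (y q)‖ < K :=
    hτc.norm.eventually (gt_mem_nhds (lt_add_one _))
  refine ⟨c / K ^ 2, by positivity, ?_⟩
  filter_upwards [hsmall, hτb, hW.mem_nhds hq₀W] with q h1 h2 hqW V u hu z hz huz
  subst huz
  have hzx : u z ∈ x.source := (hWsub hqW).1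
  have hzy : u z ∈ y.source := (hWsub hqW).2
  have le2 : (2 : WithTop ℕ∞) ≤ ∞ := WithTop.coe_le_coe.2 le_top
  have hX := hu.contDiffAt_chart hx hz hzx
  have hY := hu.contDiffAt_chart hya hz hzy
  have hX2 := hX.of_le le2
  have hY2 := hY.of_le le2
  have hXl := hu.laplacian_chart hx hz hzx
  have hYl := hu.laplacian_chart hya hz hzy
  set X := fun ζ => x (u ζ) with hXdef
  set Y := fun ζ => y (u ζ) with hYdef
  -- At a zero of the differential the MPSH hypothesis gives no information, but both sides vanish.
  by_cases hne : conformalFactor g u z = 0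
  · have hz0 : ∀ v : 𝔼, metricForm g x (x (u z)) v v = 0 → v = 0 := by
      intro v hv
      by_contra hv0
      exact (metricForm_pos g hx (x.map_source hzx) hv0).ne' hv
    have p0 := hz0 _ ((hu.conformalFactor_eq_one hx hz hzx).symm.trans hne)
    have q0 := hz0 _ ((hu.conformalFactor_eq_I hx hz hzx).symm.trans hne)
    rw [laplacian_norm_sq_comp hX2]
    rw [p0, q0] at hXl ⊢
    simp at hXl
    rw [hXl]
    simp
  · have hfs : ContDiffAt ℝ 2 (fun ζ => ‖Y ζ‖ ^ 2) z := hY2.norm_sq ℝ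
    have hfs' : ContDiffAt ℝ 2 (fun ζ => ‖X ζ‖ ^ 2) z := hX2.norm_sq ℝ
    have hsm : SubMeanAt ((fun ζ => ‖X ζ‖ ^ 2) - c • fun ζ => ‖Y ζ‖ ^ 2) z := by
      filter_upwards [hu.eventually_le_circleAverage hmpsh hW hz hqW hne] with r hr φ hφ hle
      exact EReal.coe_le_coe_iff.1 (hr φ hφ fun ζ hζ => EReal.coe_le_coe_iff.2 (hle ζ hζ))
    have hcs : ContDiffAt ℝ 2 (c • fun ζ => ‖Y ζ‖ ^ 2) z := hfs.const_smul c
    have hnn : 0 ≤ Δ ((fun ζ => ‖X ζ‖ ^ 2) - c • fun ζ => ‖Y ζ‖ ^ 2) z :=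
      hsm.laplacian_nonneg (hfs'.sub hcs)
    rw [hfs'.laplacian_sub hcs, laplacian_smul c hfs, smul_eq_mul] at hnn
    have hYge : ‖fderiv ℝ Y z 1‖ ^ 2 + ‖fderiv ℝ Y z Complex.I‖ ^ 2 ≤ Δ (fun ζ => ‖Y ζ‖ ^ 2) z := by
      rw [laplacian_norm_sq_comp hY2]
      have h3 := norm_inner_laplacian_le (Y := Y z) hYl
      have h4 := (abs_le.1 h3).1
      have h5 : ‖Y z‖ * ‖christoffelForm g y (y (u z))‖ *
          (‖fderiv ℝ Y z 1‖ ^ 2 + ‖fderiv ℝ Y z Complex.I‖ ^ 2) ≤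
          1 / 2 * (‖fderiv ℝ Y z 1‖ ^ 2 + ‖fderiv ℝ Y z Complex.I‖ ^ 2) := by gcongr
      linarith
    have hXY : ∀ v, ‖fderiv ℝ X z v‖ ^ 2 ≤ K ^ 2 * ‖fderiv ℝ Y z v‖ ^ 2 := by
      intro v
      have hev : X =ᶠ[𝓝 z] fun ζ => τ (Y ζ) := by
        filter_upwards [(hu.isOpen_preimage y.open_source).mem_nhds ⟨hz, hzy⟩] with ζ hζ
        simp only [hτ, hXdef, hYdef]
        rw [y.left_inv hζ.2]
      have hτz : DifferentiableAt ℝ τ (Y z) :=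
        (hτs _ (y.map_source hzy) (by rwa [y.left_inv hzy])).differentiableAt (by simp)
      have hd := (hτz.hasFDerivAt.comp z
        (hY.differentiableAt (by simp)).hasFDerivAt).congr_of_eventuallyEq hev
      rw [hd.fderiv, ← mul_pow]
      gcongr
      exact ((fderiv ℝ τ (Y z)).le_opNorm _).trans
        (mul_le_mul_of_nonneg_right h2.le (norm_nonneg _))
    have h6 : c / K ^ 2 * (‖fderiv ℝ X z 1‖ ^ 2 + ‖fderiv ℝ X z Complex.I‖ ^ 2) ≤
        c / K ^ 2 * (K ^ 2 * (‖fderiv ℝ Y z 1‖ ^ 2 + ‖fderiv ℝ Y z Complex.I‖ ^ 2)) := by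
      gcongr
      linarith [hXY 1, hXY Complex.I]
    have h7 : c / K ^ 2 * (K ^ 2 * (‖fderiv ℝ Y z 1‖ ^ 2 + ‖fderiv ℝ Y z Complex.I‖ ^ 2)) =
        c * (‖fderiv ℝ Y z 1‖ ^ 2 + ‖fderiv ℝ Y z Complex.I‖ ^ 2) := by field_simp
    have h8 := mul_le_mul_of_nonneg_left hYge hc.le
    linarith

theorem exists_laplacian_norm_sq_ge_of_compact (hx : x ∈ IsManifold.maximalAtlas (𝓡 n) ∞ M)
    (hU : IsStrictlyMPSHOn g (fun q => ‖x q‖ ^ 2) x.source) {K : Set M} (hK : IsCompact K)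
    (hKx : K ⊆ x.source) :
    ∃ c > 0, ∀ (V : Set M) (u : ℂ → M), IsConformalHarmonicDisc g V u →
      ∀ z ∈ ball (0 : ℂ) 1, u z ∈ K →
        c * (‖fderiv ℝ (fun ζ => x (u ζ)) z 1‖ ^ 2 +
          ‖fderiv ℝ (fun ζ => x (u ζ)) z Complex.I‖ ^ 2) ≤ Δ (fun ζ => ‖x (u ζ)‖ ^ 2) z := by
  refine hK.induction_on (p := fun S => ∃ c > 0, ∀ (V : Set M) (u : ℂ → M),
    IsConformalHarmonicDisc g V u → ∀ z ∈ ball (0 : ℂ) 1, u z ∈ S →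
      c * (‖fderiv ℝ (fun ζ => x (u ζ)) z 1‖ ^ 2 +
        ‖fderiv ℝ (fun ζ => x (u ζ)) z Complex.I‖ ^ 2) ≤ Δ (fun ζ => ‖x (u ζ)‖ ^ 2) z)
    ⟨1, one_pos, by simp⟩ ?_ ?_ ?_
  · rintro S T hST ⟨c, hc, h⟩
    exact ⟨c, hc, fun V u hu z hz huz => h V u hu z hz (hST huz)⟩
  · rintro S T ⟨c, hc, h⟩ ⟨c', hc', h'⟩
    refine ⟨min c c', lt_min hc hc', fun V u hu z hz huz => ?_⟩
    rcases huz with huz | huz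
    · refine le_trans ?_ (h V u hu z hz huz)
      gcongr
      exact min_le_left _ _
    · refine le_trans ?_ (h' V u hu z hz huz)
      gcongr
      exact min_le_right _ _
  · intro q hq
    obtain ⟨c, hc, h⟩ := exists_laplacian_norm_sq_ge hx hU (hKx hq)
    exact ⟨_, mem_nhdsWithin_of_mem_nhds h, c, hc, fun V u hu z hz huz => huz V u hu z hz rfl⟩

end Strict

/-! ### Comparison of the metric with its value frozen at a point. -/

section PoleAlgebra

variable {E : Type*} [NormedAddCommGroup E] [NormedSpace ℝ E]

set_option maxHeartbeats 800000 in
/-- The bounds for the Laplacian and the gradient of the squared distance `s = B(Y, Y)` in the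
frozen metric `B`, along a conformal harmonic disc for the metric `A` close to `B`. -/
theorem exists_frozen_distance_bounds {m Λ L Γ₀ : ℝ} (hm : 0 < m) (hΛ : 0 ≤ Λ) (hL : 0 ≤ L)
    (hΓ₀ : 0 ≤ Γ₀) :
    ∃ c, 0 ≤ c ∧ ∀ (A B : E →L[ℝ] E →L[ℝ] ℝ) (Γ : E →L[ℝ] E →L[ℝ] E) (Y p q ΔX : E) (e : ℝ),
      (∀ v w, A v w = A w v) → (∀ v, m * ‖v‖ ^ 2 ≤ A v v) → (∀ v, m * ‖v‖ ^ 2 ≤ B v v) →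
      ‖A‖ ≤ Λ → ‖B‖ ≤ Λ → ‖Γ‖ ≤ Γ₀ → ‖A - B‖ ≤ L * ‖Y‖ → ‖Y‖ ≤ 4 → A p p = e → A q q = e →
      A p q = 0 → ΔX + (Γ p p + Γ q q) = 0 →
      4 * e * (1 - c * √(B Y Y)) ≤ 2 * (B p p + B q q) + 2 * B Y ΔX ∧
        (2 * B Y p) ^ 2 + (2 * B Y q) ^ 2 ≤ 4 * B Y Y * e * (1 + c * √(B Y Y)) := by
  obtain ⟨k, hk0, hk2⟩ : ∃ k : ℝ, 0 ≤ k ∧ k ^ 2 = 1 / m :=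
    ⟨√(1 / m), Real.sqrt_nonneg _, Real.sq_sqrt (by positivity)⟩
  obtain ⟨N, hN⟩ : ∃ N, N = L + 4 * Λ * L * k ^ 2 + 8 * L ^ 2 * k ^ 2 := ⟨_, rfl⟩
  have hN0 : 0 ≤ N := by rw [hN]; positivity
  -- The first summand absorbs the error in the Laplacian of s, the second the error in its
  -- gradient; k = 1/√m converts Euclidean norms into metric ones.
  obtain ⟨c, hc⟩ : ∃ c, c = (L + Λ * Γ₀) * k ^ 3 + N * k ^ 3 := ⟨_, rfl⟩
  refine ⟨c, by rw [hc]; positivity, ?_⟩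
  intro A B Γ Y p q ΔX e hAs hA hB hAn hBn hΓ hAB hY4 hAp hAq hpq hharm
  have hs0 : 0 ≤ B Y Y := le_trans (by positivity) (hB Y)
  set r := √(B Y Y) with hr
  have hr0 : 0 ≤ r := Real.sqrt_nonneg _
  have hr2 : r ^ 2 = B Y Y := Real.sq_sqrt hs0
  have he0 : 0 ≤ e := hAp ▸ le_trans (by positivity) (hA p)
  have hsqm : ∀ (v : E) (t : ℝ), m * ‖v‖ ^ 2 ≤ t → ‖v‖ ^ 2 ≤ k ^ 2 * t := by
    intro v t h
    rw [hk2, one_div, inv_mul_eq_div, le_div_iff₀ hm]; linarith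
  have hp2 : ‖p‖ ^ 2 ≤ k ^ 2 * e := hsqm p e (hAp ▸ hA p)
  have hq2 : ‖q‖ ^ 2 ≤ k ^ 2 * e := hsqm q e (hAq ▸ hA q)
  have hYr : ‖Y‖ ≤ k * r := by
    have := hsqm Y (B Y Y) (hB Y)
    rw [← hr2, ← mul_pow] at this
    exact le_of_sq_le_sq this (by positivity)
  have hY0 := norm_nonneg Y
  have hdiff : ∀ v w : E, |A v w - B v w| ≤ L * ‖Y‖ * ‖v‖ * ‖w‖ := by
    intro v w
    have h1 := (A - B).le_opNorm₂ v w
    rw [Real.norm_eq_abs] at h1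
    refine le_trans h1 ?_
    gcongr
  have hY3 : ‖Y‖ ^ 3 ≤ k ^ 3 * (r * B Y Y) := by
    calc ‖Y‖ ^ 3 ≤ (k * r) ^ 3 := by gcongr
      _ = k ^ 3 * (r * r ^ 2) := by ring
      _ = _ := by rw [hr2]
  constructor
  · have b1 : e - L * k ^ 3 * r * e ≤ B p p := by
      have h1 := (abs_le.1 (hdiff p p)).2
      have h2 : L * ‖Y‖ * ‖p‖ * ‖p‖ ≤ L * k ^ 3 * r * e := by
        calc L * ‖Y‖ * ‖p‖ * ‖p‖ = L * ‖Y‖ * ‖p‖ ^ 2 := by ring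
          _ ≤ L * (k * r) * (k ^ 2 * e) := by gcongr
          _ = _ := by ring
      linarith
    have b2 : e - L * k ^ 3 * r * e ≤ B q q := by
      have h1 := (abs_le.1 (hdiff q q)).2
      have h2 : L * ‖Y‖ * ‖q‖ * ‖q‖ ≤ L * k ^ 3 * r * e := by
        calc L * ‖Y‖ * ‖q‖ * ‖q‖ = L * ‖Y‖ * ‖q‖ ^ 2 := by ring
          _ ≤ L * (k * r) * (k ^ 2 * e) := by gcongr
          _ = _ := by ring
      linarith
    have b3 : -(2 * (Λ * Γ₀ * k ^ 3 * r * e)) ≤ B Y ΔX := by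
      have hΔ : ‖ΔX‖ ≤ Γ₀ * (2 * (k ^ 2 * e)) := by
        have a1 := Γ.le_opNorm₂ p p
        have a2 := Γ.le_opNorm₂ q q
        rw [eq_neg_of_add_eq_zero_left hharm, norm_neg]
        calc ‖Γ p p + Γ q q‖ ≤ ‖Γ p p‖ + ‖Γ q q‖ := norm_add_le _ _
          _ ≤ ‖Γ‖ * (‖p‖ ^ 2 + ‖q‖ ^ 2) := by nlinarith
          _ ≤ Γ₀ * (‖p‖ ^ 2 + ‖q‖ ^ 2) := by gcongr
          _ ≤ Γ₀ * (2 * (k ^ 2 * e)) := by gcongr; linarith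
      have h1 := B.le_opNorm₂ Y ΔX
      have h2 : ‖B‖ * ‖Y‖ * ‖ΔX‖ ≤ Λ * (k * r) * (Γ₀ * (2 * (k ^ 2 * e))) := by gcongr
      have h3 := (abs_le.1 (h1.trans h2)).1
      linarith
    have b4 : 0 ≤ N * k ^ 3 * (r * e) := by positivity
    have b5 : 4 * e * (1 - c * r) = 4 * e - 4 * ((L + Λ * Γ₀) * k ^ 3 * (r * e)) -
        4 * (N * k ^ 3 * (r * e)) := by rw [hc]; ring
    rw [b5]
    linarith
  · have hb : ∀ v : E, ‖v‖ ^ 2 ≤ k ^ 2 * e →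
        (B Y v) ^ 2 ≤ (A Y v) ^ 2 + (2 * Λ * L + 4 * L ^ 2) * ‖Y‖ ^ 3 * (k ^ 2 * e) := by
      intro v hv
      have h1 : |A Y v| ≤ Λ * ‖Y‖ * ‖v‖ := by
        have := A.le_opNorm₂ Y v
        rw [Real.norm_eq_abs] at this
        exact this.trans (by gcongr)
      have h2 := hdiff Y v
      set d := A Y v - B Y v with hd
      have h3 : B Y v = A Y v - d := by rw [hd]; ring
      have h4 : (B Y v) ^ 2 ≤ (A Y v) ^ 2 + 2 * (|A Y v| * |d|) + |d| ^ 2 := by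
        rw [h3, sq_abs]
        have := neg_abs_le (A Y v * d)
        rw [abs_mul] at this
        nlinarith
      have h5 : |A Y v| * |d| ≤ (Λ * ‖Y‖ * ‖v‖) * (L * ‖Y‖ * ‖Y‖ * ‖v‖) := by gcongr
      have h6 : |d| ^ 2 ≤ (L * ‖Y‖ * ‖Y‖ * ‖v‖) ^ 2 := by gcongr
      have h7 : (L * ‖Y‖ * ‖Y‖ * ‖v‖) ^ 2 ≤ 4 * (L ^ 2 * ‖Y‖ ^ 3 * ‖v‖ ^ 2) := by
        calc (L * ‖Y‖ * ‖Y‖ * ‖v‖) ^ 2 = ‖Y‖ * (L ^ 2 * ‖Y‖ ^ 3 * ‖v‖ ^ 2) := by ring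
          _ ≤ _ := by gcongr
      calc (B Y v) ^ 2 ≤ (A Y v) ^ 2 + 2 * ((Λ * ‖Y‖ * ‖v‖) * (L * ‖Y‖ * ‖Y‖ * ‖v‖)) +
            4 * (L ^ 2 * ‖Y‖ ^ 3 * ‖v‖ ^ 2) := by linarith
        _ = (A Y v) ^ 2 + (2 * Λ * L + 4 * L ^ 2) * ‖Y‖ ^ 3 * ‖v‖ ^ 2 := by ring
        _ ≤ _ := by gcongr
    have hbp := hb p hp2
    have hbq := hb q hq2
    -- The sharp gradient bound holds for A, for which p, q are orthogonal of equal length; passing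
    -- from A to B costs O(‖Y‖³ e), one order √s better than the main term.
    have hbes := sq_add_sq_le_of_conformal A hAs (fun v => le_trans (by positivity) (hA v))
      (hAp.trans hAq.symm) hpq Y
    rw [hAp] at hbes
    have hAY : A Y Y ≤ B Y Y + L * ‖Y‖ ^ 3 := by
      have h1 := (abs_le.1 (hdiff Y Y)).2
      have h2 : L * ‖Y‖ * ‖Y‖ * ‖Y‖ = L * ‖Y‖ ^ 3 := by ring
      linarith
    have h1 : A Y Y * e ≤ (B Y Y + L * ‖Y‖ ^ 3) * e := mul_le_mul_of_nonneg_right hAY he0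
    have h2 : N * ‖Y‖ ^ 3 * e ≤ N * (k ^ 3 * (r * B Y Y)) * e :=
      mul_le_mul_of_nonneg_right (mul_le_mul_of_nonneg_left hY3 hN0) he0
    have h3 : 0 ≤ (L + Λ * Γ₀) * k ^ 3 * (r * B Y Y * e) := by positivity
    have h4 : 4 * B Y Y * e * (1 + c * r) = 4 * (B Y Y * e) +
        4 * ((L + Λ * Γ₀) * k ^ 3 * (r * B Y Y * e)) +
        4 * (N * (k ^ 3 * (r * B Y Y)) * e) := by
      rw [hc]; ring
    rw [h4]
    have h5 : N * ‖Y‖ ^ 3 * e = L * ‖Y‖ ^ 3 * e +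
        2 * ((2 * Λ * L + 4 * L ^ 2) * ‖Y‖ ^ 3 * (k ^ 2 * e)) := by rw [hN]; ring
    have h6 : (B Y Y + L * ‖Y‖ ^ 3) * e = B Y Y * e + L * ‖Y‖ ^ 3 * e := by ring
    have h7 : (2 * B Y p) ^ 2 + (2 * B Y q) ^ 2 = 4 * (B Y p ^ 2 + B Y q ^ 2) := by ring
    rw [h7]
    linarith

end PoleAlgebra

/-! ### Lipschitz bounds on compact convex sets, used to control the freezing error. -/

section Lipschitz

variable {E F : Type*} [NormedAddCommGroup E] [NormedSpace ℝ E] [NormedAddCommGroup F]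
  [NormedSpace ℝ F]

theorem exists_norm_sub_le_of_contDiffOn {f : E → F} {U K : Set E} (hf : ContDiffOn ℝ 1 f U)
    (hU : IsOpen U) (hK : IsCompact K) (hKc : Convex ℝ K) (hKU : K ⊆ U) :
    ∃ L ≥ 0, ∀ y ∈ K, ∀ y' ∈ K, ‖f y' - f y‖ ≤ L * ‖y' - y‖ := by
  obtain ⟨L, hL⟩ := hK.exists_bound_of_continuousOn
    ((hf.continuousOn_fderiv_of_isOpen hU le_rfl).mono hKU)
  refine ⟨max L 0, le_max_right _ _, fun y hy y' hy' => ?_⟩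
  refine hKc.norm_image_sub_le_of_norm_fderiv_le (𝕜 := ℝ)
    (fun w hw => ?_) (fun w hw => (hL w hw).trans (le_max_left _ _)) hy hy'
  exact (hf.contDiffAt (hU.mem_nhds (hKU hw))).differentiableAt (by simp)

end Lipschitz

/-! ### The logarithmic pole along a conformal harmonic disc. -/

section Pole

variable {n : ℕ} {M : Type*} [TopologicalSpace M] [ChartedSpace (EuclideanSpace ℝ (Fin n)) M]
  [IsManifold (𝓡 n) ∞ M]

local notation "𝔼" => EuclideanSpace ℝ (Fin n)

variable {g : Metric n M} {x : OpenPartialHomeomorph M (EuclideanSpace ℝ (Fin n))}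

/-- The squared distance to `y₀` of the chart image of a point, in the frozen metric at `y₀`. -/
def frozenDistSq (g : Metric n M) (x : OpenPartialHomeomorph M (EuclideanSpace ℝ (Fin n)))
    (y₀ : EuclideanSpace ℝ (Fin n)) (q : M) : ℝ :=
  metricForm g x y₀ (x q - y₀) (x q - y₀)

/-- A smooth function of the squared distance with a logarithmic pole has Laplacian bounded below
by a multiple of the conformal factor, along every conformal harmonic disc. -/
theorem exists_laplacian_poleProfile_ge (hx : x ∈ IsManifold.maximalAtlas (𝓡 n) ∞ M) {R : ℝ}
    (hR : R ≤ 2) (hT : closedBall (0 : 𝔼) R ⊆ x.target) :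
    ∃ m > 0, ∃ Λ > 0, ∃ c ≥ 0,
      (∀ y ∈ closedBall (0 : 𝔼) R, ∀ a : 𝔼, m * ‖a‖ ^ 2 ≤ metricForm g x y a a) ∧
      (∀ y ∈ closedBall (0 : 𝔼) R, ∀ a : 𝔼, metricForm g x y a a ≤ Λ * ‖a‖ ^ 2) ∧
      ∀ y₀ ∈ closedBall (0 : 𝔼) R, ∀ δ > 0, c * δ ≤ 1 → ∀ (V : Set M) (u : ℂ → M),
        IsConformalHarmonicDisc g V u → ∀ z ∈ ball (0 : ℂ) 1, u z ∈ x.source →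
        x (u z) ∈ closedBall (0 : 𝔼) R → x (u z) ≠ y₀ →
        ContDiffAt ℝ 2
          (fun ζ => poleProfile (4 * (c * δ)) (frozenDistSq g x y₀ (u ζ) / δ ^ 2)) z ∧
        -(104 * conformalFactor g u z / δ ^ 2) ≤
          Δ (fun ζ => poleProfile (4 * (c * δ)) (frozenDistSq g x y₀ (u ζ) / δ ^ 2)) z := by
  have hK := isCompact_closedBall (0 : 𝔼) R
  have hGs := contDiffOn_metricForm g hx
  obtain ⟨m, hm, hlow⟩ := exists_metricForm_lower_bound g hx hK hT
  obtain ⟨Λ₀, hΛ₀⟩ := hK.exists_bound_of_continuousOn (E := 𝔼 →L[ℝ] 𝔼 →L[ℝ] ℝ)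
    (hGs.continuousOn.mono hT)
  obtain ⟨Γ₁, hΓ₁⟩ := hK.exists_bound_of_continuousOn (E := 𝔼 →L[ℝ] 𝔼 →L[ℝ] 𝔼)
    ((contDiffOn_christoffelForm g hx).continuousOn.mono hT)
  obtain ⟨Λ, hΛ, hΛb⟩ : ∃ Λ > 0, ∀ y ∈ closedBall (0 : 𝔼) R, ‖metricForm g x y‖ ≤ Λ :=
    ⟨max Λ₀ 1, by positivity, fun y hy => (hΛ₀ y hy).trans (le_max_left _ _)⟩
  obtain ⟨L, hL, hLb⟩ := exists_norm_sub_le_of_contDiffOn (hGs.of_le (by simp)) x.open_target hK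
    (convex_closedBall (0 : 𝔼) R) hT
  obtain ⟨Γ₀, hΓ₀, hΓb⟩ : ∃ Γ₀ ≥ 0, ∀ y ∈ closedBall (0 : 𝔼) R, ‖christoffelForm g x y‖ ≤ Γ₀ :=
    ⟨max Γ₁ 0, le_max_right _ _, fun y hy => (hΓ₁ y hy).trans (le_max_left _ _)⟩
  obtain ⟨c, hc, hbd⟩ := exists_frozen_distance_bounds (E := 𝔼) hm hΛ.le hL hΓ₀
  refine ⟨m, hm, Λ, hΛ, c, hc, hlow, fun y hy a => ?_, ?_⟩
  · have h1 := (metricForm g x y).le_opNorm₂ a a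
    rw [Real.norm_eq_abs] at h1
    calc metricForm g x y a a ≤ ‖metricForm g x y‖ * ‖a‖ * ‖a‖ := (le_abs_self _).trans h1
      _ = ‖metricForm g x y‖ * ‖a‖ ^ 2 := by ring
      _ ≤ Λ * ‖a‖ ^ 2 := mul_le_mul_of_nonneg_right (hΛb y hy) (by positivity)
  intro y₀ hy₀ δ hδ hcδ V u hu z hz hzs hzR hne
  have hX2 : ContDiffAt ℝ 2 (fun ζ => x (u ζ)) z :=
    (hu.contDiffAt_chart hx hz hzs).of_le (WithTop.coe_le_coe.2 le_top)
  have hY4 : ‖x (u z) - y₀‖ ≤ 4 := by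
    rw [mem_closedBall_zero_iff] at hzR hy₀
    linarith [norm_sub_le (x (u z)) y₀]
  obtain ⟨h1, h2⟩ := hbd (metricForm g x (x (u z))) (metricForm g x y₀)
    (christoffelForm g x (x (u z))) (x (u z) - y₀) (fderiv ℝ (fun ζ => x (u ζ)) z 1)
    (fderiv ℝ (fun ζ => x (u ζ)) z Complex.I) (Δ (fun ζ => x (u ζ)) z) (conformalFactor g u z)
    (metricForm_symm g _) (hlow _ hzR) (hlow _ hy₀) (hΛb _ hzR) (hΛb _ hy₀) (hΓb _ hzR)
    (hLb _ hy₀ _ hzR) hY4 (hu.conformalFactor_eq_one hx hz hzs).symm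
    (hu.conformalFactor_eq_I hx hz hzs).symm (hu.metricForm_one_I hx hz hzs)
    (hu.laplacian_chart hx hz hzs)
  have hsc : ContDiffAt ℝ 2 (fun ζ => frozenDistSq g x y₀ (u ζ)) z :=
    (contDiff_quadratic (metricForm g x y₀) y₀).contDiffAt.comp z hX2
  have hsΔ : Δ (fun ζ => frozenDistSq g x y₀ (u ζ)) z = _ :=
    laplacian_quadratic_comp (metricForm g x y₀) (metricForm_symm g y₀) y₀ hX2
  have hsd : ∀ v, fderiv ℝ (fun ζ => frozenDistSq g x y₀ (u ζ)) z v = _ :=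
    fderiv_quadratic_comp (metricForm g x y₀) (metricForm_symm g y₀) y₀
      (hX2.differentiableAt (by simp))
  rw [← hsΔ] at h1
  rw [← hsd, ← hsd] at h2
  have hs0 : 0 < frozenDistSq g x y₀ (u z) :=
    metricForm_pos g hx (hT hy₀) (sub_ne_zero.2 hne)
  change 4 * conformalFactor g u z * (1 - c * √(frozenDistSq g x y₀ (u z))) ≤ _ at h1
  change _ ≤ 4 * frozenDistSq g x y₀ (u z) * conformalFactor g u z *
    (1 + c * √(frozenDistSq g x y₀ (u z))) at h2
  have heq : (fun ζ => frozenDistSq g x y₀ (u ζ) / δ ^ 2) =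
      (δ ^ 2)⁻¹ • fun ζ => frozenDistSq g x y₀ (u ζ) := by
    ext ζ; simp [div_eq_inv_mul]
  have htc : ContDiffAt ℝ 2 (fun ζ => frozenDistSq g x y₀ (u ζ) / δ ^ 2) z := by
    rw [heq]; exact hsc.const_smul ((δ ^ 2)⁻¹)
  have htΔ : Δ (fun ζ => frozenDistSq g x y₀ (u ζ) / δ ^ 2) z =
      (δ ^ 2)⁻¹ * Δ (fun ζ => frozenDistSq g x y₀ (u ζ)) z := by
    rw [heq, laplacian_smul _ hsc, smul_eq_mul]
  have htd : ∀ v, fderiv ℝ (fun ζ => frozenDistSq g x y₀ (u ζ) / δ ^ 2) z v =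
      (δ ^ 2)⁻¹ * fderiv ℝ (fun ζ => frozenDistSq g x y₀ (u ζ)) z v := by
    intro v
    rw [heq, fderiv_const_smul (hsc.differentiableAt (by simp))]
    rfl
  have ht0 : 0 < frozenDistSq g x y₀ (u z) / δ ^ 2 := by positivity
  have hθ := contDiffAt_poleProfile (4 * (c * δ)) ht0
  refine ⟨ContDiffAt.comp (g := poleProfile (4 * (c * δ))) z hθ htc, ?_⟩
  rw [laplacian_real_comp hθ htc, deriv_poleProfile _ ht0, deriv_deriv_poleProfile _ ht0, htΔ,
    htd, htd]
  have hsq : δ * √(frozenDistSq g x y₀ (u z) / δ ^ 2) = √(frozenDistSq g x y₀ (u z)) := by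
    rw [Real.sqrt_div hs0.le, Real.sqrt_sq hδ.le]
    field_simp
  have hfin := poleProfile_laplacian_lower hc hδ.le hcδ ht0 (conformalFactor_nonneg g u z)
    (S := Δ (fun ζ => frozenDistSq g x y₀ (u ζ)) z)
    (G := (δ ^ 2)⁻¹ * (fderiv ℝ (fun ζ => frozenDistSq g x y₀ (u ζ)) z 1 ^ 2 +
      fderiv ℝ (fun ζ => frozenDistSq g x y₀ (u ζ)) z Complex.I ^ 2))
    (by rw [hsq]; exact h1)
    (by
      rw [hsq]
      refine (mul_le_mul_of_nonneg_left h2 (by positivity)).trans_eq ?_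
      ring)
  have h3 := mul_le_mul_of_nonneg_left hfin (by positivity : 0 ≤ (δ ^ 2)⁻¹)
  calc _ = (δ ^ 2)⁻¹ * -(104 * conformalFactor g u z) := by ring
    _ ≤ _ := h3
    _ = _ := by ring

end Pole

section SubMean

theorem SubMeanAt.const_mul {f : ℂ → ℝ} {z : ℂ} (hf : SubMeanAt f z) {c : ℝ} (hc : 0 < c) :
    SubMeanAt (fun ζ => c * f ζ) z := by
  filter_upwards [hf] with r hr φ hφ hle
  have h := hr (fun ζ => c⁻¹ • φ ζ) (hφ.const_smul c⁻¹) fun ζ hζ => by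
    rw [smul_eq_mul, inv_mul_eq_div, le_div_iff₀ hc, mul_comm]
    exact hle ζ hζ
  rw [Real.circleAverage_fun_smul, smul_eq_mul, inv_mul_eq_div, le_div_iff₀ hc, mul_comm] at h
  exact h

end SubMean

/-! ### Truncation of the potential. -/

section Truncation

variable {M : Type*} {ρ : M → EReal}

/-- The function `ρ` truncated from below at `-B`. -/
def truncatePotential (ρ : M → EReal) (B : ℝ) (q : M) : ℝ :=
  (max (ρ q) ((-B : ℝ) : EReal)).toReal

theorem coe_truncatePotential (B : ℝ) {q : M} (h : ρ q ≠ ⊤) :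
    (truncatePotential ρ B q : EReal) = max (ρ q) ((-B : ℝ) : EReal) := by
  refine EReal.coe_toReal ?_ ?_
  · rcases max_choice (ρ q) ((-B : ℝ) : EReal) with h' | h' <;> rw [h']
    · exact h
    · exact EReal.coe_ne_top _
  · exact ((EReal.bot_lt_coe _).trans_le (le_max_right _ _)).ne'

end Truncation

/-! ### The truncated potential along discs, and the asymptotics of the distance at the centre. -/

section Potential

variable {n : ℕ} {M : Type*} [TopologicalSpace M] [ChartedSpace (EuclideanSpace ℝ (Fin n)) M]
  [IsManifold (𝓡 n) ∞ M]

local notation "𝔼" => EuclideanSpace ℝ (Fin n)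

variable {g : Metric n M} {x : OpenPartialHomeomorph M (EuclideanSpace ℝ (Fin n))} {V W : Set M}
  {u : ℂ → M} {z : ℂ} {ρ : M → EReal}

theorem upperSemicontinuousOn_truncatePotential (hu : IsConformalHarmonicDisc g V u)
    (hρ : UpperSemicontinuousOn ρ V) (htop : ∀ q ∈ V, ρ q ≠ ⊤) (B : ℝ) :
    UpperSemicontinuousOn (fun ζ => truncatePotential ρ B (u ζ)) (ball 0 1) := by
  intro z hz y hy
  have hy' : max (ρ (u z)) ((-B : ℝ) : EReal) < (y : EReal) := by
    rw [← coe_truncatePotential B (htop _ (hu.mapsTo hz))]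
    exact EReal.coe_lt_coe_iff.2 hy
  rw [max_lt_iff] at hy'
  have h1 : Tendsto u (𝓝[ball 0 1] z) (𝓝[V] (u z)) :=
    (hu.smooth.continuousOn z hz).tendsto_nhdsWithin hu.mapsTo
  filter_upwards [h1.eventually (hρ _ (hu.mapsTo hz) _ hy'.1), self_mem_nhdsWithin] with ζ h2 hζ
  rw [← EReal.coe_lt_coe_iff, coe_truncatePotential B (htop _ (hu.mapsTo hζ))]
  exact max_lt h2 hy'.2

namespace IsConformalHarmonicDisc

theorem subMeanAt_of_eventually_coe (hu : IsConformalHarmonicDisc g V u) (hρ : IsMPSHOn g ρ W)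
    (hW : IsOpen W) (hz : z ∈ ball (0 : ℂ) 1) (huz : u z ∈ W) (hne : conformalFactor g u z ≠ 0)
    {f : ℂ → ℝ} (hf : ∀ᶠ ζ in 𝓝 z, (f ζ : EReal) = ρ (u ζ)) : SubMeanAt f z := by
  filter_upwards [hu.eventually_le_circleAverage hρ hW hz huz hne,
    eventually_sphere_of_eventually hf] with r hr hs φ hφ hle
  rw [← EReal.coe_le_coe_iff, hf.self_of_nhds]
  refine hr φ hφ fun ζ hζ => ?_
  rw [← hs.2 ζ hζ]
  exact EReal.coe_le_coe_iff.2 (hle ζ hζ)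

/-- A continuous majorant of the truncation lies above both ρ∘u and -B, so its mean bounds ρ(u(z))
and -B. -/
theorem subMeanAt_truncatePotential (hu : IsConformalHarmonicDisc g V u) (hρ : IsMPSHOn g ρ V)
    (hV : IsOpen V) (hz : z ∈ ball (0 : ℂ) 1) (hne : conformalFactor g u z ≠ 0) (B : ℝ) :
    SubMeanAt (fun ζ => truncatePotential ρ B (u ζ)) z := by
  have hcoe : ∀ ζ ∈ ball (0 : ℂ) 1, (truncatePotential ρ B (u ζ) : EReal) = _ := fun ζ hζ =>
    coe_truncatePotential B (hρ.lt_top _ (hu.mapsTo hζ)).ne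
  filter_upwards [hu.eventually_le_circleAverage hρ hV hz (hu.mapsTo hz) hne,
    eventually_sphere_of_eventually (isOpen_ball.mem_nhds hz)] with r hr hs φ hφ hle
  have hle' : ∀ ζ ∈ sphere z r, max (ρ (u ζ)) ((-B : ℝ) : EReal) ≤ (φ ζ : EReal) := fun ζ hζ => by
    rw [← hcoe ζ (hs.2 ζ hζ)]
    exact EReal.coe_le_coe_iff.2 (hle ζ hζ)
  rw [← EReal.coe_le_coe_iff, hcoe z hz]
  refine max_le (hr φ hφ fun ζ hζ => (le_max_left _ _).trans (hle' ζ hζ)) ?_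
  rw [EReal.coe_le_coe_iff]
  have h1 : ∀ ζ ∈ sphere z |r|, -B ≤ φ ζ := fun ζ hζ => by
    rw [abs_of_pos hs.1] at hζ
    exact EReal.coe_le_coe_iff.1 ((le_max_right _ _).trans (hle' ζ hζ))
  have h2 := Real.circleAverage_mono (circleIntegrable_const (-B) z r)
    (hφ.circleIntegrable hs.1.le) h1
  rwa [Real.circleAverage_const] at h2

/-- The squared distance to the centre of a conformal disc is asymptotic to the conformal factor
times the squared modulus. -/
theorem tendsto_frozenDistSq_div (hu : IsConformalHarmonicDisc g V u)
    (hx : x ∈ IsManifold.maximalAtlas (𝓡 n) ∞ M) (h0 : u 0 ∈ x.source) :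
    Tendsto (fun z => frozenDistSq g x (x (u 0)) (u z) / ‖z‖ ^ 2) (𝓝[≠] 0)
      (𝓝 (conformalFactor g u 0)) := by
  have hz0 : (0 : ℂ) ∈ ball (0 : ℂ) 1 := by simp
  set X : ℂ → 𝔼 := fun ζ => x (u ζ) with hX
  have hd : HasFDerivAt X (fderiv ℝ X 0) 0 :=
    ((hu.contDiffAt_chart hx hz0 h0).differentiableAt (by simp)).hasFDerivAt
  set T := fderiv ℝ X 0 with hT
  set G := metricForm g x (x (u 0)) with hG
  have hGs : ∀ a b, G a b = G b a := metricForm_symm g _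
  -- Conformality makes du(0) a homothety onto its image, so the limit does not depend on the
  -- direction of approach.
  have hconf : ∀ v : ℂ, G (T v) (T v) = conformalFactor g u 0 * ‖v‖ ^ 2 := by
    intro v
    have hv : v = v.re • (1 : ℂ) + v.im • Complex.I := by
      apply Complex.ext <;> simp
    have e1 : G (T 1) (T 1) = conformalFactor g u 0 := (hu.conformalFactor_eq_one hx hz0 h0).symm
    have e2 : G (T Complex.I) (T Complex.I) = conformalFactor g u 0 :=
      (hu.conformalFactor_eq_I hx hz0 h0).symm
    have e3 : G (T 1) (T Complex.I) = 0 := hu.metricForm_one_I hx hz0 h0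
    have e4 : T v = v.re • T 1 + v.im • T Complex.I := by
      conv_lhs => rw [hv]
      rw [map_add, map_smul, map_smul]
    have e5 : ‖v‖ ^ 2 = v.re ^ 2 + v.im ^ 2 := by
      rw [← Complex.normSq_eq_norm_sq, Complex.normSq_apply]; ring
    rw [e4, e5]
    simp only [map_add, map_smul, _root_.add_apply, _root_.smul_apply, smul_eq_mul, e1, e2, e3,
      hGs (T Complex.I) (T 1)]
    ring
  have hlim := hasFDerivAt_iff_tendsto.1 hd
  have hd0 : Tendsto (fun z : ℂ => ‖z - 0‖⁻¹ * ‖X z - X 0 - T (z - 0)‖) (𝓝[≠] 0) (𝓝 0) :=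
    hlim.mono_left nhdsWithin_le_nhds
  have hbound : Tendsto (fun z : ℂ => ‖G‖ * (‖z - 0‖⁻¹ * ‖X z - X 0 - T (z - 0)‖) *
      (‖z - 0‖⁻¹ * ‖X z - X 0 - T (z - 0)‖ + 2 * ‖T‖)) (𝓝[≠] 0)
      (𝓝 (‖G‖ * 0 * (0 + 2 * ‖T‖))) :=
    (hd0.const_mul _).mul (hd0.add tendsto_const_nhds)
  rw [mul_zero, zero_mul] at hbound
  rw [tendsto_iff_norm_sub_tendsto_zero]
  refine squeeze_zero' (Eventually.of_forall fun _ => norm_nonneg _) ?_ hbound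
  filter_upwards [self_mem_nhdsWithin] with z hz
  have hzn : 0 < ‖z‖ := norm_pos_iff.2 hz
  rw [sub_zero]
  set d := X z - X 0 - T z with hdd
  have hXz : X z - X 0 = T z + d := by rw [hdd]; abel
  have hval : frozenDistSq g x (x (u 0)) (u z) / ‖z‖ ^ 2 - conformalFactor g u 0 =
      (2 * G (T z) d + G d d) / ‖z‖ ^ 2 := by
    have : frozenDistSq g x (x (u 0)) (u z) = G (X z - X 0) (X z - X 0) := rfl
    rw [this, hXz]
    simp only [map_add, _root_.add_apply, hconf, hGs d (T z)]
    field_simp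
    ring
  rw [hval, norm_div, norm_pow, norm_norm, div_le_iff₀ (by positivity)]
  have b1 : ‖G (T z) d‖ ≤ ‖G‖ * (‖T‖ * ‖z‖) * ‖d‖ :=
    (G.le_opNorm₂ _ _).trans (by gcongr; exact T.le_opNorm z)
  have b2 : ‖G d d‖ ≤ ‖G‖ * ‖d‖ * ‖d‖ := G.le_opNorm₂ _ _
  calc ‖2 * G (T z) d + G d d‖ ≤ 2 * ‖G (T z) d‖ + ‖G d d‖ := by
        refine (norm_add_le _ _).trans ?_
        rw [norm_mul]; simp
    _ ≤ 2 * (‖G‖ * (‖T‖ * ‖z‖) * ‖d‖) + ‖G‖ * ‖d‖ * ‖d‖ := by gcongr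
    _ = _ := by field_simp; ring

end IsConformalHarmonicDisc

end Potential

theorem isClosed_image_closedBall {n : ℕ} {M : Type*} [TopologicalSpace M] [T2Space M]
    {x : OpenPartialHomeomorph M (EuclideanSpace ℝ (Fin n))} {R : ℝ}
    (hR : closedBall (0 : EuclideanSpace ℝ (Fin n)) R ⊆ x.target) :
    IsClosed (x.symm '' closedBall (0 : EuclideanSpace ℝ (Fin n)) R) :=
  ((isCompact_closedBall (0 : EuclideanSpace ℝ (Fin n)) R).image_of_continuousOn
    (x.continuousOn_symm.mono hR)).isClosed

/-! ### The normalized squared distance extended to all of M. -/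

section Cutoff

variable {n : ℕ} {M : Type*} [TopologicalSpace M] [ChartedSpace (EuclideanSpace ℝ (Fin n)) M]
  [IsManifold (𝓡 n) ∞ M]

local notation "𝔼" => EuclideanSpace ℝ (Fin n)

variable {g : Metric n M} {x : OpenPartialHomeomorph M (EuclideanSpace ℝ (Fin n))}

open Classical in
/-- The normalized squared distance `s / δ²` in a chart, cut off at `1` and extended by `1`. -/
def cutoffDistSq (g : Metric n M) (x : OpenPartialHomeomorph M (EuclideanSpace ℝ (Fin n)))
    (y₀ : EuclideanSpace ℝ (Fin n)) (δ : ℝ) (q : M) : ℝ :=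
  if q ∈ x.source then min (frozenDistSq g x y₀ q / δ ^ 2) 1 else 1

variable {y₀ : EuclideanSpace ℝ (Fin n)} {δ m : ℝ}

theorem cutoffDistSq_of_mem {q : M} (hq : q ∈ x.source) :
    cutoffDistSq g x y₀ δ q = min (frozenDistSq g x y₀ q / δ ^ 2) 1 := if_pos hq

/-- The profile vanishes for t ≥ 1, so the cut-off does not affect it. -/
theorem poleProfile_cutoffDistSq {q : M} (hq : q ∈ x.source) (κ : ℝ) :
    poleProfile κ (cutoffDistSq g x y₀ δ q) =
      poleProfile κ (frozenDistSq g x y₀ q / δ ^ 2) := by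
  rw [cutoffDistSq_of_mem hq]
  rcases le_total (frozenDistSq g x y₀ q / δ ^ 2) 1 with h | h
  · rw [min_eq_left h]
  · rw [min_eq_right h, poleProfile_of_one_le κ h, poleProfile_of_one_le κ le_rfl]

/-- At coordinate distance at least 1 from y₀ the frozen form is at least m ≥ δ². -/
theorem cutoffDistSq_eq_one (hm : 0 < m) (hlow : ∀ a : 𝔼, m * ‖a‖ ^ 2 ≤ metricForm g x y₀ a a)
    (hδ : 0 < δ) (hδm : δ ^ 2 ≤ m) {q : M}
    (hq : q ∉ x.symm '' closedBall (0 : 𝔼) (‖y₀‖ + 1)) : cutoffDistSq g x y₀ δ q = 1 := by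
  by_cases hs : q ∈ x.source
  · rw [cutoffDistSq_of_mem hs, min_eq_right]
    rw [le_div_iff₀ (by positivity), one_mul]
    have h1 : ‖y₀‖ + 1 < ‖x q‖ := by
      by_contra! h
      exact hq ⟨x q, by simpa using h, x.left_inv hs⟩
    have h2 : 1 ≤ ‖x q - y₀‖ := by linarith [norm_sub_norm_le (x q) y₀]
    calc δ ^ 2 ≤ m * 1 ^ 2 := by linarith
      _ ≤ m * ‖x q - y₀‖ ^ 2 := by gcongr
      _ ≤ _ := hlow _
  · exact if_neg hs

theorem continuousAt_frozenDistSq {q : M} (hq : q ∈ x.source) :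
    ContinuousAt (frozenDistSq g x y₀) q :=
  ((contDiff_quadratic (metricForm g x y₀) y₀ (k := 0)).continuous.continuousAt).comp
    (x.continuousAt hq)

/-- Off the chart, the complement of the compact coordinate ball is a neighbourhood on which the
function is 1; this ball is closed in M because M is Hausdorff. -/
theorem continuous_cutoffDistSq [T2Space M] (hm : 0 < m)
    (hlow : ∀ a : 𝔼, m * ‖a‖ ^ 2 ≤ metricForm g x y₀ a a) (hδ : 0 < δ) (hδm : δ ^ 2 ≤ m)
    (hR : closedBall (0 : 𝔼) (‖y₀‖ + 1) ⊆ x.target) : Continuous (cutoffDistSq g x y₀ δ) := by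
  rw [continuous_iff_continuousAt]
  intro q
  by_cases hs : q ∈ x.source
  · have h : ContinuousAt (fun q => min (frozenDistSq g x y₀ q / δ ^ 2) 1) q :=
      ((continuousAt_frozenDistSq hs).div_const _).min continuousAt_const
    refine h.congr ?_
    filter_upwards [x.open_source.mem_nhds hs] with q' hq' using (cutoffDistSq_of_mem hq').symm
  · have hq : q ∉ x.symm '' closedBall (0 : 𝔼) (‖y₀‖ + 1) := by
      rintro ⟨y, hy, rfl⟩
      exact hs (x.map_target (hR hy))
    refine (continuousAt_const (y := (1 : ℝ))).congr ?_
    filter_upwards [(isClosed_image_closedBall hR).isOpen_compl.mem_nhds hq] with q' hq'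
    exact (cutoffDistSq_eq_one hm hlow hδ hδm hq').symm

theorem cutoffDistSq_nonneg (hlow : ∀ a : 𝔼, 0 ≤ metricForm g x y₀ a a) (q : M) :
    0 ≤ cutoffDistSq g x y₀ δ q := by
  unfold cutoffDistSq
  split_ifs
  · exact le_min (div_nonneg (hlow _) (by positivity)) zero_le_one
  · exact zero_le_one

end Cutoff

theorem exists_coe_of_abs_le {a : EReal} {B : ℝ} (hB : 0 ≤ B) (h : a.abs ≤ ENNReal.ofReal B) :
    ∃ r : ℝ, a = r ∧ |r| ≤ B := by
  induction a with
  | bot => simp at h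
  | top => simp at h
  | coe r => exact ⟨r, rfl, by rwa [EReal.abs_def, ENNReal.ofReal_le_ofReal_iff hB] at h⟩

theorem truncatePotential_of_abs_le {M : Type*} {ρ : M → EReal} {q : M} {r B : ℝ} (hr : ρ q = r)
    (h : |r| ≤ B) : truncatePotential ρ B q = r := by
  rw [truncatePotential, hr, max_eq_left (EReal.coe_le_coe_iff.2 (abs_le.1 h).1), EReal.toReal_coe]

/-! ### The Sibony-type estimate at the centre of a disc. -/

section Estimate

variable {n : ℕ} {M : Type*} [TopologicalSpace M] [ChartedSpace (EuclideanSpace ℝ (Fin n)) M]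
  [IsManifold (𝓡 n) ∞ M]

local notation "𝔼" => EuclideanSpace ℝ (Fin n)

variable {g : Metric n M} {x : OpenPartialHomeomorph M (EuclideanSpace ℝ (Fin n))} {D : Set M}
  {u : ℂ → M} {ρ : M → EReal}

/-- The decomposition of `W + lam * V` into a smooth part with nonnegative Laplacian and a part
with the sub-mean value property. -/
theorem IsConformalHarmonicDisc.exists_subMean_decomposition [T2Space M]
    (hu : IsConformalHarmonicDisc g D u) (hx : x ∈ IsManifold.maximalAtlas (𝓡 n) ∞ M)
    (hT : closedBall (0 : 𝔼) 2 ⊆ x.target) {m Λ κ c₀ δ ε B : ℝ} (hm : 0 < m) (hΛ : 0 < Λ)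
    (hc₀ : 0 < c₀) (hδ : 0 < δ) (hε : 0 < ε) (hB : 0 < B) {y₀ : EuclideanSpace ℝ (Fin n)}
    (hy₀ : ‖y₀‖ < 1) (hlow : ∀ a : 𝔼, m * ‖a‖ ^ 2 ≤ metricForm g x y₀ a a)
    (hup : ∀ y ∈ closedBall (0 : 𝔼) 2, ∀ a : 𝔼, metricForm g x y a a ≤ Λ * ‖a‖ ^ 2)
    (hδm : δ ^ 2 ≤ m) {z : ℂ} (hz : z ∈ ball (0 : ℂ) 1) (hne : conformalFactor g u z ≠ 0)
    (htz : cutoffDistSq g x y₀ δ (u z) ≠ 0)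
    (hpole : u z ∈ x.source → x (u z) ∈ closedBall (0 : 𝔼) 2 → x (u z) ≠ y₀ →
      ContDiffAt ℝ 2 (fun ζ => poleProfile κ (frozenDistSq g x y₀ (u ζ) / δ ^ 2)) z ∧
        -(104 * conformalFactor g u z / δ ^ 2) ≤
          Δ (fun ζ => poleProfile κ (frozenDistSq g x y₀ (u ζ) / δ ^ 2)) z)
    (hsq : u z ∈ x.symm '' closedBall (0 : 𝔼) 2 →
      c₀ * (‖fderiv ℝ (fun ζ => x (u ζ)) z 1‖ ^ 2 +
        ‖fderiv ℝ (fun ζ => x (u ζ)) z Complex.I‖ ^ 2) ≤ Δ (fun ζ => ‖x (u ζ)‖ ^ 2) z)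
    (hD : IsOpen D) (hρ : IsMPSHOn g ρ D)
    (hρε : IsMPSHOn g (fun q => ρ q - ((ε * ‖x q‖ ^ 2 : ℝ) : EReal)) (D ∩ x.source))
    (hρB : ∀ q ∈ D ∩ x.source, ‖x q‖ < 2 → (ρ q).abs ≤ ENNReal.ofReal B) :
    ∃ ψ V₁ : ℂ → ℝ, ContDiffAt ℝ 2 ψ z ∧ 0 ≤ Δ ψ z ∧ SubMeanAt V₁ z ∧
      ∀ᶠ ζ in 𝓝 z, poleProfile κ (cutoffDistSq g x y₀ δ (u ζ)) +
        52 * Λ / (ε * c₀ * δ ^ 2) * truncatePotential ρ B (u ζ) = ψ ζ + V₁ ζ := by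
  -- By conformality Λ(|X_x|² + |X_y|²) ≥ 2e with X = x∘u, so lam·ε·Δ|X|² ≥ 2 · 52 e/δ², which
  -- offsets the loss 104 e/δ² of the profile.
  set lam := 52 * Λ / (ε * c₀ * δ ^ 2) with hlam
  have hlam0 : 0 < lam := by positivity
  have hev : ∀ {W : Set M}, IsOpen W → u z ∈ W → ∀ᶠ ζ in 𝓝 z, ζ ∈ ball (0 : ℂ) 1 ∧ u ζ ∈ W :=
    fun hW hzW => (hu.isOpen_preimage hW).mem_nhds ⟨hz, hzW⟩
  by_cases hin : u z ∈ x.source ∧ ‖x (u z)‖ < 2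
  · obtain ⟨hzs, hz2⟩ := hin
    have hzK : x (u z) ∈ closedBall (0 : 𝔼) 2 := by simpa using hz2.le
    have hney : x (u z) ≠ y₀ := by
      intro h
      refine htz ?_
      rw [cutoffDistSq_of_mem hzs, frozenDistSq, h]
      simp
    obtain ⟨hP, hPΔ⟩ := hpole hzs hzK hney
    have hX2 : ContDiffAt ℝ 2 (fun ζ => x (u ζ)) z :=
      (hu.contDiffAt_chart hx hz hzs).of_le (WithTop.coe_le_coe.2 le_top)
    have hN : ContDiffAt ℝ 2 (fun ζ => ‖x (u ζ)‖ ^ 2) z := hX2.norm_sq ℝ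
    have hN' : ContDiffAt ℝ 2 ((lam * ε) • fun ζ => ‖x (u ζ)‖ ^ 2) z := hN.const_smul (lam * ε)
    have hnear : ∀ᶠ ζ in 𝓝 z, u ζ ∈ D ∩ x.source ∧ ‖x (u ζ)‖ < 2 := by
      filter_upwards [hev (hD.inter x.open_source) ⟨hu.mapsTo hz, hzs⟩,
        hX2.continuousAt.norm.eventually (gt_mem_nhds hz2)] with ζ h1 h2 using ⟨h1.2, h2⟩
    -- Where |ρ| ≤ B the truncation changes nothing, so ρ - ε|x|² is real valued and its sub-mean
    -- value property applies; ε|x|² moves into the smooth part.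
    have hcoe : ∀ᶠ ζ in 𝓝 z, ((truncatePotential ρ B (u ζ) - ε * ‖x (u ζ)‖ ^ 2 : ℝ) : EReal) =
        ρ (u ζ) - ((ε * ‖x (u ζ)‖ ^ 2 : ℝ) : EReal) := by
      filter_upwards [hnear] with ζ hζ
      obtain ⟨r, hr, hrB⟩ := exists_coe_of_abs_le hB.le (hρB _ hζ.1 hζ.2)
      rw [truncatePotential_of_abs_le hr hrB, hr, EReal.coe_sub]
    have hsub := (hu.subMeanAt_of_eventually_coe hρε (hD.inter x.open_source) hz
      ⟨hu.mapsTo hz, hzs⟩ hne hcoe).const_mul hlam0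
    refine ⟨(fun ζ => poleProfile κ (frozenDistSq g x y₀ (u ζ) / δ ^ 2)) +
      (lam * ε) • fun ζ => ‖x (u ζ)‖ ^ 2, _, hP.add hN', ?_, hsub, ?_⟩
    · rw [hP.laplacian_add hN', laplacian_smul _ hN, smul_eq_mul]
      have h1 := hsq ⟨x (u z), hzK, x.left_inv hzs⟩
      have e1 := hu.conformalFactor_eq_one hx hz hzs ▸ hup _ hzK (fderiv ℝ (fun ζ => x (u ζ)) z 1)
      have e2 := hu.conformalFactor_eq_I hx hz hzs ▸
        hup _ hzK (fderiv ℝ (fun ζ => x (u ζ)) z Complex.I)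
      have h2 := mul_le_mul_of_nonneg_left h1 (by positivity : 0 ≤ lam * ε)
      have h3 : 104 * conformalFactor g u z / δ ^ 2 ≤ lam * ε *
          (c₀ * (‖fderiv ℝ (fun ζ => x (u ζ)) z 1‖ ^ 2 +
            ‖fderiv ℝ (fun ζ => x (u ζ)) z Complex.I‖ ^ 2)) := by
        have h4 : lam * ε * (c₀ * (‖fderiv ℝ (fun ζ => x (u ζ)) z 1‖ ^ 2 +
            ‖fderiv ℝ (fun ζ => x (u ζ)) z Complex.I‖ ^ 2)) =
            52 * (Λ * ‖fderiv ℝ (fun ζ => x (u ζ)) z 1‖ ^ 2 +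
              Λ * ‖fderiv ℝ (fun ζ => x (u ζ)) z Complex.I‖ ^ 2) / δ ^ 2 := by
          rw [hlam]; field_simp
        rw [h4]
        refine div_le_div_of_nonneg_right ?_ (by positivity)
        linarith
      linarith
    · filter_upwards [hnear] with ζ hζ
      rw [poleProfile_cutoffDistSq hζ.1.2]
      simp only [Pi.add_apply, Pi.smul_apply, smul_eq_mul]
      ring
  · have hR : closedBall (0 : 𝔼) (‖y₀‖ + 1) ⊆ x.target :=
      (closedBall_subset_closedBall (by linarith)).trans hT
    -- Since ‖y₀‖ + 1 < 2, the point lies off the support of the profile. There W vanishes near z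
    -- and the truncated potential suffices.
    have hout : u z ∈ (x.symm '' closedBall (0 : 𝔼) (‖y₀‖ + 1))ᶜ := by
      rintro ⟨y, hy, hyz⟩
      refine hin ⟨hyz ▸ x.map_target (hR hy), ?_⟩
      rw [← hyz, x.right_inv (hR hy)]
      rw [mem_closedBall_zero_iff] at hy
      linarith
    refine ⟨fun _ => 0, _, contDiffAt_const, ?_,
      (hu.subMeanAt_truncatePotential hρ hD hz hne B).const_mul hlam0, ?_⟩
    · rw [laplacian_eq_fderiv_fderiv]; simp
    · filter_upwards [hev (isClosed_image_closedBall hR).isOpen_compl hout] with ζ hζ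
      rw [cutoffDistSq_eq_one hm hlow hδ hδm hζ.2, poleProfile_of_one_le κ le_rfl]

/-- The upper bound for the conformal factor at the centre of a conformal harmonic disc. -/
theorem IsConformalHarmonicDisc.log_conformalFactor_le [T2Space M]
    (hu : IsConformalHarmonicDisc g D u) (hx : x ∈ IsManifold.maximalAtlas (𝓡 n) ∞ M)
    (hT : closedBall (0 : 𝔼) 2 ⊆ x.target) {m Λ κ c₀ δ ε B : ℝ} (hm : 0 < m) (hΛ : 0 < Λ)
    (hκ : 0 ≤ κ) (hc₀ : 0 < c₀) (hδ : 0 < δ) (hε : 0 < ε) (hB : 0 < B) (h0s : u 0 ∈ x.source)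
    (hy₀ : ‖x (u 0)‖ < 1) (hlow : ∀ a : 𝔼, m * ‖a‖ ^ 2 ≤ metricForm g x (x (u 0)) a a)
    (hup : ∀ y ∈ closedBall (0 : 𝔼) 2, ∀ a : 𝔼, metricForm g x y a a ≤ Λ * ‖a‖ ^ 2)
    (hδm : δ ^ 2 ≤ m) (hne : conformalFactor g u 0 ≠ 0)
    (hpole : ∀ z ∈ ball (0 : ℂ) 1, u z ∈ x.source → x (u z) ∈ closedBall (0 : 𝔼) 2 →
      x (u z) ≠ x (u 0) →
      ContDiffAt ℝ 2 (fun ζ => poleProfile κ (frozenDistSq g x (x (u 0)) (u ζ) / δ ^ 2)) z ∧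
        -(104 * conformalFactor g u z / δ ^ 2) ≤
          Δ (fun ζ => poleProfile κ (frozenDistSq g x (x (u 0)) (u ζ) / δ ^ 2)) z)
    (hsq : ∀ z ∈ ball (0 : ℂ) 1, u z ∈ x.symm '' closedBall (0 : 𝔼) 2 →
      c₀ * (‖fderiv ℝ (fun ζ => x (u ζ)) z 1‖ ^ 2 +
        ‖fderiv ℝ (fun ζ => x (u ζ)) z Complex.I‖ ^ 2) ≤ Δ (fun ζ => ‖x (u ζ)‖ ^ 2) z)
    (hD : IsOpen D) (hρ0 : ∀ q ∈ D, ρ q < 0) (hρ : IsMPSHOn g ρ D)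
    (hρε : IsMPSHOn g (fun q => ρ q - ((ε * ‖x q‖ ^ 2 : ℝ) : EReal)) (D ∩ x.source))
    (hρB : ∀ q ∈ D ∩ x.source, ‖x q‖ < 2 → (ρ q).abs ≤ ENNReal.ofReal B) :
    Real.log (conformalFactor g u 0) ≤ Real.log (δ ^ 2) + 2 * κ -
      52 * Λ / (ε * c₀ * δ ^ 2) * truncatePotential ρ B (u 0) := by
  set lam := 52 * Λ / (ε * c₀ * δ ^ 2) with hlam
  have hlam0 : 0 < lam := by positivity
  have hz0 : (0 : ℂ) ∈ ball (0 : ℂ) 1 := by simp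
  have hR : closedBall (0 : 𝔼) (‖x (u 0)‖ + 1) ⊆ x.target :=
    (closedBall_subset_closedBall (by linarith)).trans hT
  have hSc := continuous_cutoffDistSq hm hlow hδ hδm hR
  set t : ℂ → ℝ := fun z => cutoffDistSq g x (x (u 0)) δ (u z) with ht
  set V : ℂ → ℝ := fun z => truncatePotential ρ B (u z) with hV
  have htc : ContinuousOn t (ball 0 1) := hSc.comp_continuousOn hu.smooth.continuousOn
  have ht0 : ∀ z, 0 ≤ t z := fun z =>
    cutoffDistSq_nonneg (fun a => le_trans (by positivity) (hlow a)) _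
  have htpos : ∀ z, t z ≠ 0 → 0 < t z := fun z h => lt_of_le_of_ne (ht0 z) h.symm
  have hV0 : ∀ z ∈ ball (0 : ℂ) 1, V z ≤ 0 := by
    intro z hz
    rw [← EReal.coe_le_coe_iff, hV]
    simp only
    rw [coe_truncatePotential B (hρ.lt_top _ (hu.mapsTo hz)).ne]
    refine max_le (hρ0 _ (hu.mapsTo hz)).le (EReal.coe_le_coe_iff.2 (by linarith))
  have he0 : 0 < conformalFactor g u 0 := lt_of_le_of_ne (conformalFactor_nonneg g u 0) hne.symm
  have hlim := hu.tendsto_frozenDistSq_div hx h0s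
  have hballev : ∀ᶠ z in 𝓝[≠] (0 : ℂ), z ∈ ball (0 : ℂ) 1 ∧ u z ∈ x.source ∧ z ≠ 0 := by
    have : ∀ᶠ z in 𝓝 (0 : ℂ), z ∈ ball (0 : ℂ) 1 ∧ u z ∈ x.source :=
      (hu.isOpen_preimage x.open_source).mem_nhds ⟨hz0, h0s⟩
    filter_upwards [mem_nhdsWithin_of_mem_nhds this, self_mem_nhdsWithin] with z h1 h2 using
      ⟨h1.1, h1.2, h2⟩
  have hlog : Tendsto (fun z => Real.log (frozenDistSq g x (x (u 0)) (u z) / ‖z‖ ^ 2)) (𝓝[≠] 0)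
      (𝓝 (Real.log (conformalFactor g u 0))) := hlim.log hne
  have hspos : ∀ᶠ z in 𝓝[≠] (0 : ℂ), 0 < frozenDistSq g x (x (u 0)) (u z) := by
    filter_upwards [hlim.eventually (lt_mem_nhds he0), self_mem_nhdsWithin] with z h1 h2
    have hn : 0 < ‖z‖ := norm_pos_iff.2 h2
    rwa [lt_div_iff₀ (by positivity), zero_mul] at h1
  have htlt : ∀ᶠ z in 𝓝[≠] (0 : ℂ), t z < 1 := by
    have h1 : t 0 < 1 := by
      rw [ht]
      simp only
      rw [cutoffDistSq_of_mem h0s, frozenDistSq]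
      simp
    exact mem_nhdsWithin_of_mem_nhds
      ((htc.continuousAt (isOpen_ball.mem_nhds hz0)).eventually (gt_mem_nhds h1))
  have hteq : ∀ᶠ z in 𝓝[≠] (0 : ℂ), t z = frozenDistSq g x (x (u 0)) (u z) / δ ^ 2 ∧ 0 < t z := by
    filter_upwards [hballev, htlt, hspos] with z h1 h2 h3
    have h4 : t z = min (frozenDistSq g x (x (u 0)) (u z) / δ ^ 2) 1 := cutoffDistSq_of_mem h1.2.1
    have h5 : t z = frozenDistSq g x (x (u 0)) (u z) / δ ^ 2 := by
      rcases min_choice (frozenDistSq g x (x (u 0)) (u z) / δ ^ 2) 1 with h | h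
      · rw [h4, h]
      · rw [h4, h] at h2; exact absurd h2 (lt_irrefl _)
    exact ⟨h5, h5 ▸ by positivity⟩
  have hlogt : ∀ᶠ z in 𝓝[≠] (0 : ℂ), Real.log (t z) =
      Real.log (frozenDistSq g x (x (u 0)) (u z) / ‖z‖ ^ 2) + 2 * Real.log ‖z‖ -
        Real.log (δ ^ 2) := by
    filter_upwards [hteq, hspos, self_mem_nhdsWithin] with z h1 h2 h3
    have hn : 0 < ‖z‖ := norm_pos_iff.2 h3
    rw [h1.1, Real.log_div h2.ne' (by positivity), Real.log_div h2.ne' (by positivity),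
      Real.log_pow ‖z‖ 2]
    push_cast
    ring
  have hschwarz := schwarz_maximum_principle (W := fun z => poleProfile κ (t z)) (V := V)
    (e := conformalFactor g u) (t := t) hlam0
    (upperSemicontinuousOn_truncatePotential hu hρ.usc (fun q hq => (hρ.lt_top q hq).ne) B) hV0 htc
    (fun z _ => ht0 z)
    (fun z hz _ htz => ContinuousAt.comp (g := poleProfile κ)
      (contDiffAt_poleProfile κ (htpos z htz)).continuousAt
      (htc.continuousAt (isOpen_ball.mem_nhds hz)))
    (fun z _ htz => (poleProfile_bounds hκ (htpos z htz)).1)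
    ⟨2, fun z _ htz => (poleProfile_bounds hκ (htpos z htz)).2.1⟩
    ⟨Real.log (conformalFactor g u 0) + 1 - Real.log (δ ^ 2) + 2, by
      filter_upwards [hteq, hlogt, hlog.eventually (gt_mem_nhds (lt_add_one _))] with z h1 h2 h3
      have := (poleProfile_bounds hκ h1.2).2.1
      linarith⟩
    (fun z hz => (hu.contDiffAt_conformalFactor hz).continuousAt.continuousWithinAt)
    (fun z _ => conformalFactor_nonneg g u z)
    (fun r hr => hu.laplacian_log_conformalFactor_ge hr)
    (fun z hz _ htz hez => hu.exists_subMean_decomposition hx hT hm hΛ hc₀ hδ hε hB hy₀ hlow hup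
      hδm hz hez htz (hpole z hz) (hsq z hz) hD hρ hρε hρB)
  have hVsub := hu.subMeanAt_truncatePotential hρ hD hz0 hne B
  have hneev : ∀ᶠ z in 𝓝[≠] (0 : ℂ), conformalFactor g u z ≠ 0 :=
    mem_nhdsWithin_of_mem_nhds
      ((hu.contDiffAt_conformalFactor hz0).continuousAt.eventually_ne hne)
  have key : ∀ η > 0, Real.log (conformalFactor g u 0) ≤
      Real.log (δ ^ 2) + 2 * κ - lam * V 0 + (1 + lam) * η := by
    intro η hη
    -- A point near 0 with V(z) ≥ V(0) - η at which the asymptotics also hold. There log t - 2κ ≤ W,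
    -- and 2 log|z| cancels against the expansion of log t.
    obtain ⟨z, hVz, hz, hz1, hz2, hz3, hz4, hz5⟩ := ((hVsub.frequently_ge hη).and_eventually
      (hballev.and (htlt.and (hteq.and (hlogt.and (hneev.and
        (hlog.eventually (lt_mem_nhds (sub_lt_self _ hη))))))))).exists
    have h1 := hschwarz z hz.1 hz.2.2 hz2.2.ne' hz4
    have h2 := (poleProfile_bounds hκ hz2.2).2.2 hz1
    have h3 := mul_le_mul_of_nonneg_left hVz hlam0.le
    change lam * (V 0 - η) ≤ lam * V z at h3
    linarith
  have hl : Tendsto (fun η => Real.log (δ ^ 2) + 2 * κ - lam * V 0 + (1 + lam) * η) (𝓝[>] 0)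
      (𝓝 (Real.log (δ ^ 2) + 2 * κ - lam * V 0 + (1 + lam) * 0)) :=
    (tendsto_const_nhds.add (tendsto_id.const_mul _)).mono_left nhdsWithin_le_nhds
  rw [mul_zero, add_zero] at hl
  refine ge_of_tendsto hl ?_
  filter_upwards [self_mem_nhdsWithin] with η hη using key η hη

end Estimate

/-! ### From conformal factors to the Kobayashi–Royden pseudometric. -/

section KobayashiRoyden

variable {n : ℕ} {M : Type*} [TopologicalSpace M] [ChartedSpace (EuclideanSpace ℝ (Fin n)) M]
  [IsManifold (𝓡 n) ∞ M]

local notation "𝔼" => EuclideanSpace ℝ (Fin n)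

variable {g : Metric n M} {x : OpenPartialHomeomorph M (EuclideanSpace ℝ (Fin n))}

/-- The conformal factor at the centre of a conformal harmonic disc is bounded by the modulus of a
potential as in the Sibony-type estimate. -/
theorem exists_conformalFactor_le [T2Space M] (hx : x ∈ IsManifold.maximalAtlas (𝓡 n) ∞ M)
    (hT : closedBall (0 : 𝔼) 2 ⊆ x.target)
    (hU : IsStrictlyMPSHOn g (fun q => ‖x q‖ ^ 2) x.source) {ε B : ℝ} (hε : 0 < ε) (hB : 0 < B) :
    ∃ C > 0, ∀ D : Set M, IsOpen D → ∀ ρ : M → EReal, (∀ q ∈ D, ρ q < 0) → IsMPSHOn g ρ D →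
      IsMPSHOn g (fun q => ρ q - ((ε * ‖x q‖ ^ 2 : ℝ) : EReal)) (D ∩ x.source) →
      (∀ q ∈ D ∩ x.source, ‖x q‖ < 2 → (ρ q).abs ≤ ENNReal.ofReal B) →
      ∀ u : ℂ → M, IsConformalHarmonicDisc g D u → u 0 ∈ x.source → ‖x (u 0)‖ < 1 →
      ∀ r : ℝ, ρ (u 0) = r → |r| ≤ B → conformalFactor g u 0 ≤ C * |r| := by
  obtain ⟨m, hm, Λ, hΛ, c, hc, hlow, hup, hpole⟩ :=
    exists_laplacian_poleProfile_ge (g := g) hx le_rfl hT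
  have hKx : x.symm '' closedBall (0 : 𝔼) 2 ⊆ x.source := by
    rintro _ ⟨y, hy, rfl⟩
    exact x.map_target (hT hy)
  obtain ⟨c₀, hc₀, hsq⟩ := exists_laplacian_norm_sq_ge_of_compact hx hU
    ((isCompact_closedBall (0 : 𝔼) 2).image_of_continuousOn (x.continuousOn_symm.mono hT)) hKx
  obtain ⟨δ₀, hδ₀, hδ₀c, hδ₀m⟩ : ∃ δ₀ > 0, c * δ₀ ≤ 1 ∧ δ₀ ^ 2 ≤ m := by
    have hs := Real.sqrt_pos.2 hm
    have hc1 : 0 < c + 1 := by linarith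
    refine ⟨min (1 / (c + 1)) √m, by positivity, ?_, ?_⟩
    · calc c * min (1 / (c + 1)) √m ≤ c * (1 / (c + 1)) := by gcongr; exact min_le_left _ _
        _ ≤ 1 := by rw [mul_one_div, div_le_one hc1]; linarith
    · calc min (1 / (c + 1)) √m ^ 2 ≤ √m ^ 2 := by gcongr; exact min_le_right _ _
        _ = m := Real.sq_sqrt hm.le
  -- The 8 bounds 2κ = 8cδ, and the second summand of the exponent is the constant value of lam·|r|.
  refine ⟨δ₀ ^ 2 / B * Real.exp (8 + 52 * Λ * B / (ε * c₀ * δ₀ ^ 2)), by positivity, ?_⟩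
  intro D hD ρ hρ0 hρ hρε hρB u hu h0s h01 r hr hrB
  rcases eq_or_ne (conformalFactor g u 0) 0 with hne | hne
  · rw [hne]; positivity
  have hz0 : (0 : ℂ) ∈ ball (0 : ℂ) 1 := by simp
  have hr0 : r < 0 := by
    have := hρ0 _ (hu.mapsTo hz0)
    rw [hr] at this
    exact_mod_cast this
  have ha : 0 < |r| := abs_pos.2 hr0.ne
  -- The scale of the pole is adapted to ρ(w): lam is proportional to 1/δ², so lam·|r| no longer
  -- depends on r, while δ² contributes the factor |r|.
  obtain ⟨δ, hδ, hδ2⟩ : ∃ δ > 0, δ ^ 2 = δ₀ ^ 2 * (|r| / B) :=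
    ⟨√(δ₀ ^ 2 * (|r| / B)), by positivity, Real.sq_sqrt (by positivity)⟩
  have hδle2 : δ ^ 2 ≤ δ₀ ^ 2 := by
    rw [hδ2]
    exact mul_le_of_le_one_right (by positivity) ((div_le_one hB).2 hrB)
  have hδle : δ ≤ δ₀ := le_of_sq_le_sq hδle2 hδ₀.le
  have hcδ : c * δ ≤ 1 := (mul_le_mul_of_nonneg_left hδle hc).trans hδ₀c
  have hy : x (u 0) ∈ closedBall (0 : 𝔼) 2 := by
    rw [mem_closedBall_zero_iff]; linarith
  have h := hu.log_conformalFactor_le hx hT hm hΛ (by positivity : 0 ≤ 4 * (c * δ)) hc₀ hδ hε hB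
    h0s h01 (hlow _ hy) hup (hδle2.trans hδ₀m) hne (hpole _ hy δ hδ hcδ D u hu) (hsq D u hu) hD hρ0
    hρ hρε hρB
  rw [truncatePotential_of_abs_le hr hrB, hδ2] at h
  have h1 : 52 * Λ / (ε * c₀ * (δ₀ ^ 2 * (|r| / B))) * r = -(52 * Λ * B / (ε * c₀ * δ₀ ^ 2)) := by
    rw [abs_of_neg hr0]
    have := hr0.ne
    field_simp
  rw [h1] at h
  have h2 : Real.log (conformalFactor g u 0) ≤
      Real.log (δ₀ ^ 2 * (|r| / B)) + (8 + 52 * Λ * B / (ε * c₀ * δ₀ ^ 2)) := by linarith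
  have he0 : 0 < conformalFactor g u 0 := lt_of_le_of_ne (conformalFactor_nonneg g u 0) hne.symm
  have h3 := Real.exp_le_exp.2 h2
  rw [Real.exp_add, Real.exp_log he0, Real.exp_log (by positivity)] at h3
  calc _ ≤ _ := h3
    _ = _ := by ring

/-- A bound for the conformal factors at the centres of all discs gives a lower bound for the
Kobayashi-Royden pseudometric. -/
theorem ofReal_le_kobayashiRoyden {D : Set M} {w : M} {ξ : TangentSpace (𝓡 n) w} {b : ℝ}
    (h : ∀ u : ℂ → M, IsConformalHarmonicDisc g D u → u 0 = w → ∀ α : ℝ, 0 < α →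
      conformalFactor g u 0 = α⁻¹ ^ 2 * g.inner w ξ ξ → b ≤ α) :
    ENNReal.ofReal b ≤ kobayashiRoyden g D w ξ := by
  refine le_iInf fun α => le_iInf fun hα => le_iInf fun hu => ?_
  obtain ⟨u, hu, heq⟩ := hu
  refine ENNReal.ofReal_le_ofReal (h u hu (congrArg Bundle.TotalSpace.proj heq) α hα ?_)
  -- Applying the squared length, a function on the whole tangent bundle, avoids transport between
  -- fibres.
  have h1 := congrArg (fun v : TangentBundle (𝓡 n) M => g.inner v.1 v.2 v.2) heq
  simp only at h1
  change conformalFactor g u 0 = _ at h1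
  rw [h1]
  simp only [map_smul, _root_.smul_apply, smul_eq_mul]
  ring

theorem sqrt_mul_rpow_le {C a α G : ℝ} (hC : 0 < C) (ha : 0 < a) (hα : 0 < α)
    (h : α⁻¹ ^ 2 * G ≤ C * a) : 1 / √C * √G * a ^ (-(1 / 2) : ℝ) ≤ α := by
  have h1 : G ≤ α ^ 2 * (C * a) := by
    rwa [inv_pow, inv_mul_eq_div, div_le_iff₀' (by positivity)] at h
  have h2 : √G ≤ α * (√C * √a) := by
    rw [← Real.sqrt_mul hC.le]
    exact (Real.sqrt_le_sqrt h1).trans_eq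
      (by rw [Real.sqrt_mul (by positivity), Real.sqrt_sq hα.le])
  have hCs := Real.sqrt_pos.2 hC
  have has := Real.sqrt_pos.2 ha
  rw [Real.rpow_neg ha.le, ← Real.sqrt_eq_rpow]
  calc 1 / √C * √G * (√a)⁻¹ ≤ 1 / √C * (α * (√C * √a)) * (√a)⁻¹ := by gcongr
    _ = α := by field_simp

end KobayashiRoyden

end ConformalDiscs

end

/-! ### The lower bound for both norms. -/

theorem theorem3p1 {n : ℕ} (hn : 2 ≤ n) {M : Type*} [TopologicalSpace M] [T2Space M]
    [ChartedSpace (EuclideanSpace ℝ (Fin n)) M] [IsManifold (𝓡 n) ∞ M]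
    (g : ConformalDiscs.Metric n M) (p : M)
    (x : OpenPartialHomeomorph M (EuclideanSpace ℝ (Fin n)))
    (hx : ConformalDiscs.IsNormalChart g p x 3)
    (hU : ConformalDiscs.IsStrictlyMPSHOn g (fun q => ‖x q‖ ^ 2) x.source)
    (ε B : ℝ) (hε : 0 < ε) (hB : 0 < B) :
    ∃ C : ℝ, 0 < C ∧
      ∀ D : Set M, IsOpen D → IsConnected D → p ∈ D →
      ∀ ρ : M → EReal,
        (∀ q ∈ D, ρ q < 0) →
        ConformalDiscs.IsMPSHOn g ρ D →
        ConformalDiscs.IsMPSHOn g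
          (fun q => ρ q - ((ε * ‖x q‖ ^ 2 : ℝ) : EReal)) (D ∩ x.source) →
        (∀ q ∈ D ∩ x.source, ‖x q‖ < 2 → (ρ q).abs ≤ ENNReal.ofReal B) →
        ∀ w ∈ D ∩ x.source, ‖x w‖ < 1 → ∀ ξ : TangentSpace (𝓡 n) w,
          ENNReal.ofReal (C * Real.sqrt (g.inner w ξ ξ)) * (ρ w).abs ^ (-(1 / 2) : ℝ) ≤
              ConformalDiscs.kobayashiRoyden g D w ξ ∧
          ENNReal.ofReal (C * ‖ConformalDiscs.coordComponents x w ξ‖) *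
              (ρ w).abs ^ (-(1 / 2) : ℝ) ≤
            ConformalDiscs.kobayashiRoyden g D w ξ := by
  have hxa := hx.mem_atlas
  have hT : Metric.closedBall (0 : EuclideanSpace ℝ (Fin n)) 2 ⊆ x.target := by
    rw [hx.target_eq]
    exact Metric.closedBall_subset_ball (by norm_num)
  obtain ⟨C₀, hC₀, hmain⟩ := ConformalDiscs.exists_conformalFactor_le hxa hT hU hε hB
  obtain ⟨m, hm, hlow⟩ :=
    ConformalDiscs.exists_metricForm_lower_bound g hxa (isCompact_closedBall _ _) hT
  -- The Riemannian norm needs only 1/√C₀. The factor √m pays for √m ‖dx(ξ)‖ ≤ |ξ|_g on the closed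
  -- coordinate ball of radius 2.
  refine ⟨min 1 (√m) * (1 / √C₀), by positivity, ?_⟩
  intro D hD _ _ ρ hρ0 hρ hρε hρB w hw hw1 ξ
  obtain ⟨r, hr, hrB⟩ := ConformalDiscs.exists_coe_of_abs_le hB.le (hρB w hw (by linarith))
  have hr0 : r < 0 := by
    have := hρ0 w hw.1
    rw [hr] at this
    exact_mod_cast this
  have ha : 0 < |r| := abs_pos.2 hr0.ne
  have hbound : ∀ s : ℝ, min 1 (√m) * s ≤ √(g.inner w ξ ξ) →
      ENNReal.ofReal (min 1 (√m) * (1 / √C₀) * s) * (ρ w).abs ^ (-(1 / 2) : ℝ) ≤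
        ConformalDiscs.kobayashiRoyden g D w ξ := by
    intro s hs
    rw [hr, EReal.abs_def, ENNReal.ofReal_rpow_of_pos ha,
      ← ENNReal.ofReal_mul' (by positivity)]
    refine ConformalDiscs.ofReal_le_kobayashiRoyden fun u hu hu0 α hα he => ?_
    subst hu0
    have h1 := hmain D hD ρ hρ0 hρ hρε hρB u hu hw.2 hw1 r hr hrB
    rw [he] at h1
    refine le_trans ?_ (ConformalDiscs.sqrt_mul_rpow_le hC₀ ha hα h1)
    refine mul_le_mul_of_nonneg_right ?_ (by positivity)
    calc min 1 (√m) * (1 / √C₀) * s = 1 / √C₀ * (min 1 (√m) * s) := by ring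
      _ ≤ _ := mul_le_mul_of_nonneg_left hs (by positivity)
  refine ⟨hbound _ (mul_le_of_le_one_left (Real.sqrt_nonneg _) (min_le_left _ _)), hbound _ ?_⟩
  have h2 := hlow (x w) (by rw [mem_closedBall_zero_iff]; linarith)
    (ConformalDiscs.coordComponents x w ξ)
  have h3 : ConformalDiscs.metricForm g x (x w) (ConformalDiscs.coordComponents x w ξ)
      (ConformalDiscs.coordComponents x w ξ) = g.inner w ξ ξ :=
    ConformalDiscs.metricForm_chart_apply g hxa hw.2 ξ ξ
  rw [h3] at h2
  calc min 1 (√m) * ‖ConformalDiscs.coordComponents x w ξ‖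
      ≤ √m * ‖ConformalDiscs.coordComponents x w ξ‖ := by
        gcongr
        exact min_le_right _ _
    _ = √(m * ‖ConformalDiscs.coordComponents x w ξ‖ ^ 2) := by
        rw [Real.sqrt_mul hm.le, Real.sqrt_sq (norm_nonneg _)]
    _ ≤ _ := Real.sqrt_le_sqrt h2
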